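/- **Setting.** Composition is written functionally. A *restriction category* is a category with an operation assigning to each $f\colon A\to B$ a map $\bar f\colon A\to A$ such that $f\bar f=f$, $\bar f\bar g=\bar g\bar f$, $\overline{g\bar f}=\bar g\bar f$ (for $f,g$ with common domain) and $\bar g f=f\,\overline{gf}$. A map is *total* if $\bar f=1$; $f\leqslant g$ means $g\bar f=f$; parallel maps are *compatible* if $f\bar g=g\bar f$; $t$ is a *partial inverse* of $s$ if $ts=\bar s$ and $st=\bar t$, and then $s$ is a *partial isomorphism*. A *restriction functor* preserves $\overline{(\ )}$, and is *hyperconnected* if, for each object $A$, it restricts to a bijection between the restriction idempotents (maps $e=\bar e$) of $A$ and of $FA$. A *join restriction category* is one in which every pairwise compatible family of parallel maps (including the empty one) has a join for $\leqslant$, and joins are preserved by precomposition. A *join inverse category* is a restriction category in which every map is a partial isomorphism, pairwise bicompatible families (compatible, with compatible partial inverses) have joins, and joins are preserved by precomposition. A *local homeomorphism* is a total map which is a join of partial isomorphisms. A *local atlas* on $X$ is a family of restriction idempotents $\varphi_{ij}$ of $X$ ($i,j\in I$, $I$ a set) with $\varphi_{ij}=\varphi_{ji}$ and $\varphi_{jk}\varphi_{ij}\leqslant\varphi_{ik}$.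 A category *has local glueings* if each local atlas arises as $\varphi_{ij}=p_j s_i$ from a total map $p=\bigvee_i p_i\colon A\to X$ whose $p_i$ have partial inverses $s_i$. Let $\mathcal C$ be a locally small join restriction category with local glueings. *Partite internal categories.* An $I$-partite internal category $\mathbb A$ in $\mathcal C$ ($I$ a set) has objects $A_i$ and $A_{ij}$, total maps $\sigma_{ij}\colon A_{ij}\to A_i$ and $\tau_{ij}\colon A_{ij}\to A_j$ such that $\sigma_{ij}$ has pullbacks along all total maps, identities $\eta_i\colon A_i\to A_{ii}$ and composition $\mu_{ijk}\colon A_{jk}\times_{A_j}A_{ij}\to A_{ik}$, subject to the source, target, unit and associativity laws. It is *source-étale* if all $\sigma_{ij}$ are local homeomorphisms. It is a *partite internal groupoid* if there are total $\iota_{ij}\colon A_{ij}\to A_{ji}$ with $\iota_{ji}\iota_{ij}=1$, $\sigma_{ji}\iota_{ij}=\tau_{ij}$ and $\mu_{iji}(\iota_{ij},1)=\eta_i\sigma_{ij}$; such a groupoid is *étale* if it is source-étale. A *partite cofunctor* $F\colon\mathbb A\rightsquigarrow\mathbb B$ has a function $i\mapsto Fi$ on components, total maps $F_i\colon B_{Fi}\to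 A_i$ and total maps $F_{ij}\colon A_{ij}\times_{A_i}B_{Fi}\to B_{Fi,Fj}$ with $\sigma F_{ij}=\pi_2$, $F_j\tau F_{ij}=\tau_{ij}\pi_1$, $F_{ii}(\eta_iF_i,1)=\eta_{Fi}$ and (on generalised elements) $F_{ik}(\mu(c,a),b)=\mu\bigl(F_{jk}(c,\tau F_{ij}(a,b)),F_{ij}(a,b)\bigr)$. It is *bijective on components / objects / arrows* if $i\mapsto Fi$ / all $F_i$ / all $F_{ij}$ are invertible. These form a category $\mathrm{pCat}_c(\mathcal C)$, with full subcategories $\mathrm{peCat}_c(\mathcal C)$ of source-étale objects and $\mathrm{pGpd}_c(\mathcal C)$, $\mathrm{peGpd}_c(\mathcal C)$ of groupoids and étale groupoids; $\mathrm{eGpd}_c(\mathcal C)$ consists of the étale groupoids with component set $\{*\}$. A *partite internal functor* $G\colon\mathbb B\to\mathbb A$ has a function $i\mapsto Gi$ on components, total maps $G_i\colon B_i\to A_{Gi}$, and maps $G_{ij}\colon B_{ij}\to A_{Gi,Gj}$ compatible with $\sigma,\tau,\eta,\mu$. It is a *covering functor* if $i\mapsto Gi$ is bijective and each square $\sigma_{Gi,Gj}G_{ij}=G_i\sigma_{ij}$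 is a pullback in $\mathcal C$. Covering functors form the category $\mathrm{pCat}_{\mathrm{cov}}(\mathcal C)$; $\mathrm{peCat}_{\mathrm{cov}}$, $\mathrm{peGpd}_{\mathrm{cov}}$ and $\mathrm{eGpd}_{\mathrm{cov}}$ are its analogues on the objects above. *Restriction categories over $\mathcal C$.* Objects of $\mathrm{rCat}/\!/\mathcal C$ are restriction functors $P\colon\mathcal A\to\mathcal C$; a map $(\mathcal A,P)\to(\mathcal B,Q)$ is a restriction functor $F\colon\mathcal A\to\mathcal B$ with a total natural transformation $\alpha\colon QF\Rightarrow P$. Let $\mathrm{jrCat}/\!/_h\mathcal C$ (resp. $\mathrm{jiCat}/\!/_h\mathcal C$) be the full subcategory with $\mathcal A$ a join restriction (resp. join inverse) category and $P$ hyperconnected. A map $(F,\alpha)$ of either is *localic* if $F$ preserves joins, is bijective on objects, and (i) $Ff\wedge Fg=F(f\wedge g)$ for all parallel $f,g$; (ii) $g=\bigvee_{f\in\mathcal A(i,j)}g\wedge Ff$ for all $g\in\mathcal B(Fi,Fj)$. The functor $\Phi\colon\mathrm{pCat}_c(\mathcal C)\to\mathrm{rCat}/\!/\mathcal C$ sends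 $\mathbb A$ to the category $\Phi\mathbb A$ with objects $i\in I$, with maps $i\to j$ the partial sections $s\colon A_i\to A_{ij}$ (that is, $\sigma_{ij}s=\bar s$), identities $\eta_i$, composites $t*s=\mu_{ijk}(t\tau_{ij},\overline{t\tau_{ij}})s$ and restriction $s\mapsto\eta_i\bar s$, with projection $i\mapsto A_i$, $s\mapsto\tau_{ij}s$; it sends $F$ to $\bigl(i\mapsto Fi,\ s\mapsto F_{ij}(sF_i,\overline{sF_i})\bigr)$ with transformation $(F_i)_i$. The functor $\Phi_g$, defined on $\mathrm{pGpd}_c(\mathcal C)$, takes $\mathbb A$ to the subcategory of $\Phi\mathbb A$ on the partial sections $s$ with $\tau_{ij}s$ a partial isomorphism. *Pseudogroups.* For $X\in\mathcal C$, let $\mathcal I(X)$ be the monoid of partial isomorphisms $X\to X$. A *complete $\mathcal C$-pseudogroup* $(S,X,\theta)$ is a join inverse monoid $S$ (a one-object join inverse category), an object $X\in\mathcal C$ and a monoid homomorphism $\theta\colon S\to\mathcal I(X)$ which is bijective between idempotents. A map $(S,X,\theta)\to(T,Y,\gamma)$ is a homomorphism $f\colon S\to T$ and a total map $g\colon Y\to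 X$ with $\theta(s)g=g\,\gamma(f(s))$ for all $s$. These form $\mathrm{PsGrp}(\mathcal C)$; a map is *localic* if $f$ preserves joins and satisfies (i) and (ii). On $\mathrm{eGpd}_c(\mathcal C)$, $\Phi_g$ gives the functor $\mathbb A\mapsto(\Phi_g\mathbb A(*,*),A_*,\ s\mapsto\tau s)$ to monoids acting by partial automorphisms of objects of $\mathcal C$. **Theorem.** 1. The maps of $\mathrm{pCat}_c(\mathcal C)$ bijective on components and arrows form a subcategory containing all objects, and sending a covering functor $G\colon\mathbb B\to\mathbb A$ to the cofunctor $F\colon\mathbb A\rightsquigarrow\mathbb B$ with $F(Gi)=i$, $F_{Gi}=G_i$ and $F_{Gi,Gj}=(G_{ij},\sigma_{ij})^{-1}\colon A_{Gi,Gj}\times_{A_{Gi}}B_i\to B_{ij}$ is an isomorphism of categories from $\mathrm{pCat}_{\mathrm{cov}}(\mathcal C)^{\mathrm{op}}$ onto it. 2. $\Phi$ restricts to an equivalence $\mathrm{peCat}_c(\mathcal C)\simeq\mathrm{jrCat}/\!/_h\mathcal C$. Under this equivalence (under $\Phi$, and under any left adjoint $\Psi$ of the restricted $\Phi$), cofunctors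 bijective on components correspond to the maps $(F,\alpha)$ with $F$ bijective on objects, those bijective on objects to the maps with $\alpha$ invertible, those bijective on arrows to the maps with $F$ satisfying (i) and (ii), and those bijective on components and arrows to the localic maps. The localic maps form a subcategory $\mathrm{jrCat}/\!/_{h\ell}\mathcal C$ with all objects of $\mathrm{jrCat}/\!/_h\mathcal C$, and the composite of the functor of 1 with $\Phi$ is an equivalence $\mathrm{peCat}_{\mathrm{cov}}(\mathcal C)^{\mathrm{op}}\simeq\mathrm{jrCat}/\!/_{h\ell}\mathcal C$. 3. $\Phi_g$ restricts to an equivalence $\mathrm{peGpd}_c(\mathcal C)\simeq\mathrm{jiCat}/\!/_h\mathcal C$. Under it, the cofunctors bijective on components and arrows correspond to the localic maps; these form a subcategory $\mathrm{jiCat}/\!/_{h\ell}\mathcal C$ with all objects of $\mathrm{jiCat}/\!/_h\mathcal C$, and the composite of the functor of 1 with $\Phi_g$ is an equivalence $\mathrm{peGpd}_{\mathrm{cov}}(\mathcal C)^{\mathrm{op}}\simeq\mathrm{jiCat}/\!/_{h\ell}\mathcal C$. 4. $\Phi_g$ induces an equivalence $\mathrm{eGpd}_c(\mathcal C)\simeq\mathrm{PsGrp}(\mathcal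 C)$. Under it, the cofunctors bijective on (components and) arrows correspond to the localic maps; these form a subcategory $\mathrm{PsGrp}(\mathcal C)_\ell$ with all objects of $\mathrm{PsGrp}(\mathcal C)$, and the composite of the functor of 1 with $\Phi_g$ is an equivalence $\mathrm{eGpd}_{\mathrm{cov}}(\mathcal C)^{\mathrm{op}}\simeq\mathrm{PsGrp}(\mathcal C)_\ell$. -/

import Mathlib

open CategoryTheory CategoryTheory.Limits Opposite

universe w w' w₁ w₂ w₃ v u

namespace EtaleCat

/-! ### Restriction categories

Composition `f ≫ g` is "first `f`, then `g`". -/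

/-- A restriction category: every `f : A ⟶ B` has a restriction `rest f : A ⟶ A`. -/
class RestrictionCategory (C : Type u) [Category.{v} C] where
  rest : ∀ {A B : C}, (A ⟶ B) → (A ⟶ A)
  rest_comp : ∀ {A B : C} (f : A ⟶ B), rest f ≫ f = f
  rest_comm : ∀ {A B D : C} (f : A ⟶ B) (g : A ⟶ D), rest f ≫ rest g = rest g ≫ rest f
  rest_rest_comp : ∀ {A B D : C} (f : A ⟶ B) (g : A ⟶ D),
    rest (rest f ≫ g) = rest f ≫ rest g
  comp_rest : ∀ {A B D : C} (f : A ⟶ B) (g : B ⟶ D), f ≫ rest g = rest (f ≫ g) ≫ f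

open RestrictionCategory

section Restriction

variable {C : Type u} [Category.{v} C] [RestrictionCategory C]

/-- A map is total if its restriction is an identity. -/
def Total {A B : C} (f : A ⟶ B) : Prop := rest f = 𝟙 A

/-- Restriction idempotents of `A`: the maps of the form `rest f`, equivalently the maps which are
their own restriction. -/
def restIdem (A : C) : Set (A ⟶ A) := {e | rest e = e}

/-- The canonical partial order on a hom-set. -/
def RLe {A B : C} (f g : A ⟶ B) : Prop := rest f ≫ g = f

/-- The compatibility relation on a hom-set. -/
def Compatible {A B : C} (f g : A ⟶ B) : Prop := rest g ≫ f = rest f ≫ g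

/-- `j` is the join of the family `S` for the canonical order. -/
def IsJoin {A B : C} (S : Set (A ⟶ B)) (j : A ⟶ B) : Prop :=
  (∀ f ∈ S, RLe f j) ∧ ∀ k, (∀ f ∈ S, RLe f k) → RLe j k

/-- `m` is the meet of `f` and `g` for the canonical order. -/
def IsMeet {A B : C} (f g m : A ⟶ B) : Prop :=
  RLe m f ∧ RLe m g ∧ ∀ k, RLe k f → RLe k g → RLe k m

/-- `t` is a partial inverse of `s`. -/
def PartialInverse {A B : C} (s : A ⟶ B) (t : B ⟶ A) : Prop :=
  s ≫ t = rest s ∧ t ≫ s = rest t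

/-- Partial isomorphisms. -/
def PartialIso {A B : C} (s : A ⟶ B) : Prop := ∃ t, PartialInverse s t

/-- Local homeomorphisms: total maps which are joins of partial isomorphisms. -/
def LocalHomeo {A B : C} (p : A ⟶ B) : Prop :=
  Total p ∧ ∃ S : Set (A ⟶ B), (∀ s ∈ S, PartialIso s) ∧ IsJoin S p

theorem rest_id (A : C) : rest (𝟙 A) = 𝟙 A := by
  simpa using rest_comp (𝟙 A)

theorem rest_rest {A B : C} (f : A ⟶ B) : rest (rest f) = rest f := by
  have := rest_rest_comp f (𝟙 A)
  simpa [rest_id] using this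

theorem rest_idem {A B : C} (f : A ⟶ B) : rest f ≫ rest f = rest f := by
  rw [← rest_rest_comp, rest_comp]

theorem rest_comp_rest {A B D : C} (f : A ⟶ B) (g : B ⟶ D) :
    rest (f ≫ rest g) = rest (f ≫ g) := by
  rw [comp_rest, rest_rest_comp, rest_comm, ← rest_rest_comp, ← Category.assoc, rest_comp]

theorem rest_comp_total {A B D : C} (f : A ⟶ B) {g : B ⟶ D} (hg : Total g) :
    rest (f ≫ g) = rest f := by
  rw [← rest_comp_rest, hg, Category.comp_id]

theorem Total.id (A : C) : Total (𝟙 A) := rest_id A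

theorem Total.comp {A B D : C} {f : A ⟶ B} {g : B ⟶ D} (hf : Total f) (hg : Total g) :
    Total (f ≫ g) := (rest_comp_total f hg).trans hf

theorem Total.of_comp {A B D : C} {f : A ⟶ B} {g : B ⟶ D} (h : Total (f ≫ g)) : Total f := by
  unfold Total at *
  have : rest (f ≫ g) ≫ rest f = rest (f ≫ g) := by
    rw [rest_comm, ← rest_rest_comp, ← Category.assoc, rest_comp]
  rwa [h, Category.id_comp] at this

theorem rest_le {A B D : C} (f : A ⟶ B) (g : B ⟶ D) :
    rest (f ≫ g) ≫ rest f = rest (f ≫ g) := by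
  rw [rest_comm, ← rest_rest_comp, ← Category.assoc, rest_comp]

theorem total_fst {X Y Z : C} (f : X ⟶ Z) (g : Y ⟶ Z) [HasPullback f g]
    (hf : Total f) (hg : Total g) : Total (pullback.fst f g) := by
  have h : rest (pullback.fst f g) = rest (pullback.snd f g) := by
    rw [← rest_comp_total _ hf, pullback.condition, rest_comp_total _ hg]
  apply pullback.hom_ext
  · rw [rest_comp, Category.id_comp]
  · rw [h, rest_comp, Category.id_comp]

theorem total_snd {X Y Z : C} (f : X ⟶ Z) (g : Y ⟶ Z) [HasPullback f g]
    (hf : Total f) (hg : Total g) : Total (pullback.snd f g) := by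
  have h : rest (pullback.fst f g) = rest (pullback.snd f g) := by
    rw [← rest_comp_total _ hf, pullback.condition, rest_comp_total _ hg]
  rw [Total, ← h]; exact total_fst f g hf hg

theorem PartialInverse.comp {A B D : C} {s : A ⟶ B} {s' : B ⟶ A} {t : B ⟶ D} {t' : D ⟶ B}
    (h : PartialInverse s s') (k : PartialInverse t t') :
    PartialInverse (s ≫ t) (t' ≫ s') := by
  constructor
  · rw [Category.assoc, reassoc_of% k.1, ← Category.assoc, comp_rest, Category.assoc, h.1, rest_le]
  · rw [Category.assoc, reassoc_of% h.2, ← Category.assoc, comp_rest, Category.assoc, k.2, rest_le]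

theorem PartialIso.comp {A B D : C} {s : A ⟶ B} {t : B ⟶ D}
    (h : PartialIso s) (k : PartialIso t) : PartialIso (s ≫ t) := by
  obtain ⟨s', h⟩ := h
  obtain ⟨t', k⟩ := k
  exact ⟨_, h.comp k⟩

theorem PartialIso.rest {A B : C} (f : A ⟶ B) : PartialIso (RestrictionCategory.rest f) :=
  ⟨RestrictionCategory.rest f, by simp [PartialInverse, rest_idem, rest_rest]⟩

theorem PartialIso.id (A : C) : PartialIso (𝟙 A) := rest_id A ▸ PartialIso.rest (𝟙 A)

end Restriction

/-- Join restriction categories: pairwise compatible families of parallel maps have joins, and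
these are preserved by precomposition. -/
class JoinRestriction (C : Type u) [Category.{v} C] [RestrictionCategory C] : Prop where
  exists_join : ∀ {A B : C} (S : Set (A ⟶ B)),
    (∀ f ∈ S, ∀ g ∈ S, Compatible f g) → ∃ j, IsJoin S j
  comp_join : ∀ {A' A B : C} (g : A' ⟶ A) (S : Set (A ⟶ B)) (j : A ⟶ B),
    IsJoin S j → IsJoin ((fun f => g ≫ f) '' S) (g ≫ j)

/-- Parallel partial isomorphisms are bicompatible if they are compatible and so are their
partial inverses. -/
def Bicompatible {C : Type u} [Category.{v} C] [RestrictionCategory C] {A B : C}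
    (s t : A ⟶ B) : Prop :=
  Compatible s t ∧ ∀ s' t', PartialInverse s s' → PartialInverse t t' → Compatible s' t'

/-- Join inverse categories, seen as restriction categories: every map is a partial isomorphism,
pairwise bicompatible families have joins, and these are preserved by precomposition. -/
class JoinInverse (C : Type u) [Category.{v} C] [RestrictionCategory C] : Prop where
  partialIso : ∀ {A B : C} (s : A ⟶ B), PartialIso s
  exists_join : ∀ {A B : C} (S : Set (A ⟶ B)),
    (∀ f ∈ S, ∀ g ∈ S, Bicompatible f g) → ∃ j, IsJoin S j
  comp_join : ∀ {A' A B : C} (g : A' ⟶ A) (S : Set (A ⟶ B)) (j : A ⟶ B),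
    IsJoin S j → IsJoin ((fun f => g ≫ f) '' S) (g ≫ j)

/-- Local atlases on `X`. -/
def IsLocalAtlas {C : Type u} [Category.{v} C] [RestrictionCategory C] {X : C} {I : Type w}
    (φ : I → I → (X ⟶ X)) : Prop :=
  (∀ i j, φ i j ∈ restIdem X) ∧ (∀ i j, φ i j = φ j i) ∧
    ∀ i j k, RLe (φ i j ≫ φ j k) (φ i k)

/-- `C` has local glueings: every local atlas, indexed by a set of the size of the hom-sets, is
induced by a local homeomorphism `p = ⋁ pᵢ` whose components `pᵢ` have partial inverses `sᵢ`. -/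
class HasLocalGlueings (C : Type u) [Category.{v} C] [RestrictionCategory C] : Prop where
  exists_glueing : ∀ {X : C} {I : Type v} (φ : I → I → (X ⟶ X)), IsLocalAtlas φ →
    ∃ (A : C) (p : A ⟶ X) (q : I → (A ⟶ X)) (s : I → (X ⟶ A)),
      Total p ∧ IsJoin (Set.range q) p ∧ (∀ i, PartialInverse (q i) (s i)) ∧
        ∀ i j, φ i j = s i ≫ q j

/-! ### Partite internal categories -/

/-- The underlying graph of an `I`-partite internal category. -/
structure PartiteGraph (I : Type w) (C : Type u) [Category.{v} C] [RestrictionCategory C] where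
  obj : I → C
  arr : I → I → C
  src : ∀ i j, arr i j ⟶ obj i
  tgt : ∀ i j, arr i j ⟶ obj j
  src_total : ∀ i j, Total (src i j)
  tgt_total : ∀ i j, Total (tgt i j)
  hasPullback : ∀ i j {Y : C} (f : Y ⟶ obj i), Total f → HasPullback (src i j) f

section

variable {C : Type u} [Category.{v} C] [RestrictionCategory C]
variable {I : Type w₁} {J : Type w₂} {K : Type w₃}

instance (A : PartiteGraph I C) (i j k : I) : HasPullback (A.src j k) (A.tgt i j) :=
  A.hasPullback j k _ (A.tgt_total i j)

/-- The fibre product of `arr j k` and `arr i j` over `obj j`. -/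
noncomputable def PartiteGraph.fib (A : PartiteGraph I C) (i j k : I) : C :=
  pullback (A.src j k) (A.tgt i j)

/-- First projection from `fib`. -/
noncomputable def PartiteGraph.fibFst (A : PartiteGraph I C) (i j k : I) :
    A.fib i j k ⟶ A.arr j k := pullback.fst (A.src j k) (A.tgt i j)

/-- Second projection from `fib`. -/
noncomputable def PartiteGraph.fibSnd (A : PartiteGraph I C) (i j k : I) :
    A.fib i j k ⟶ A.arr i j := pullback.snd (A.src j k) (A.tgt i j)

/-- The map into `fib` with given projections. -/
noncomputable def PartiteGraph.fibLift (A : PartiteGraph I C) {i j k : I} {T : C}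
    (c : T ⟶ A.arr j k) (a : T ⟶ A.arr i j) (h : c ≫ A.src j k = a ≫ A.tgt i j) :
    T ⟶ A.fib i j k := pullback.lift c a h

section

variable (A : PartiteGraph I C) {i j k : I} {T : C}

@[simp]
theorem PartiteGraph.fibLift_fst (c : T ⟶ A.arr j k) (a : T ⟶ A.arr i j)
    (h : c ≫ A.src j k = a ≫ A.tgt i j) : A.fibLift c a h ≫ A.fibFst i j k = c :=
  pullback.lift_fst _ _ _

@[simp]
theorem PartiteGraph.fibLift_snd (c : T ⟶ A.arr j k) (a : T ⟶ A.arr i j)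
    (h : c ≫ A.src j k = a ≫ A.tgt i j) : A.fibLift c a h ≫ A.fibSnd i j k = a :=
  pullback.lift_snd _ _ _

@[simp]
theorem PartiteGraph.fibLift_fst_assoc {X : C} (c : T ⟶ A.arr j k) (a : T ⟶ A.arr i j)
    (h : c ≫ A.src j k = a ≫ A.tgt i j) (x : A.arr j k ⟶ X) :
    A.fibLift c a h ≫ A.fibFst i j k ≫ x = c ≫ x :=
  pullback.lift_fst_assoc _ _ _ _

@[simp]
theorem PartiteGraph.fibLift_snd_assoc {X : C} (c : T ⟶ A.arr j k) (a : T ⟶ A.arr i j)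
    (h : c ≫ A.src j k = a ≫ A.tgt i j) (x : A.arr i j ⟶ X) :
    A.fibLift c a h ≫ A.fibSnd i j k ≫ x = a ≫ x :=
  pullback.lift_snd_assoc _ _ _ _

theorem PartiteGraph.fib_condition (i j k : I) :
    A.fibFst i j k ≫ A.src j k = A.fibSnd i j k ≫ A.tgt i j :=
  pullback.condition

theorem PartiteGraph.fib_hom_ext {x y : T ⟶ A.fib i j k}
    (h : x ≫ A.fibFst i j k = y ≫ A.fibFst i j k) (h' : x ≫ A.fibSnd i j k = y ≫ A.fibSnd i j k) :
    x = y := pullback.hom_ext h h'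

end

/-- Identities and composition, compatible with source and target. -/
structure PrePartiteCat (I : Type w) (C : Type u) [Category.{v} C] [RestrictionCategory C]
    extends PartiteGraph I C where
  ident : ∀ i, obj i ⟶ arr i i
  ident_src : ∀ i, ident i ≫ src i i = 𝟙 (obj i)
  ident_tgt : ∀ i, ident i ≫ tgt i i = 𝟙 (obj i)
  mul : ∀ i j k, toPartiteGraph.fib i j k ⟶ arr i k
  mul_src : ∀ i j k, mul i j k ≫ src i k = toPartiteGraph.fibSnd i j k ≫ src i j
  mul_tgt : ∀ i j k, mul i j k ≫ tgt i k = toPartiteGraph.fibFst i j k ≫ tgt j k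

/-- The composite `μ ∘ (c, a)` of generalised elements `c` and `a` of objects of arrows. -/
noncomputable def PrePartiteCat.mu (A : PrePartiteCat I C) {T : C} {i j k : I}
    (c : T ⟶ A.arr j k) (a : T ⟶ A.arr i j) (h : c ≫ A.src j k = a ≫ A.tgt i j) :
    T ⟶ A.arr i k :=
  A.fibLift c a h ≫ A.mul i j k

theorem PrePartiteCat.mu_src (A : PrePartiteCat I C) {T : C} {i j k : I}
    (c : T ⟶ A.arr j k) (a : T ⟶ A.arr i j) (h : c ≫ A.src j k = a ≫ A.tgt i j) :
    A.mu c a h ≫ A.src i k = a ≫ A.src i j := by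
  simp [PrePartiteCat.mu, A.mul_src]

theorem PrePartiteCat.mu_tgt (A : PrePartiteCat I C) {T : C} {i j k : I}
    (c : T ⟶ A.arr j k) (a : T ⟶ A.arr i j) (h : c ≫ A.src j k = a ≫ A.tgt i j) :
    A.mu c a h ≫ A.tgt i k = c ≫ A.tgt j k := by
  simp [PrePartiteCat.mu, A.mul_tgt]

/-- An `I`-partite internal category in `C`. Associativity is stated on the generalised elements
of the triple fibre product; the latter exists, so this says that the two maps out of it agree. -/
structure PartiteCat (I : Type w) (C : Type u) [Category.{v} C] [RestrictionCategory C]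
    extends PrePartiteCat I C where
  unit_left : ∀ i j, toPrePartiteCat.mu (tgt i j ≫ ident j) (𝟙 (arr i j))
    (by rw [Category.assoc, ident_src, Category.comp_id, Category.id_comp]) = 𝟙 (arr i j)
  unit_right : ∀ i j, toPrePartiteCat.mu (𝟙 (arr i j)) (src i j ≫ ident i)
    (by rw [Category.assoc, ident_tgt, Category.comp_id, Category.id_comp]) = 𝟙 (arr i j)
  assoc : ∀ {T : C} {i j k l : I} (c : T ⟶ arr k l) (b : T ⟶ arr j k) (a : T ⟶ arr i j)
    (h : c ≫ src k l = b ≫ tgt j k) (h' : b ≫ src j k = a ≫ tgt i j),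
    toPrePartiteCat.mu c (toPrePartiteCat.mu b a h')
        (h.trans (toPrePartiteCat.mu_tgt b a h').symm) =
      toPrePartiteCat.mu (toPrePartiteCat.mu c b h) a
        ((toPrePartiteCat.mu_src c b h).trans h')

/-- The source maps are local homeomorphisms. -/
def PartiteCat.SourceEtale (A : PartiteCat I C) : Prop := ∀ i j, LocalHomeo (A.src i j)

/-- Partite internal groupoids. -/
def PartiteCat.IsGroupoid (A : PartiteCat I C) : Prop :=
  ∃ ι : ∀ i j, A.arr i j ⟶ A.arr j i,
    (∀ i j, Total (ι i j)) ∧ (∀ i j, ι i j ≫ ι j i = 𝟙 _) ∧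
    ∃ h : ∀ i j, ι i j ≫ A.src j i = A.tgt i j,
      ∀ i j, A.mu (ι i j) (𝟙 (A.arr i j)) ((h i j).trans (Category.id_comp _).symm) =
        A.src i j ≫ A.ident i

theorem PrePartiteCat.comp_mu (A : PrePartiteCat I C) {S T : C} {i j k : I} (t : S ⟶ T)
    (c : T ⟶ A.arr j k) (a : T ⟶ A.arr i j) (h : c ≫ A.src j k = a ≫ A.tgt i j) :
    t ≫ A.mu c a h = A.mu (t ≫ c) (t ≫ a) (by simp [h]) := by
  rw [PrePartiteCat.mu, ← Category.assoc]
  congr 1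
  apply A.fib_hom_ext <;> simp

theorem PrePartiteCat.mu_congr (A : PrePartiteCat I C) {T : C} {i j k : I}
    {c c' : T ⟶ A.arr j k} {a a' : T ⟶ A.arr i j} (h : c ≫ A.src j k = a ≫ A.tgt i j)
    (hc : c = c') (ha : a = a') : A.mu c a h = A.mu c' a' (hc ▸ ha ▸ h) := by
  subst hc ha; rfl

theorem PrePartiteCat.rest_mu (A : PrePartiteCat I C) {T : C} {i j k : I}
    (c : T ⟶ A.arr j k) (a : T ⟶ A.arr i j) (h : c ≫ A.src j k = a ≫ A.tgt i j) :
    rest (A.mu c a h) = rest a := by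
  rw [← rest_comp_total _ (A.src_total i k), A.mu_src, rest_comp_total _ (A.src_total i j)]

theorem PartiteCat.mu_unit_left (A : PartiteCat I C) {T : C} {i j : I} (a : T ⟶ A.arr i j)
    (c : T ⟶ A.arr j j) (hc : c = a ≫ A.tgt i j ≫ A.ident j) (h) : A.mu c a h = a := by
  subst hc
  have := A.comp_mu a _ _ (by rw [Category.assoc, A.ident_src, Category.comp_id,
    Category.id_comp] : (A.tgt i j ≫ A.ident j) ≫ A.src j j = 𝟙 (A.arr i j) ≫ A.tgt i j)
  rw [A.unit_left] at this
  exact (A.mu_congr _ rfl (Category.comp_id a).symm).trans (this.symm.trans (Category.comp_id a))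

theorem PartiteCat.mu_unit_right (A : PartiteCat I C) {T : C} {i j : I} (c : T ⟶ A.arr i j)
    (a : T ⟶ A.arr i i) (ha : a = c ≫ A.src i j ≫ A.ident i) (h) : A.mu c a h = c := by
  subst ha
  have := A.comp_mu c _ _ (by rw [Category.assoc, A.ident_tgt, Category.comp_id,
    Category.id_comp] : 𝟙 (A.arr i j) ≫ A.src i j = (A.src i j ≫ A.ident i) ≫ A.tgt i i)
  rw [A.unit_right] at this
  exact (A.mu_congr _ (Category.comp_id c).symm rfl).trans (this.symm.trans (Category.comp_id c))

/-! ### Partite cofunctors -/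

/-- Action on components and objects of a partite cofunctor. -/
structure CofunctorBase (A : PartiteCat I C) (B : PartiteCat J C) where
  comp : I → J
  onObj : ∀ i, B.obj (comp i) ⟶ A.obj i
  onObj_total : ∀ i, Total (onObj i)

instance {A : PartiteCat I C} {B : PartiteCat J C} (F : CofunctorBase A B) (i j : I) :
    HasPullback (A.src i j) (F.onObj i) :=
  A.hasPullback i j _ (F.onObj_total i)

section

variable {A : PartiteCat I C} {B : PartiteCat J C} (F : CofunctorBase A B)

/-- The fibre product of `A.arr i j` and `B.obj (F.comp i)` over `A.obj i`. -/
noncomputable def CofunctorBase.fib (i j : I) : C := pullback (A.src i j) (F.onObj i)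

/-- First projection from `fib`. -/
noncomputable def CofunctorBase.fibFst (i j : I) : F.fib i j ⟶ A.arr i j :=
  pullback.fst (A.src i j) (F.onObj i)

/-- Second projection from `fib`. -/
noncomputable def CofunctorBase.fibSnd (i j : I) : F.fib i j ⟶ B.obj (F.comp i) :=
  pullback.snd (A.src i j) (F.onObj i)

variable {i j : I} {T : C}

/-- The map into `fib` with given projections. -/
noncomputable def CofunctorBase.fibLift (a : T ⟶ A.arr i j) (b : T ⟶ B.obj (F.comp i))
    (h : a ≫ A.src i j = b ≫ F.onObj i) : T ⟶ F.fib i j := pullback.lift a b h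

@[simp]
theorem CofunctorBase.fibLift_fst (a : T ⟶ A.arr i j) (b : T ⟶ B.obj (F.comp i))
    (h : a ≫ A.src i j = b ≫ F.onObj i) : F.fibLift a b h ≫ F.fibFst i j = a :=
  pullback.lift_fst _ _ _

@[simp]
theorem CofunctorBase.fibLift_snd (a : T ⟶ A.arr i j) (b : T ⟶ B.obj (F.comp i))
    (h : a ≫ A.src i j = b ≫ F.onObj i) : F.fibLift a b h ≫ F.fibSnd i j = b :=
  pullback.lift_snd _ _ _

@[simp]
theorem CofunctorBase.fibLift_fst_assoc {X : C} (a : T ⟶ A.arr i j) (b : T ⟶ B.obj (F.comp i))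
    (h : a ≫ A.src i j = b ≫ F.onObj i) (x : A.arr i j ⟶ X) :
    F.fibLift a b h ≫ F.fibFst i j ≫ x = a ≫ x :=
  pullback.lift_fst_assoc _ _ _ _

@[simp]
theorem CofunctorBase.fibLift_snd_assoc {X : C} (a : T ⟶ A.arr i j) (b : T ⟶ B.obj (F.comp i))
    (h : a ≫ A.src i j = b ≫ F.onObj i) (x : B.obj (F.comp i) ⟶ X) :
    F.fibLift a b h ≫ F.fibSnd i j ≫ x = b ≫ x :=
  pullback.lift_snd_assoc _ _ _ _

theorem CofunctorBase.fib_condition (i j : I) :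
    F.fibFst i j ≫ A.src i j = F.fibSnd i j ≫ F.onObj i := pullback.condition

theorem CofunctorBase.fib_hom_ext {x y : T ⟶ F.fib i j}
    (h : x ≫ F.fibFst i j = y ≫ F.fibFst i j) (h' : x ≫ F.fibSnd i j = y ≫ F.fibSnd i j) :
    x = y := pullback.hom_ext h h'

end

/-- Action on arrows, compatible with source and target. The map `onArr i j` is total by
`onArr_src`. -/
structure PreCofunctor (A : PartiteCat I C) (B : PartiteCat J C) extends CofunctorBase A B where
  onArr : ∀ i j, toCofunctorBase.fib i j ⟶ B.arr (comp i) (comp j)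
  onArr_src : ∀ i j, onArr i j ≫ B.src (comp i) (comp j) = toCofunctorBase.fibSnd i j
  onArr_tgt : ∀ i j, onArr i j ≫ B.tgt (comp i) (comp j) ≫ onObj j =
    toCofunctorBase.fibFst i j ≫ A.tgt i j

/-- The composite `F_ij ∘ (a, b)` for generalised elements `a` of `A_ij` and `b` of `B_Fi`. -/
noncomputable def PreCofunctor.act {A : PartiteCat I C} {B : PartiteCat J C}
    (F : PreCofunctor A B) {T : C} {i j : I} (a : T ⟶ A.arr i j) (b : T ⟶ B.obj (F.comp i))
    (h : a ≫ A.src i j = b ≫ F.onObj i) : T ⟶ B.arr (F.comp i) (F.comp j) :=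
  F.fibLift a b h ≫ F.onArr i j

namespace PreCofunctor

variable {A : PartiteCat I C} {B : PartiteCat J C} (F : PreCofunctor A B) {T : C} {i j : I}

theorem act_src (a : T ⟶ A.arr i j) (b : T ⟶ B.obj (F.comp i))
    (h : a ≫ A.src i j = b ≫ F.onObj i) : F.act a b h ≫ B.src _ _ = b := by
  simp [PreCofunctor.act, F.onArr_src]

theorem act_tgt (a : T ⟶ A.arr i j) (b : T ⟶ B.obj (F.comp i))
    (h : a ≫ A.src i j = b ≫ F.onObj i) :
    (F.act a b h ≫ B.tgt _ _) ≫ F.onObj j = a ≫ A.tgt i j := by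
  simp [PreCofunctor.act, F.onArr_tgt]

theorem comp_act {S : C} (t : S ⟶ T) (a : T ⟶ A.arr i j) (b : T ⟶ B.obj (F.comp i))
    (h : a ≫ A.src i j = b ≫ F.onObj i) :
    t ≫ F.act a b h = F.act (t ≫ a) (t ≫ b) (by simp [h]) := by
  rw [PreCofunctor.act, ← Category.assoc]
  congr 1
  apply F.fib_hom_ext <;> simp

theorem act_congr {a a' : T ⟶ A.arr i j} {b b' : T ⟶ B.obj (F.comp i)}
    (h : a ≫ A.src i j = b ≫ F.onObj i) (ha : a = a') (hb : b = b') :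
    F.act a b h = F.act a' b' (ha ▸ hb ▸ h) := by
  subst ha hb; rfl

theorem act_self (h) : F.act (F.fibFst i j) (F.fibSnd i j) h =
    F.onArr i j := by
  rw [PreCofunctor.act]
  convert Category.id_comp _
  apply F.fib_hom_ext <;> simp

theorem rest_act (a : T ⟶ A.arr i j) (b : T ⟶ B.obj (F.comp i))
    (h : a ≫ A.src i j = b ≫ F.onObj i) : rest (F.act a b h) = rest b := by
  rw [← rest_comp_total _ (B.src_total _ _), F.act_src]

end PreCofunctor

/-- A partite cofunctor from `A` to `B`. The composition axiom is stated on the generalised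
elements of the fibre product of `A_jk`, `A_ij` and `B_Fi`; the latter exists, so this says that
the two maps out of it agree. -/
structure Cofunctor (A : PartiteCat I C) (B : PartiteCat J C) extends PreCofunctor A B where
  act_ident : ∀ i, toPreCofunctor.act (onObj i ≫ A.ident i) (𝟙 (B.obj (comp i)))
    (by rw [Category.assoc, A.ident_src, Category.comp_id, Category.id_comp]) =
      B.ident (comp i)
  act_mu : ∀ {T : C} {i j k : I} (c : T ⟶ A.arr j k) (a : T ⟶ A.arr i j)
    (b : T ⟶ B.obj (comp i)) (h : c ≫ A.src j k = a ≫ A.tgt i j)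
    (h' : a ≫ A.src i j = b ≫ onObj i),
    toPreCofunctor.act (A.mu c a h) b ((A.mu_src c a h).trans h') =
      B.mu (toPreCofunctor.act c (toPreCofunctor.act a b h' ≫ B.tgt _ _)
          (h.trans (toPreCofunctor.act_tgt a b h').symm))
        (toPreCofunctor.act a b h') (toPreCofunctor.act_src _ _ _)

/-- The components and object maps of the identity cofunctor. -/
def CofunctorBase.id (A : PartiteCat I C) : CofunctorBase A A where
  comp i := i
  onObj i := 𝟙 _
  onObj_total i := Total.id _

/-- The identity cofunctor. -/
noncomputable def Cofunctor.id (A : PartiteCat I C) : Cofunctor A A where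
  toCofunctorBase := CofunctorBase.id A
  onArr i j := (CofunctorBase.id A).fibFst i j
  onArr_src i j := ((CofunctorBase.id A).fib_condition i j).trans (Category.comp_id _)
  onArr_tgt i j := congrArg _ (Category.comp_id _)
  act_ident i := ((CofunctorBase.id A).fibLift_fst _ _ _).trans (Category.id_comp _)
  act_mu c a b h h' := by
    have key : ∀ {T : C} {i j : I} (a : T ⟶ A.arr i j) (b : T ⟶ A.obj i)
      (h : a ≫ A.src i j = b ≫ 𝟙 (A.obj i)),
      (CofunctorBase.id A).fibLift a b h ≫ (CofunctorBase.id A).fibFst i j = a :=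
      fun a b h => (CofunctorBase.id A).fibLift_fst a b h
    refine (key _ _ _).trans ?_
    apply A.mu_congr
    · exact (key _ _ _).symm
    · exact (key _ _ _).symm

theorem Cofunctor.id_act (A : PartiteCat I C) {T : C} {i j : I} (a : T ⟶ A.arr i j)
    (b : T ⟶ A.obj i) (h : a ≫ A.src i j = b ≫ (Cofunctor.id A).onObj i) :
    (Cofunctor.id A).act a b h = a :=
  (CofunctorBase.id A).fibLift_fst a b h

/-- The components and object maps of a composite cofunctor. -/
def CofunctorBase.comp' {A : PartiteCat I C} {B : PartiteCat J C} {D : PartiteCat K C}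
    (F : CofunctorBase A B) (G : CofunctorBase B D) : CofunctorBase A D where
  comp i := G.comp (F.comp i)
  onObj i := G.onObj (F.comp i) ≫ F.onObj i
  onObj_total i := (G.onObj_total _).comp (F.onObj_total _)

section

variable {A : PartiteCat I C} {B : PartiteCat J C} {D : PartiteCat K C}
variable (F : Cofunctor A B) (G : Cofunctor B D)

/-- The action of a composite cofunctor on generalised elements. -/
noncomputable def Cofunctor.act₂ {T : C} {i j : I} (a : T ⟶ A.arr i j)
    (b : T ⟶ D.obj (G.comp (F.comp i)))
    (h : a ≫ A.src i j = (b ≫ G.onObj (F.comp i)) ≫ F.onObj i) :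
    T ⟶ D.arr (G.comp (F.comp i)) (G.comp (F.comp j)) :=
  G.act (F.act a (b ≫ G.onObj (F.comp i)) h) b (F.act_src _ _ _)

/-- The composite of two cofunctors before checking the identity and composition axioms. -/
noncomputable def Cofunctor.preComp : PreCofunctor A D where
  toCofunctorBase := F.toCofunctorBase.comp' G.toCofunctorBase
  onArr i j := F.act₂ G ((F.comp' G.toCofunctorBase).fibFst i j)
    ((F.comp' G.toCofunctorBase).fibSnd i j)
    (((F.comp' G.toCofunctorBase).fib_condition i j).trans (Category.assoc _ _ _).symm)
  onArr_src i j := G.act_src _ _ _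
  onArr_tgt i j := by
    refine Eq.trans ?_ (F.act_tgt _ ((F.comp' G.toCofunctorBase).fibSnd i j ≫ G.onObj _)
      (((F.comp' G.toCofunctorBase).fib_condition i j).trans (Category.assoc _ _ _).symm))
    refine Eq.trans ?_ (congrArg (· ≫ F.onObj j)
      (G.act_tgt _ ((F.comp' G.toCofunctorBase).fibSnd i j) (F.act_src _ _ _)))
    exact ((Category.assoc _ _ _).trans (Category.assoc _ _ _)).symm

theorem Cofunctor.preComp_act {T : C} {i j : I} (a : T ⟶ A.arr i j)
    (b : T ⟶ D.obj (G.comp (F.comp i)))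
    (h : a ≫ A.src i j = b ≫ G.onObj (F.comp i) ≫ F.onObj i) :
    (F.preComp G).act a b h = F.act₂ G a b (h.trans (Category.assoc _ _ _).symm) := by
  have e₁ := (F.comp' G.toCofunctorBase).fibLift_fst a b h
  have e₂ := (F.comp' G.toCofunctorBase).fibLift_snd a b h
  refine (G.comp_act ((F.comp' G.toCofunctorBase).fibLift a b h) _ _ _).trans ?_
  refine G.act_congr _ ((F.comp_act _ _ _ _).trans (F.act_congr _ e₁ ?_)) e₂
  exact (Category.assoc _ _ _).symm.trans (congrArg (· ≫ G.onObj (F.comp i)) e₂)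

/-- Composition of cofunctors: first `F`, then `G`. -/
noncomputable def Cofunctor.comp' : Cofunctor A D where
  toPreCofunctor := F.preComp G
  act_ident i := by
    refine (F.preComp_act G _ _ _).trans ?_
    refine Eq.trans ?_ (G.act_ident (F.comp i))
    refine G.act_congr _ ?_ rfl
    rw [← F.act_ident, F.comp_act]
    exact F.act_congr _ (Category.assoc _ _ _)
      ((Category.id_comp _).trans (Category.comp_id _).symm)
  act_mu c a b h h' := by
    refine (F.preComp_act G _ _ _).trans ?_
    refine (G.act_congr _ (F.act_mu c a (b ≫ G.onObj _) h
      (h'.trans (Category.assoc _ _ _).symm)) rfl).trans ?_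
    refine (G.act_mu _ _ b _ (F.act_src _ _ _)).trans ?_
    have e : F.act₂ G a b (h'.trans (Category.assoc _ _ _).symm) = (F.preComp G).act a b h' :=
      (F.preComp_act G a b h').symm
    refine D.mu_congr _ ?_ e
    refine Eq.trans ?_ (F.preComp_act G _ _ _).symm
    refine G.act_congr _ (F.act_congr _ rfl ?_) (congrArg (· ≫ D.tgt _ _) e)
    refine Eq.trans (G.act_tgt _ b (F.act_src _ _ _)).symm ?_
    exact congrArg (fun x => (x ≫ D.tgt _ _) ≫ G.onObj _) e

theorem Cofunctor.comp'_act {T : C} {i j : I} (a : T ⟶ A.arr i j)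
    (b : T ⟶ D.obj (G.comp (F.comp i)))
    (h : a ≫ A.src i j = b ≫ G.onObj (F.comp i) ≫ F.onObj i) :
    (F.comp' G).act a b h = F.act₂ G a b (h.trans (Category.assoc _ _ _).symm) :=
  F.preComp_act G a b h

end

/-- Cofunctors with the same action on components, objects and generalised elements agree. -/
theorem Cofunctor.ext_act {A : PartiteCat I C} {B : PartiteCat J C} {F G : Cofunctor A B}
    (hc : ∀ i, F.comp i = G.comp i)
    (ho : ∀ i, F.onObj i = eqToHom (congrArg B.obj (hc i)) ≫ G.onObj i)
    (ha : ∀ {T : C} (i j : I) (a : T ⟶ A.arr i j) (b : T ⟶ B.obj (F.comp i)) (h h'),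
      F.act a b h = G.act a (b ≫ eqToHom (congrArg B.obj (hc i))) h' ≫
        eqToHom (congrArg₂ B.arr (hc i) (hc j)).symm) : F = G := by
  obtain ⟨⟨⟨fc, fo, ft⟩, fa, fs, fg⟩, fi, fm⟩ := F
  obtain ⟨⟨⟨gc, go, gt⟩, ga, gs, gg⟩, gi, gm⟩ := G
  obtain rfl : fc = gc := funext hc
  obtain rfl : fo = go := funext fun i => (ho i).trans (by simp)
  obtain rfl : fa = ga := by
    funext i j
    have := ha i j ((CofunctorBase.mk fc fo ft).fibFst i j) ((CofunctorBase.mk fc fo ft).fibSnd i j)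
      (CofunctorBase.fib_condition _ _ _)
      (by simpa using (CofunctorBase.mk fc fo ft).fib_condition i j)
    simp only [eqToHom_refl, Category.comp_id] at this
    exact ((PreCofunctor.act_self (PreCofunctor.mk (CofunctorBase.mk fc fo ft) fa fs fg) _).symm.trans
      this).trans
        (PreCofunctor.act_self (PreCofunctor.mk (CofunctorBase.mk fc fo ft) ga gs gg) _)
  rfl

end

/-- The objects of the category of partite internal categories in `C`. -/
structure PCat (C : Type u) [Category.{v} C] [RestrictionCategory C] where
  comps : Type w
  cat : PartiteCat comps C

section

variable {C : Type u} [Category.{v} C] [RestrictionCategory C]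

/-- The category of partite internal categories and partite cofunctors. -/
noncomputable instance : Category (PCat.{w} C) where
  Hom A B := Cofunctor A.cat B.cat
  id A := Cofunctor.id A.cat
  comp F G := F.comp' G
  id_comp {A B} F := by
    refine Cofunctor.ext_act (fun _ => rfl) (fun i => ?_) (fun i j a b h h' => ?_)
    · exact (Category.comp_id _).trans (Category.id_comp _).symm
    · refine (Cofunctor.comp'_act (Cofunctor.id A.cat) F a b h).trans ?_
      refine (F.act_congr _ (Cofunctor.id_act _ _ _ _) rfl).trans ?_
      refine Eq.trans ?_ (Category.comp_id _).symm
      exact F.act_congr _ rfl (Category.comp_id _).symm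
  comp_id {A B} F := by
    refine Cofunctor.ext_act (fun _ => rfl) (fun i => ?_) (fun i j a b h h' => ?_)
    · rfl
    · refine (Cofunctor.comp'_act F (Cofunctor.id B.cat) a b h).trans ?_
      refine (Cofunctor.id_act _ _ _ _).trans ?_
      refine Eq.trans ?_ (Category.comp_id _).symm
      exact F.act_congr _ rfl rfl
  assoc {A B D E} F G H := by
    refine Cofunctor.ext_act (fun _ => rfl) (fun i => ?_) (fun i j a b h h' => ?_)
    · exact (Category.assoc _ _ _).symm.trans (Category.id_comp _).symm
    · refine (Cofunctor.comp'_act (F.comp' G) H a b h).trans ?_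
      have h₁ : a ≫ A.cat.src i j = b ≫ H.onObj _ ≫ G.onObj _ ≫ F.onObj i :=
        h.trans rfl
      refine (H.act_congr _ (Cofunctor.comp'_act F G a (b ≫ H.onObj _)
        (h₁.trans (Category.assoc _ _ _).symm)) rfl).trans ?_
      refine Eq.trans ?_ (Category.comp_id _).symm
      refine Eq.trans ?_ (Cofunctor.comp'_act F (G.comp' H) a _ h').symm
      refine Eq.trans ?_ (Cofunctor.comp'_act G H _ _ _).symm
      refine H.act_congr _ (G.act_congr _ (F.act_congr _ rfl ?_) ?_) ?_
      · exact (Category.assoc _ _ _).trans (congrArg (· ≫ H.onObj _ ≫ G.onObj _)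
          (Category.comp_id b).symm)
      · exact congrArg (· ≫ H.onObj _) (Category.comp_id b).symm
      · exact (Category.comp_id b).symm

end

/-! ### Restriction categories over `C` -/

/-- Restriction functors. -/
def PreservesRest {A : Type w₁} [Category.{v} A] [RestrictionCategory A] {B : Type w₂}
    [Category.{w₃} B] [RestrictionCategory B] (F : A ⥤ B) : Prop :=
  ∀ {X Y : A} (f : X ⟶ Y), F.map (rest f) = rest (F.map f)

/-- A restriction category equipped with a restriction functor to `C`. -/
structure RCatOver (C : Type u) [Category.{v} C] [RestrictionCategory C] where
  carrier : Type w
  [cat : Category.{v} carrier]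
  [restr : RestrictionCategory carrier]
  proj : carrier ⥤ C
  proj_rest : PreservesRest proj

attribute [instance] RCatOver.cat RCatOver.restr

section

variable {C : Type u} [Category.{v} C] [RestrictionCategory C]

/-- Morphisms of restriction categories over `C`: a restriction functor and a total
transformation. -/
structure RCatOver.Hom (A B : RCatOver.{w} C) where
  functor : A.carrier ⥤ B.carrier
  functor_rest : PreservesRest functor
  trans : functor ⋙ B.proj ⟶ A.proj
  trans_total : ∀ X, Total (trans.app X)

theorem RCatOver.Hom.ext' {A B : RCatOver.{w} C} {F G : RCatOver.Hom A B}
    (h : F.functor = G.functor)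
    (h' : ∀ X, F.trans.app X =
      eqToHom (congrArg B.proj.obj (Functor.congr_obj h X)) ≫ G.trans.app X) : F = G := by
  obtain ⟨f, fr, ft, ftt⟩ := F
  obtain ⟨g, gr, gt, gtt⟩ := G
  obtain rfl : f = g := h
  obtain rfl : ft = gt := by
    ext X
    exact (h' X).trans (by simp)
  rfl

/-- The category of restriction categories over `C`. -/
instance : Category (RCatOver.{w} C) where
  Hom A B := RCatOver.Hom A B
  id A := ⟨𝟭 A.carrier, fun _ => rfl, (Functor.leftUnitor A.proj).hom, fun _ => Total.id _⟩
  comp {_ _ D} F G :=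
    { functor := F.functor ⋙ G.functor
      functor_rest := fun f =>
        (congrArg G.functor.map (F.functor_rest f)).trans (G.functor_rest _)
      trans := (Functor.associator F.functor G.functor D.proj).hom ≫
        Functor.whiskerLeft F.functor G.trans ≫ F.trans
      trans_total := fun X => (Total.id _).comp ((G.trans_total _).comp (F.trans_total _)) }
  id_comp F := RCatOver.Hom.ext' rfl fun X => by simp
  comp_id F := RCatOver.Hom.ext' rfl fun X => by simp
  assoc F G H := RCatOver.Hom.ext' rfl fun X => by simp

/-- Hyperconnected restriction functors: bijective on restriction idempotents. -/
def Hyperconnected {A : Type w₁} [Category.{v} A] [RestrictionCategory A] {B : Type w₂}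
    [Category.{w₃} B] [RestrictionCategory B] (F : A ⥤ B) : Prop :=
  ∀ X : A, Set.BijOn F.map (restIdem X) (restIdem (F.obj X))

/-- Join restriction categories hyperconnected over `C`. -/
def hcon (C : Type u) [Category.{v} C] [RestrictionCategory C] :
    ObjectProperty (RCatOver.{w} C) :=
  fun A => JoinRestriction A.carrier ∧ Hyperconnected A.proj

/-- Join inverse categories hyperconnected over `C`. -/
def jihcon (C : Type u) [Category.{v} C] [RestrictionCategory C] :
    ObjectProperty (RCatOver.{w} C) :=
  fun A => JoinInverse A.carrier ∧ Hyperconnected A.proj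

/-- Functors preserving all joins that exist in hom-sets. -/
def PreservesJoins {A : Type w₁} [Category.{v} A] [RestrictionCategory A] {B : Type w₂}
    [Category.{w₃} B] [RestrictionCategory B] (F : A ⥤ B) : Prop :=
  ∀ {X Y : A} (S : Set (X ⟶ Y)) (j : X ⟶ Y), IsJoin S j → IsJoin (F.map '' S) (F.map j)

/-- `F` preserves the binary meets of parallel maps, and every map between objects in the image is
the join of its meets with maps in the image. -/
def MeetCondition {A : Type w₁} [Category.{v} A] [RestrictionCategory A] {B : Type w₂}
    [Category.{w₃} B] [RestrictionCategory B] (F : A ⥤ B) : Prop :=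
  (∀ {X Y : A} (f g m : X ⟶ Y), IsMeet f g m → IsMeet (F.map f) (F.map g) (F.map m)) ∧
    ∀ {X Y : A} (g : F.obj X ⟶ F.obj Y),
      IsJoin {h | ∃ f : X ⟶ Y, IsMeet g (F.map f) h} g

/-- Localic functors. -/
def Localic {A : Type w₁} [Category.{v} A] [RestrictionCategory A] {B : Type w₂}
    [Category.{w₃} B] [RestrictionCategory B] (F : A ⥤ B) : Prop :=
  PreservesJoins F ∧ Function.Bijective F.obj ∧ MeetCondition F

/-- Morphisms over `C` whose functor is localic. -/
def localic (C : Type u) [Category.{v} C] [RestrictionCategory C] :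
    MorphismProperty (RCatOver.{w} C) := fun _ _ F => Localic F.functor

end

/-! ### Externalisation -/

section

variable {C : Type u} [Category.{v} C] [RestrictionCategory C]
variable {I : Type w₁} {J : Type w₂} {K : Type w₃}

theorem comp_rest_assoc' {A B D E : C} (f : A ⟶ B) (g : B ⟶ D) (k : B ⟶ E) :
    f ≫ rest g ≫ k = rest (f ≫ g) ≫ f ≫ k := by
  rw [← Category.assoc, comp_rest, Category.assoc]

/-- The objects of the externalisation of `A` are the components. -/
structure Ext (A : PartiteCat I C) where
  idx : I

namespace PartiteCat

variable (A : PartiteCat I C)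

/-- Partial sections of the source maps. -/
structure PartialSection (i j : I) where
  val : A.obj i ⟶ A.arr i j
  comp_src : val ≫ A.src i j = rest val

variable {A}

theorem PartialSection.ext' {i j : I} {s t : A.PartialSection i j} (h : s.val = t.val) :
    s = t := by
  cases s; cases t; cases h; rfl

theorem star_aux {j k : I} (t : A.PartialSection j k) (i : I) :
    (A.tgt i j ≫ t.val) ≫ A.src j k = rest (A.tgt i j ≫ t.val) ≫ A.tgt i j := by
  rw [Category.assoc, t.comp_src, comp_rest]

/-- The composite `t ∗ s`: first `s`, then the pullback of `t`, then the composition map. -/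
noncomputable def star {i j k : I} (t : A.PartialSection j k) (s : A.PartialSection i j) :
    A.obj i ⟶ A.arr i k :=
  s.val ≫ A.fibLift (A.tgt i j ≫ t.val) (rest (A.tgt i j ≫ t.val)) (star_aux t i) ≫ A.mul i j k

theorem star_aux' {i j k : I} (t : A.PartialSection j k) (s : A.PartialSection i j) :
    (s.val ≫ A.tgt i j ≫ t.val) ≫ A.src j k =
      (rest (s.val ≫ A.tgt i j ≫ t.val) ≫ s.val) ≫ A.tgt i j := by
  rw [← comp_rest]
  simp only [Category.assoc, t.comp_src, comp_rest_assoc', comp_rest]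

theorem star_eq {i j k : I} (t : A.PartialSection j k) (s : A.PartialSection i j) :
    star t s = A.mu (s.val ≫ A.tgt i j ≫ t.val) (rest (s.val ≫ A.tgt i j ≫ t.val) ≫ s.val)
      (star_aux' t s) :=
  (A.comp_mu s.val _ _ (star_aux t i)).trans (A.mu_congr _ rfl (comp_rest _ _))

theorem rest_star {i j k : I} (t : A.PartialSection j k) (s : A.PartialSection i j) :
    rest (star t s) = rest (s.val ≫ A.tgt i j ≫ t.val) := by
  rw [star_eq, A.rest_mu, rest_rest_comp, rest_le]

theorem star_section {i j k : I} (t : A.PartialSection j k) (s : A.PartialSection i j) :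
    star t s ≫ A.src i k = rest (star t s) := by
  rw [rest_star, star_eq, A.mu_src, Category.assoc, s.comp_src, rest_le]

theorem star_tgt {i j k : I} (t : A.PartialSection j k) (s : A.PartialSection i j) :
    star t s ≫ A.tgt i k = s.val ≫ A.tgt i j ≫ t.val ≫ A.tgt j k := by
  rw [star_eq, A.mu_tgt]; simp

theorem ident_total (i : I) : Total (A.ident i) :=
  Total.of_comp (g := A.src i i) (by rw [A.ident_src]; exact Total.id _)

theorem rest_comp_ident {i : I} {T : C} (e : T ⟶ A.obj i) : rest (e ≫ A.ident i) = rest e :=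
  rest_comp_total _ (ident_total i)

/-- A restriction idempotent of `A_i`, as a partial section. -/
def idemSection {i : I} (e : A.obj i ⟶ A.obj i) (he : rest e = e) : A.PartialSection i i :=
  ⟨e ≫ A.ident i, by
    rw [Category.assoc, A.ident_src, Category.comp_id, rest_comp_ident, he]⟩

theorem star_idem {i j : I} (e : A.obj i ⟶ A.obj i) (he : rest e = e)
    (s : A.PartialSection i j) : star s (idemSection e he) = e ≫ s.val := by
  have h : (idemSection (A := A) e he).val ≫ A.tgt i i ≫ s.val = e ≫ s.val := by
    simp only [idemSection, Category.assoc]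
    rw [← Category.assoc (A.ident i), A.ident_tgt, Category.id_comp]
  rw [star_eq]
  refine (A.mu_congr _ h (congrArg (fun x => rest x ≫ (idemSection e he).val) h)).trans ?_
  refine A.mu_unit_right _ _ ?_ _
  have : rest (e ≫ s.val) = e ≫ rest s.val := by
    conv_lhs => rw [← he, rest_rest_comp, he]
  simp only [idemSection]
  have hc : e ≫ rest s.val = rest s.val ≫ e := by
    have := rest_comm e s.val
    rwa [he] at this
  have he2 : e ≫ e = e := by
    have := rest_idem e
    rwa [he] at this
  rw [this, ← Category.assoc, Category.assoc e, ← hc, ← Category.assoc e, he2]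
  simp only [Category.assoc]
  rw [reassoc_of% s.comp_src]

theorem idem_star {i j : I} (e : A.obj j ⟶ A.obj j) (he : rest e = e)
    (s : A.PartialSection i j) :
    star (idemSection e he) s = rest (s.val ≫ A.tgt i j ≫ e) ≫ s.val := by
  have h : rest (s.val ≫ A.tgt i j ≫ e ≫ A.ident j) = rest (s.val ≫ A.tgt i j ≫ e) := by
    rw [← Category.assoc, ← Category.assoc, rest_comp_ident, Category.assoc]
  rw [star_eq]
  refine (A.mu_congr _ rfl (congrArg (· ≫ s.val) h)).trans ?_
  refine A.mu_unit_left _ _ ?_ _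
  have := comp_rest_assoc' (s.val ≫ A.tgt i j) e (A.ident j)
  rw [he] at this
  simpa [idemSection] using this

end PartiteCat

open PartiteCat

/-- The category structure of the externalisation. -/
noncomputable instance (A : PartiteCat I C) : Category.{v} (Ext A) where
  Hom i j := A.PartialSection i.idx j.idx
  id i := ⟨A.ident i.idx, by rw [A.ident_src, ident_total]⟩
  comp s t := ⟨star t s, star_section t s⟩
  id_comp {i j} s := PartialSection.ext' <| by
    have := star_idem (𝟙 _) (rest_id _) s
    rw [Category.id_comp] at this
    refine Eq.trans ?_ this
    exact congrArg (star s) (PartialSection.ext' (Category.id_comp _).symm)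
  comp_id {i j} s := PartialSection.ext' <| by
    have := idem_star (𝟙 _) (rest_id _) s
    rw [Category.comp_id, rest_comp_total _ (A.tgt_total _ _), rest_comp] at this
    refine Eq.trans ?_ this
    exact congrArg (fun x => star x s) (PartialSection.ext' (Category.id_comp _).symm)
  assoc {i j k l} s t r := PartialSection.ext' <| by
    change star r ⟨star t s, _⟩ = star ⟨star r t, _⟩ s
    refine (star_eq _ _).trans (Eq.trans ?_ (star_eq _ _).symm)
    change A.mu (star t s ≫ A.tgt _ _ ≫ r.val)
      (rest (star t s ≫ A.tgt _ _ ≫ r.val) ≫ star t s) _ =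
      A.mu (s.val ≫ A.tgt _ _ ≫ star r t) (rest (s.val ≫ A.tgt _ _ ≫ star r t) ≫ s.val) _
    set p := s.val ≫ A.tgt _ _ ≫ t.val with hp
    set q := p ≫ A.tgt _ _ ≫ r.val with hq
    have hqp : rest q ≫ rest p = rest q := by rw [hq, rest_le]
    have h₁ : star t s ≫ A.tgt _ _ ≫ r.val = q := by
      rw [← Category.assoc, star_tgt, hq, hp]; simp
    have h₂ : s.val ≫ A.tgt _ _ ≫ star r t = A.mu q (rest q ≫ p) (by
        have := star_aux' r t
        rw [hq, Category.assoc, Category.assoc, hp, Category.assoc, Category.assoc]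
        simp only [Category.assoc] at this
        rw [this, ← Category.assoc, comp_rest_assoc']; simp) := by
      rw [star_eq, A.comp_mu, A.comp_mu]
      refine A.mu_congr _ (by simp [hq, hp]) ?_
      rw [← Category.assoc, comp_rest_assoc']; simp [hq, hp]
    have h₃ : rest (s.val ≫ A.tgt _ _ ≫ star r t) = rest q := by
      rw [h₂, A.rest_mu, rest_rest_comp, hqp]
    have h₄ : rest q ≫ star t s = A.mu (rest q ≫ p) (rest q ≫ s.val) (by
        have := congrArg (fun x => rest q ≫ x) (star_aux' t s)
        simp only [Category.assoc] at this ⊢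
        rw [reassoc_of% hqp] at this
        rw [← this, hp]; simp) := by
      rw [star_eq, A.comp_mu]
      exact A.mu_congr _ rfl (by rw [← hp, reassoc_of% hqp])
    refine (A.mu_congr _ h₁ ((congrArg (fun x => rest x ≫ star t s) h₁).trans h₄)).trans ?_
    refine Eq.trans ?_ (A.mu_congr _ h₂ (congrArg (· ≫ s.val) h₃)).symm
    exact A.assoc _ _ _ _ _

theorem Ext.comp_val {A : PartiteCat I C} {i j k : Ext A} (s : i ⟶ j) (t : j ⟶ k) :
    (s ≫ t).val = star t s := rfl

/-- The restriction structure of the externalisation. -/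
noncomputable instance (A : PartiteCat I C) : RestrictionCategory (Ext A) where
  rest s := idemSection (rest s.val) (rest_rest _)
  rest_comp s := PartialSection.ext' ((star_idem _ _ _).trans (rest_comp _))
  rest_comm s t := PartialSection.ext' <| (star_idem _ _ _).trans <| by
    refine Eq.trans ?_ (star_idem _ _ _).symm
    simp only [idemSection]
    rw [← Category.assoc, rest_comm, Category.assoc]
  rest_rest_comp s t := PartialSection.ext' <| by
    refine Eq.trans ?_ (star_idem _ _ _).symm
    change rest (star t (idemSection _ _)) ≫ A.ident _ = rest s.val ≫ rest t.val ≫ A.ident _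
    rw [star_idem, rest_rest_comp, Category.assoc]
  comp_rest {i j k} s t := PartialSection.ext' <| by
    refine (idem_star _ _ _).trans ?_
    refine Eq.trans ?_ (star_idem _ _ _).symm
    refine congrArg (· ≫ s.val) ?_
    refine Eq.trans ?_ (rest_star t s).symm
    rw [← Category.assoc, rest_comp_rest, Category.assoc]

/-- The projection of the externalisation to `C`. -/
noncomputable def extProj (A : PartiteCat I C) : Ext A ⥤ C where
  obj i := A.obj i.idx
  map {i j} s := s.val ≫ A.tgt i.idx j.idx
  map_id i := A.ident_tgt i.idx
  map_comp s t := (star_tgt t s).trans (Category.assoc _ _ _).symm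

theorem extProj_rest (A : PartiteCat I C) : PreservesRest (extProj A) := fun {i j} s => by
  change (rest s.val ≫ A.ident i.idx) ≫ A.tgt i.idx i.idx = rest (s.val ≫ A.tgt i.idx j.idx)
  rw [Category.assoc, A.ident_tgt, Category.comp_id, rest_comp_total _ (A.tgt_total _ _)]

section

variable {A : PartiteCat I C} {B : PartiteCat J C} (F : Cofunctor A B)

theorem Cofunctor.push_aux {i j : I} (s : A.PartialSection i j) :
    (F.onObj i ≫ s.val) ≫ A.src i j = rest (F.onObj i ≫ s.val) ≫ F.onObj i := by
  rw [Category.assoc, s.comp_src, comp_rest]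

/-- The action of the externalisation of `F` on partial sections: first the pullback of `s` along
`F_i`, then `F_ij`. -/
noncomputable def Cofunctor.push {i j : I} (s : A.PartialSection i j) :
    B.obj (F.comp i) ⟶ B.arr (F.comp i) (F.comp j) :=
  F.fibLift (F.onObj i ≫ s.val) (rest (F.onObj i ≫ s.val)) (F.push_aux s) ≫ F.onArr i j

theorem Cofunctor.push_eq {i j : I} (s : A.PartialSection i j) :
    F.push s = F.act (F.onObj i ≫ s.val) (rest (F.onObj i ≫ s.val)) (F.push_aux s) := rfl

theorem Cofunctor.rest_push {i j : I} (s : A.PartialSection i j) :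
    rest (F.push s) = rest (F.onObj i ≫ s.val) := by
  rw [push_eq, F.rest_act, rest_rest]

theorem Cofunctor.push_section {i j : I} (s : A.PartialSection i j) :
    F.push s ≫ B.src _ _ = rest (F.push s) := by
  rw [rest_push, push_eq, F.act_src]

theorem Cofunctor.push_tgt {i j : I} (s : A.PartialSection i j) :
    F.push s ≫ B.tgt _ _ ≫ F.onObj j = F.onObj i ≫ s.val ≫ A.tgt i j := by
  have := F.act_tgt _ _ (F.push_aux s)
  simpa [push_eq] using this

theorem Cofunctor.push_idem {i : I} (e : A.obj i ⟶ A.obj i) (he : rest e = e) :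
    F.push (idemSection e he) = rest (F.onObj i ≫ e) ≫ B.ident _ := by
  have h : F.onObj i ≫ (idemSection (A := A) e he).val =
      rest (F.onObj i ≫ e) ≫ F.onObj i ≫ A.ident i := by
    have := comp_rest_assoc' (F.onObj i) e (A.ident i)
    rwa [he] at this
  have h' : rest (F.onObj i ≫ (idemSection (A := A) e he).val) = rest (F.onObj i ≫ e) :=
    (congrArg rest (Category.assoc _ _ _).symm).trans (rest_comp_ident _)
  rw [push_eq, ← F.act_ident, F.comp_act]
  exact F.act_congr _ h (h'.trans (Category.comp_id _).symm)

/-- The externalisation of a cofunctor. -/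
noncomputable def extFunctor : Ext A ⥤ Ext B where
  obj i := ⟨F.comp i.idx⟩
  map s := ⟨F.push s, F.push_section s⟩
  map_id i := PartialSection.ext' <| by
    refine Eq.trans ?_ ((F.push_idem (𝟙 _) (rest_id _)).trans ?_)
    · exact congrArg F.push (PartialSection.ext' (Category.id_comp _).symm)
    · rw [Category.comp_id, F.onObj_total, Category.id_comp]; rfl
  map_comp {i j k} s t := PartialSection.ext' <| by
    refine Eq.trans ?_ (star_eq _ _).symm
    change F.push ⟨star t s, star_section t s⟩ = B.mu (F.push s ≫ B.tgt _ _ ≫ F.push t)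
      (rest (F.push s ≫ B.tgt _ _ ≫ F.push t) ≫ F.push s) _
    set p := s.val ≫ A.tgt i.idx j.idx ≫ t.val with hp
    set r := rest (F.onObj i.idx ≫ p) with hr
    have hrs : r ≫ rest (F.onObj i.idx ≫ s.val) = r := by
      rw [hr, hp, ← Category.assoc, rest_le]
    have h₀ : (r ≫ F.onObj i.idx ≫ s.val) ≫ A.src i.idx j.idx = r ≫ F.onObj i.idx := by
      have := F.push_aux s
      rw [Category.assoc, this, reassoc_of% hrs]
    have h₁ : (F.onObj i.idx ≫ p) ≫ A.src j.idx k.idx = (r ≫ F.onObj i.idx ≫ s.val) ≫ A.tgt i.idx j.idx := by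
      have := star_aux' t s
      simp only [Category.assoc] at this ⊢
      rw [hp, Category.assoc, Category.assoc, this, comp_rest_assoc']
    have h₂ : F.onObj i.idx ≫ star t s = A.mu (F.onObj i.idx ≫ p) (r ≫ F.onObj i.idx ≫ s.val) h₁ := by
      rw [star_eq, A.comp_mu]
      exact A.mu_congr _ rfl (comp_rest_assoc' _ _ _)
    have h₃ : rest (F.onObj i.idx ≫ star t s) = r := by
      rw [h₂, A.rest_mu, hr, rest_rest_comp, ← hr, hrs]
    have h₄ : F.push ⟨star t s, star_section t s⟩ =
        F.act (A.mu (F.onObj i.idx ≫ p) (r ≫ F.onObj i.idx ≫ s.val) h₁) r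
          ((A.mu_src _ _ _).trans h₀) := F.act_congr _ h₂ h₃
    have h₅ : r ≫ F.push s = F.act (r ≫ F.onObj i.idx ≫ s.val) r h₀ := by
      rw [F.push_eq, F.comp_act]
      exact F.act_congr _ rfl hrs
    have h₇ : F.push s ≫ B.tgt _ _ ≫ F.onObj j.idx ≫ t.val = F.onObj i.idx ≫ p := by
      have := congrArg (· ≫ t.val) (F.push_tgt s)
      simp only [Category.assoc] at this
      rw [this, hp]
    have h₈ : F.push s ≫ B.tgt _ _ ≫ rest (F.onObj j.idx ≫ t.val) =
        F.act (r ≫ F.onObj i.idx ≫ s.val) r h₀ ≫ B.tgt _ _ := by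
      rw [← h₅, ← Category.assoc, comp_rest, hr, ← h₇]; simp
    have h₉ : rest (F.push s ≫ B.tgt _ _ ≫ F.push t) = r := by
      rw [← Category.assoc, ← rest_comp_rest, F.rest_push, rest_comp_rest, Category.assoc, h₇]
    refine h₄.trans ((F.act_mu _ _ _ h₁ h₀).trans ?_)
    refine B.mu_congr _ ?_ ?_
    · refine Eq.trans ?_ (Category.assoc _ _ _)
      refine Eq.trans ?_ (F.comp_act _ _ _ (F.push_aux t)).symm
      exact F.act_congr _ (h₇.symm.trans (by simp)) (h₈.symm.trans (by simp))
    · rw [h₉, h₅]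

theorem extFunctor_rest : PreservesRest (extFunctor F) := fun {i j} s => PartialSection.ext' <| by
  refine (F.push_idem _ _).trans ?_
  rw [rest_comp_rest, ← F.rest_push]; rfl

/-- The transformation over `C` associated with a cofunctor. -/
def extTrans : extFunctor F ⋙ extProj B ⟶ extProj A where
  app i := F.onObj i.idx
  naturality i j s := (Category.assoc _ _ _).trans (F.push_tgt s)

end

/-- The functor `Φ` from partite internal categories to restriction categories over `C`. -/
noncomputable def externalisation (C : Type u) [Category.{v} C] [RestrictionCategory C] :
    PCat.{w} C ⥤ RCatOver.{w} C where
  obj A := ⟨Ext A.cat, extProj A.cat, extProj_rest A.cat⟩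
  map F := ⟨extFunctor F, extFunctor_rest F, extTrans F, fun i => F.onObj_total i.idx⟩
  map_id A := RCatOver.Hom.ext'
    (CategoryTheory.Functor.hext (fun _ => rfl) fun i j s =>
      heq_of_eq <| PartialSection.ext' ((Cofunctor.id_act A.cat _ _ _).trans (Category.id_comp _)))
    fun i => (Category.id_comp _).symm
  map_comp F G := RCatOver.Hom.ext'
    (CategoryTheory.Functor.hext (fun _ => rfl) fun i j s => by
      refine heq_of_eq <| PartialSection.ext' ((Cofunctor.comp'_act F G _ _ _).trans ?_)
      have h₁ : rest (G.onObj (F.comp i.idx) ≫ F.push s) =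
          rest ((G.onObj (F.comp i.idx) ≫ F.onObj i.idx) ≫ s.val) := by
        rw [← rest_comp_rest, F.rest_push, rest_comp_rest, Category.assoc]
      refine Eq.trans ?_ (G.act_congr _ rfl h₁).symm
      refine G.act_congr _ ?_ rfl
      refine Eq.trans ?_ (F.comp_act _ _ _ (F.push_aux s)).symm
      exact F.act_congr _ (Category.assoc _ _ _)
        (((congrArg (fun x => rest x ≫ G.onObj _) (Category.assoc _ _ _))).trans
          (comp_rest _ _).symm))
    fun _ => ((Category.id_comp _).trans (Category.id_comp _)).symm

end

/-! ### Partial bisections -/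

section

variable {C : Type u} [Category.{v} C] [RestrictionCategory C]

theorem PartialIso.map {A : Type w₁} [Category.{v} A] [RestrictionCategory A] {B : Type w₂}
    [Category.{w₃} B] [RestrictionCategory B] {F : A ⥤ B} (hF : PreservesRest F) {X Y : A}
    {f : X ⟶ Y} (h : PartialIso f) : PartialIso (F.map f) := by
  obtain ⟨g, h₁, h₂⟩ := h
  exact ⟨F.map g, by rw [← F.map_comp, h₁, hF], by rw [← F.map_comp, h₂, hF]⟩

/-- The objects of the subcategory of maps sent to partial isomorphisms by the projection. -/
structure Bis (A : RCatOver.{w} C) where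
  of : A.carrier

/-- The subcategory of those maps sent to partial isomorphisms by the projection. -/
instance (A : RCatOver.{w} C) : Category.{v} (Bis A) where
  Hom X Y := {f : X.of ⟶ Y.of // PartialIso (A.proj.map f)}
  id X := ⟨𝟙 X.of, by rw [A.proj.map_id]; exact PartialIso.id _⟩
  comp f g := ⟨f.1 ≫ g.1, by rw [A.proj.map_comp]; exact f.2.comp g.2⟩
  id_comp f := Subtype.ext (Category.id_comp f.1)
  comp_id f := Subtype.ext (Category.comp_id f.1)
  assoc f g h := Subtype.ext (Category.assoc f.1 g.1 h.1)

instance (A : RCatOver.{w} C) : RestrictionCategory (Bis A) where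
  rest f := ⟨rest f.1, by rw [A.proj_rest]; exact PartialIso.rest _⟩
  rest_comp f := Subtype.ext (rest_comp f.1)
  rest_comm f g := Subtype.ext (rest_comm f.1 g.1)
  rest_rest_comp f g := Subtype.ext (rest_rest_comp f.1 g.1)
  comp_rest f g := Subtype.ext (comp_rest f.1 g.1)

/-- The subcategory of maps sent to partial isomorphisms, as a restriction category over `C`. -/
def RCatOver.bis (A : RCatOver.{w} C) : RCatOver.{w} C where
  carrier := Bis A
  proj :=
    { obj := fun X => A.proj.obj X.of
      map := fun f => A.proj.map f.1
      map_id := fun X => A.proj.map_id X.of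
      map_comp := fun f g => A.proj.map_comp f.1 g.1 }
  proj_rest := fun f => A.proj_rest f.1

/-- The projection reflects partial isomorphisms. -/
def RCatOver.Reflects (A : RCatOver.{w} C) : Prop :=
  ∀ {X Y : A.carrier} (f : X ⟶ Y), PartialIso (A.proj.map f) → PartialIso f

/-- The action of a morphism over `C` on the subcategories of maps sent to partial
isomorphisms. -/
def RCatOver.bisMap {A B : RCatOver.{w} C} (hA : A.Reflects) (F : A ⟶ B) : A.bis ⟶ B.bis where
  functor :=
    { obj := fun X => ⟨F.functor.obj X.of⟩
      map := fun f => ⟨F.functor.map f.1, ((hA f.1 f.2).map F.functor_rest).map B.proj_rest⟩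
      map_id := fun X => Subtype.ext (F.functor.map_id X.of)
      map_comp := fun f g => Subtype.ext (F.functor.map_comp f.1 g.1) }
  functor_rest := fun f => Subtype.ext (F.functor_rest f.1)
  trans :=
    { app := fun X => F.trans.app X.of
      naturality := fun _ _ f => F.trans.naturality f.1 }
  trans_total := fun X => F.trans_total X.of

/-- Partite internal groupoids. -/
def IsPGpd (C : Type u) [Category.{v} C] [RestrictionCategory C] : ObjectProperty (PCat.{w} C) :=
  fun A => A.cat.IsGroupoid

/-- Source-étale partite internal categories. -/
def IsEtale (C : Type u) [Category.{v} C] [RestrictionCategory C] : ObjectProperty (PCat.{w} C) :=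
  fun A => A.cat.SourceEtale

open PartiteCat in
theorem reflects_of_groupoid (A : PCat.{w} C) (hA : A.cat.IsGroupoid) :
    ((externalisation C).obj A).Reflects := by
  intro X Y f hf
  obtain ⟨ι, ht, hi, hs, hm⟩ := hA
  have hι (i j) : ι i j ≫ A.cat.tgt j i = A.cat.src i j := by
    rw [← hs j i, ← Category.assoc, hi, Category.id_comp]
  obtain ⟨i⟩ := X
  obtain ⟨j⟩ := Y
  obtain ⟨f, hfs⟩ := f
  change PartialIso (f ≫ A.cat.tgt i j) at hf
  change f ≫ A.cat.src i j = rest f at hfs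
  obtain ⟨r, h₁, h₂⟩ := hf
  rw [rest_comp_total _ (A.cat.tgt_total i j)] at h₁
  rw [Category.assoc] at h₁
  have hr : rest (r ≫ f) = rest r := by
    rw [← rest_comp_total _ (A.cat.tgt_total i j), Category.assoc, h₂, rest_rest]
  have hrg : rest (r ≫ f ≫ ι i j) = rest r := by
    rw [← Category.assoc, rest_comp_total _ (ht i j), hr]
  have hgs : (r ≫ f ≫ ι i j) ≫ A.cat.src j i = rest (r ≫ f ≫ ι i j) := by
    rw [hrg, Category.assoc, Category.assoc, hs, h₂]
  have hgt : (r ≫ f ≫ ι i j) ≫ A.cat.tgt j i = r := by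
    rw [Category.assoc, Category.assoc, hι, hfs, comp_rest, hr, rest_comp]
  let f' : A.cat.PartialSection i j := ⟨f, hfs⟩
  let g : A.cat.PartialSection j i := ⟨r ≫ f ≫ ι i j, hgs⟩
  refine ⟨g, PartialSection.ext' ?_, PartialSection.ext' ?_⟩
  · change star g f' = rest f ≫ A.cat.ident i
    have e₁ : f ≫ A.cat.tgt i j ≫ r ≫ f ≫ ι i j = f ≫ ι i j := by
      have := congrArg (· ≫ f ≫ ι i j) h₁
      simp only [Category.assoc] at this
      rw [this, ← Category.assoc, rest_comp]
    have e₂ : rest (f ≫ A.cat.tgt i j ≫ r ≫ f ≫ ι i j) ≫ f = f ≫ 𝟙 _ := by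
      rw [e₁, rest_comp_total _ (ht i j), rest_comp, Category.comp_id]
    refine (star_eq g f').trans ((A.cat.mu_congr _ e₁ e₂).trans ?_)
    refine (A.cat.comp_mu f (ι i j) (𝟙 _) ((hs i j).trans (Category.id_comp _).symm)).symm.trans ?_
    rw [hm, ← Category.assoc, hfs]
  · change star f' g = rest (r ≫ f ≫ ι i j) ≫ A.cat.ident j
    have e₁ : (r ≫ f ≫ ι i j) ≫ A.cat.tgt j i ≫ f = (r ≫ f ≫ ι i j) ≫ ι j i := by
      rw [← Category.assoc, hgt]; simp [hi]
    have e₂ : rest ((r ≫ f ≫ ι i j) ≫ A.cat.tgt j i ≫ f) ≫ r ≫ f ≫ ι i j =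
        (r ≫ f ≫ ι i j) ≫ 𝟙 _ := by
      rw [e₁, rest_comp_total _ (ht j i), rest_comp, Category.comp_id]
    refine (star_eq f' g).trans ((A.cat.mu_congr _ e₁ e₂).trans ?_)
    refine (A.cat.comp_mu _ (ι j i) (𝟙 _) ((hs j i).trans (Category.id_comp _).symm)).symm.trans ?_
    rw [hm, ← Category.assoc, hgs]

/-- The functor `Φ_g` from partite internal groupoids to restriction categories over `C`. -/
noncomputable def externalisationG (C : Type u) [Category.{v} C] [RestrictionCategory C] :
    (IsPGpd.{w} C).FullSubcategory ⥤ RCatOver.{w} C where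
  obj A := ((externalisation C).obj A.obj).bis
  map {A _} F := RCatOver.bisMap (reflects_of_groupoid A.obj A.property)
    ((externalisation C).map F.hom)
  map_id A := by
    refine RCatOver.Hom.ext' (CategoryTheory.Functor.hext (fun X => ?_) fun X Y f => ?_) fun X => ?_
    · rfl
    · refine heq_of_eq (Subtype.ext ?_)
      exact PartiteCat.PartialSection.ext'
        ((Cofunctor.id_act A.obj.cat _ _ _).trans (Category.id_comp _))
    · exact (Category.id_comp _).symm
  map_comp {A B D} F G := by
    have h := (externalisation C).map_comp F.hom G.hom
    refine RCatOver.Hom.ext' (CategoryTheory.Functor.hext (fun X => ?_) fun X Y f => ?_) fun X => ?_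
    · rfl
    · refine heq_of_eq (Subtype.ext ?_)
      have := congr_arg_heq (fun x : RCatOver.Hom _ _ => x.functor.map f.1) h
      exact eq_of_heq this
    · exact ((Category.id_comp _).trans (Category.id_comp _)).symm

end

/-! ### Covering functors -/

section

variable {C : Type u} [Category.{v} C] [RestrictionCategory C]
variable {I : Type w₁} {J : Type w₂} {K : Type w₃}

/-- Action of a partite internal functor, compatible with source and target. The map `onArr i j`
is total, by `onArr_src`. -/
structure PrePartiteFunctor (B : PartiteCat I C) (A : PartiteCat J C) where
  comp : I → J
  onObj : ∀ i, B.obj i ⟶ A.obj (comp i)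
  onObj_total : ∀ i, Total (onObj i)
  onArr : ∀ i j, B.arr i j ⟶ A.arr (comp i) (comp j)
  onArr_src : ∀ i j, onArr i j ≫ A.src (comp i) (comp j) = B.src i j ≫ onObj i
  onArr_tgt : ∀ i j, onArr i j ≫ A.tgt (comp i) (comp j) = B.tgt i j ≫ onObj j

theorem PrePartiteFunctor.fib_aux {B : PartiteCat I C} {A : PartiteCat J C}
    (G : PrePartiteFunctor B A) {T : C} {i j k : I} (c : T ⟶ B.arr j k) (a : T ⟶ B.arr i j)
    (h : c ≫ B.src j k = a ≫ B.tgt i j) :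
    (c ≫ G.onArr j k) ≫ A.src _ _ = (a ≫ G.onArr i j) ≫ A.tgt _ _ := by
  rw [Category.assoc, G.onArr_src, Category.assoc, G.onArr_tgt, reassoc_of% h]

/-- Partite internal functors. -/
structure PartiteFunctor (B : PartiteCat I C) (A : PartiteCat J C) extends
    PrePartiteFunctor B A where
  ident : ∀ i, B.ident i ≫ onArr i i = onObj i ≫ A.ident (comp i)
  mul : ∀ i j k, B.mul i j k ≫ onArr i k =
    A.mu (B.fibFst i j k ≫ onArr j k) (B.fibSnd i j k ≫ onArr i j)
      (toPrePartiteFunctor.fib_aux _ _ (B.fib_condition i j k))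

/-- Covering functors. -/
structure PartiteFunctor.IsCovering {B : PartiteCat I C} {A : PartiteCat J C}
    (G : PartiteFunctor B A) : Prop where
  bijective : Function.Bijective G.comp
  isPullback : ∀ i j, IsPullback (G.onArr i j) (B.src i j) (A.src (G.comp i) (G.comp j)) (G.onObj i)

theorem PartiteFunctor.mu {B : PartiteCat I C} {A : PartiteCat J C}
    (G : PartiteFunctor B A) {T : C} {i j k : I} (c : T ⟶ B.arr j k) (a : T ⟶ B.arr i j)
    (h : c ≫ B.src j k = a ≫ B.tgt i j) :
    B.mu c a h ≫ G.onArr i k = A.mu (c ≫ G.onArr j k) (a ≫ G.onArr i j) (G.fib_aux c a h) := by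
  rw [PrePartiteCat.mu, Category.assoc, G.mul, A.comp_mu]
  exact A.mu_congr _ (by simp) (by simp)

theorem PartiteFunctor.ext' {B : PartiteCat I C} {A : PartiteCat J C} {F G : PartiteFunctor B A}
    (hc : F.comp = G.comp)
    (ho : ∀ i, F.onObj i ≫ eqToHom (congrArg A.obj (congrFun hc i)) = G.onObj i)
    (ha : ∀ i j, F.onArr i j ≫
      eqToHom (congrArg₂ A.arr (congrFun hc i) (congrFun hc j)) = G.onArr i j) : F = G := by
  obtain ⟨⟨fc, fo, fot, fa, fs, ft⟩, fi, fm⟩ := F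
  obtain ⟨⟨gc, go, got, ga, gs, gt⟩, gi, gm⟩ := G
  obtain rfl : fc = gc := hc
  obtain rfl : fo = go := funext fun i => by simpa using ho i
  obtain rfl : fa = ga := by
    funext i j
    simpa using ha i j
  rfl

/-- The identity functor. -/
def PartiteFunctor.id (A : PartiteCat I C) : PartiteFunctor A A where
  comp i := i
  onObj i := 𝟙 _
  onObj_total i := Total.id _
  onArr i j := 𝟙 _
  onArr_src i j := (Category.id_comp _).trans (Category.comp_id _).symm
  onArr_tgt i j := (Category.id_comp _).trans (Category.comp_id _).symm
  ident i := (Category.comp_id _).trans (Category.id_comp _).symm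
  mul i j k := by
    refine (Category.comp_id _).trans ?_
    refine Eq.trans ?_ (A.mu_congr (A.fib_condition i j k) (Category.comp_id _).symm
      (Category.comp_id _).symm)
    rw [PrePartiteCat.mu]
    refine (Category.id_comp _).symm.trans (congrArg (· ≫ A.mul i j k) ?_)
    apply A.fib_hom_ext <;> simp

/-- Composition of functors: first `G`, then `H`. -/
noncomputable def PartiteFunctor.comp' {D : PartiteCat I C} {B : PartiteCat J C}
    {A : PartiteCat K C} (G : PartiteFunctor D B) (H : PartiteFunctor B A) :
    PartiteFunctor D A where
  comp i := H.comp (G.comp i)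
  onObj i := G.onObj i ≫ H.onObj (G.comp i)
  onObj_total i := (G.onObj_total i).comp (H.onObj_total _)
  onArr i j := G.onArr i j ≫ H.onArr (G.comp i) (G.comp j)
  onArr_src i j := by
    rw [Category.assoc, H.onArr_src, ← Category.assoc, G.onArr_src, Category.assoc]
  onArr_tgt i j := by
    rw [Category.assoc, H.onArr_tgt, ← Category.assoc, G.onArr_tgt, Category.assoc]
  ident i := by
    rw [← Category.assoc, G.ident, Category.assoc, H.ident, Category.assoc]
  mul i j k := by
    rw [← Category.assoc, G.mul, H.mu]
    exact A.mu_congr _ (Category.assoc _ _ _) (Category.assoc _ _ _)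

theorem PartiteFunctor.IsCovering.id (A : PartiteCat I C) : (PartiteFunctor.id A).IsCovering :=
  ⟨Function.bijective_id, fun i j => IsPullback.id_horiz (A.src i j)⟩

theorem PartiteFunctor.IsCovering.comp {D : PartiteCat I C} {B : PartiteCat J C}
    {A : PartiteCat K C} {G : PartiteFunctor D B} {H : PartiteFunctor B A} (hG : G.IsCovering)
    (hH : H.IsCovering) : (G.comp' H).IsCovering :=
  ⟨hH.bijective.comp hG.bijective, fun i j =>
    (hG.isPullback i j).paste_horiz (hH.isPullback _ _)⟩

/-- The objects of the category of partite internal categories and covering functors. -/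
structure PCov (C : Type u) [Category.{v} C] [RestrictionCategory C] where
  toPCat : PCat.{w} C

/-- The category of partite internal categories and covering functors. -/
noncomputable instance : Category (PCov.{w} C) where
  Hom B A := {G : PartiteFunctor B.toPCat.cat A.toPCat.cat // G.IsCovering}
  id A := ⟨PartiteFunctor.id _, PartiteFunctor.IsCovering.id _⟩
  comp G H := ⟨G.1.comp' H.1, G.2.comp H.2⟩
  id_comp G := Subtype.ext <| PartiteFunctor.ext' rfl
    (fun _ => (Category.comp_id _).trans (Category.id_comp _))
    (fun _ _ => (Category.comp_id _).trans (Category.id_comp _))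
  comp_id G := Subtype.ext <| PartiteFunctor.ext' rfl
    (fun _ => (Category.comp_id _).trans (Category.comp_id _))
    (fun _ _ => (Category.comp_id _).trans (Category.comp_id _))
  assoc F G H := Subtype.ext <| PartiteFunctor.ext' rfl
    (fun _ => (Category.comp_id _).trans (Category.assoc _ _ _))
    (fun _ _ => (Category.comp_id _).trans (Category.assoc _ _ _))

section

variable {B : PartiteCat I C} {A : PartiteCat J C} (G : PartiteFunctor B A)

/-- The component of `G` on objects, at `i' ↦ i`. -/
def PartiteFunctor.obj' {i' : I} {i : J} (h : G.comp i' = i) : B.obj i' ⟶ A.obj i :=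
  G.onObj i' ≫ eqToHom (congrArg A.obj h)

/-- The component of `G` on arrows, at `i' ↦ i` and `j' ↦ j`. -/
def PartiteFunctor.arr' {i' j' : I} {i j : J} (hi : G.comp i' = i) (hj : G.comp j' = j) :
    B.arr i' j' ⟶ A.arr i j :=
  G.onArr i' j' ≫ eqToHom (congrArg₂ A.arr hi hj)

theorem PartiteFunctor.obj'_total {i' : I} {i : J} (h : G.comp i' = i) : Total (G.obj' h) := by
  subst h; simpa [obj'] using G.onObj_total i'

theorem PartiteFunctor.arr'_src {i' j' : I} {i j : J} (hi : G.comp i' = i) (hj : G.comp j' = j) :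
    G.arr' hi hj ≫ A.src i j = B.src i' j' ≫ G.obj' hi := by
  subst hi hj; simpa [obj', arr'] using G.onArr_src i' j'

theorem PartiteFunctor.arr'_tgt {i' j' : I} {i j : J} (hi : G.comp i' = i) (hj : G.comp j' = j) :
    G.arr' hi hj ≫ A.tgt i j = B.tgt i' j' ≫ G.obj' hj := by
  subst hi hj; simpa [obj', arr'] using G.onArr_tgt i' j'

theorem PartiteFunctor.arr'_ident {i' : I} {i : J} (hi : G.comp i' = i) :
    B.ident i' ≫ G.arr' hi hi = G.obj' hi ≫ A.ident i := by
  subst hi; simpa [obj', arr'] using G.ident i'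

theorem PartiteFunctor.arr'_mu {T : C} {i' j' k' : I} {i j k : J} (hi : G.comp i' = i)
    (hj : G.comp j' = j) (hk : G.comp k' = k) (c : T ⟶ B.arr j' k') (a : T ⟶ B.arr i' j')
    (h : c ≫ B.src j' k' = a ≫ B.tgt i' j') (h') :
    B.mu c a h ≫ G.arr' hi hk = A.mu (c ≫ G.arr' hj hk) (a ≫ G.arr' hi hj) h' := by
  subst hi hj hk
  have := G.mu c a h
  refine Eq.trans (by simp [arr']) (this.trans (A.mu_congr _ ?_ ?_)) <;> simp [arr']

theorem PartiteFunctor.IsCovering.arr' {G : PartiteFunctor B A} (hG : G.IsCovering)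
    {i' j' : I} {i j : J} (hi : G.comp i' = i) (hj : G.comp j' = j) :
    IsPullback (G.arr' hi hj) (B.src i' j') (A.src i j) (G.obj' hi) := by
  subst hi hj; simpa [obj', PartiteFunctor.arr'] using hG.isPullback i' j'

variable {G}

/-- The cofunctor of a covering functor `G` acts on components by the inverse of `G` and on objects
as `G`. -/
noncomputable def PartiteFunctor.IsCovering.cofunctorBase (hG : G.IsCovering) :
    CofunctorBase A B where
  comp := Function.surjInv hG.bijective.surjective
  onObj i := G.obj' (Function.surjInv_eq hG.bijective.surjective i)
  onObj_total i := G.obj'_total _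

/-- The cofunctor of a covering functor `G` acts on arrows by the inverse of the comparison map
`B_ij ⟶ A_{Gi,Gj} × B_i`. -/
noncomputable def PartiteFunctor.IsCovering.preCofunctor (hG : G.IsCovering) :
    PreCofunctor A B where
  toCofunctorBase := hG.cofunctorBase
  onArr i j := (hG.arr' (Function.surjInv_eq hG.bijective.surjective i)
    (Function.surjInv_eq hG.bijective.surjective j)).lift
      (hG.cofunctorBase.fibFst i j) (hG.cofunctorBase.fibSnd i j)
      (hG.cofunctorBase.fib_condition i j)
  onArr_src i j := IsPullback.lift_snd _ _ _ _
  onArr_tgt i j := by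
    refine (congrArg (fun x => _ ≫ x)
      (G.arr'_tgt (Function.surjInv_eq hG.bijective.surjective i)
        (Function.surjInv_eq hG.bijective.surjective j))).symm.trans ?_
    exact (Category.assoc _ _ _).symm.trans
      (congrArg (· ≫ A.tgt i j) (IsPullback.lift_fst _ _ _ _))

theorem PartiteFunctor.IsCovering.act_arr' (hG : G.IsCovering) {T : C} {i j : J} (a : T ⟶ A.arr i j)
    (b : T ⟶ B.obj (hG.preCofunctor.comp i)) (h : a ≫ A.src i j = b ≫ hG.preCofunctor.onObj i) :
    hG.preCofunctor.act a b h ≫ G.arr' (Function.surjInv_eq hG.bijective.surjective i)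
      (Function.surjInv_eq hG.bijective.surjective j) = a := by
  refine (Category.assoc _ _ _).trans ?_
  refine (congrArg (fun x => _ ≫ x) (IsPullback.lift_fst _ _ _ _)).trans ?_
  exact hG.preCofunctor.fibLift_fst a b h

theorem PartiteFunctor.IsCovering.eq_act (hG : G.IsCovering) {T : C} {i j : J} (a : T ⟶ A.arr i j)
    (b : T ⟶ B.obj (hG.preCofunctor.comp i)) (h : a ≫ A.src i j = b ≫ hG.preCofunctor.onObj i)
    (x : T ⟶ B.arr (hG.preCofunctor.comp i) (hG.preCofunctor.comp j))
    (hx : x ≫ G.arr' (Function.surjInv_eq hG.bijective.surjective i)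
      (Function.surjInv_eq hG.bijective.surjective j) = a) (hx' : x ≫ B.src _ _ = b) :
    hG.preCofunctor.act a b h = x :=
  (hG.arr' _ _).hom_ext ((hG.act_arr' a b h).trans hx.symm)
    ((hG.preCofunctor.act_src a b h).trans hx'.symm)

/-- The cofunctor of a covering functor. -/
noncomputable def PartiteFunctor.IsCovering.cofunctor (hG : G.IsCovering) : Cofunctor A B where
  toPreCofunctor := hG.preCofunctor
  act_ident i := hG.eq_act _ _ _ _ (G.arr'_ident _) (B.ident_src _)
  act_mu c a b h h' := hG.eq_act _ _ _ _
    ((G.arr'_mu _ (Function.surjInv_eq hG.bijective.surjective _) _ _ _ _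
      ((congrArg (· ≫ A.src _ _) (hG.act_arr' _ _ _)).trans
        (h.trans (congrArg (· ≫ A.tgt _ _) (hG.act_arr' _ _ _)).symm))).trans
        (A.mu_congr _ (hG.act_arr' _ _ _) (hG.act_arr' _ _ _)))
    ((B.mu_src _ _ _).trans (hG.preCofunctor.act_src _ _ _))

end

/-- The covering functor `G` and the cofunctor `F` correspond to each other. -/
def Corresponds {B : PartiteCat I C} {A : PartiteCat J C} (G : PartiteFunctor B A)
    (F : Cofunctor A B) : Prop :=
  ∃ h : ∀ j, G.comp (F.comp j) = j, (∀ j, F.onObj j = G.obj' (h j)) ∧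
    ∀ {T : C} (i j : J) (a : T ⟶ A.arr i j) (b : T ⟶ B.obj (F.comp i))
      (hab : a ≫ A.src i j = b ≫ F.onObj i), F.act a b hab ≫ G.arr' (h i) (h j) = a

theorem PartiteFunctor.IsCovering.corresponds {B : PartiteCat I C} {A : PartiteCat J C}
    {G : PartiteFunctor B A} (hG : G.IsCovering) : Corresponds G hG.cofunctor :=
  ⟨fun j => Function.surjInv_eq hG.bijective.surjective j, fun _ => rfl,
    fun _ _ a b h => hG.act_arr' a b h⟩

theorem Corresponds.unique {B : PartiteCat I C} {A : PartiteCat J C}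
    {G : PartiteFunctor B A} (hG : G.IsCovering) {F F' : Cofunctor A B} (h : Corresponds G F)
    (h' : Corresponds G F') : F = F' := by
  obtain ⟨hc, ho, ha⟩ := h
  obtain ⟨hc', ho', ha'⟩ := h'
  have e : ∀ j, F.comp j = F'.comp j := fun j => hG.bijective.1 ((hc j).trans (hc' j).symm)
  have key : ∀ {i' i'' : I} {i : J} (e : i' = i'') (h₁ : G.comp i' = i) (h₂ : G.comp i'' = i),
      eqToHom (congrArg B.obj e) ≫ G.obj' h₂ = G.obj' h₁ := by
    intro i' i'' i e h₁ h₂; subst e; simp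
  have key' : ∀ {i' i'' j' j'' : I} {i j : J} (e : i' = i'') (f : j' = j'') (h₁ : G.comp i' = i)
      (h₂ : G.comp i'' = i) (k₁ : G.comp j' = j) (k₂ : G.comp j'' = j),
      eqToHom (congrArg₂ B.arr e f).symm ≫ G.arr' h₁ k₁ = G.arr' h₂ k₂ := by
    intro i' i'' j' j'' i j e f h₁ h₂ k₁ k₂; subst e f; simp
  have key'' : ∀ {i' i'' j' j'' : I} (e : i' = i'') (f : j' = j''),
      eqToHom (congrArg₂ B.arr e f).symm ≫ B.src i' j' =
        B.src i'' j'' ≫ eqToHom (congrArg B.obj e).symm := by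
    intro i' i'' j' j'' e f; subst e f; simp
  refine Cofunctor.ext_act e (fun i => ?_) (fun {T} i j a b h h' => ?_)
  · rw [ho, ho', key (e i)]
  · refine (hG.arr' (hc i) (hc j)).hom_ext ?_ ?_
    · rw [ha, Category.assoc, key' (e i) (e j) _ (hc' i) _ (hc' j), ha']
    · rw [F.act_src, Category.assoc, key'' (e i) (e j), ← Category.assoc, F'.act_src,
        Category.assoc, eqToHom_trans, eqToHom_refl, Category.comp_id]

theorem Corresponds.id (A : PartiteCat I C) :
    Corresponds (PartiteFunctor.id A) (Cofunctor.id A) :=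
  ⟨fun _ => rfl, fun _ => (Category.comp_id _).symm, fun _ _ a b h =>
    (congrArg (fun x => _ ≫ x) (Category.comp_id _)).trans
      ((Category.comp_id _).trans (Cofunctor.id_act A a b h))⟩

theorem Corresponds.comp {D : PartiteCat I C} {B : PartiteCat J C} {A : PartiteCat K C}
    {G : PartiteFunctor D B} {H : PartiteFunctor B A} {F : Cofunctor B D} {E : Cofunctor A B}
    (hG : Corresponds G F) (hH : Corresponds H E) :
    Corresponds (G.comp' H) (E.comp' F) := by
  obtain ⟨hc, ho, ha⟩ := hG
  obtain ⟨kc, ko, ka⟩ := hH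
  have key : ∀ {i : I} {j : J} {k : K} (h₁ : G.comp i = j) (h₂ : H.comp j = k)
      (h : (G.comp' H).comp i = k), (G.comp' H).obj' h = G.obj' h₁ ≫ H.obj' h₂ := by
    intro i j k h₁ h₂ h
    subst h₁ h₂
    exact (Category.comp_id _).trans
      (congrArg₂ (· ≫ ·) (Category.comp_id _).symm (Category.comp_id _).symm)
  have key' : ∀ {i i' : I} {j j' : J} {k k' : K} (h₁ : G.comp i = j) (h₂ : H.comp j = k)
      (h₁' : G.comp i' = j') (h₂' : H.comp j' = k')
      (h : (G.comp' H).comp i = k) (h' : (G.comp' H).comp i' = k'),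
      (G.comp' H).arr' h h' = G.arr' h₁ h₁' ≫ H.arr' h₂ h₂' := by
    intro i i' j j' k k' h₁ h₂ h₁' h₂' h h'
    subst h₁ h₂ h₁' h₂'
    exact (Category.comp_id _).trans
      (congrArg₂ (· ≫ ·) (Category.comp_id _).symm (Category.comp_id _).symm)
  have hk : ∀ k, (G.comp' H).comp ((E.comp' F).comp k) = k := fun k =>
    (congrArg H.comp (hc (E.comp k))).trans (kc k)
  refine ⟨hk, fun k => ?_, fun {T} i j a b h => ?_⟩
  · exact (congrArg₂ (· ≫ ·) (ho _) (ko _)).trans (key (hc (E.comp k)) (kc k) _).symm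
  · refine (congrArg (fun x => _ ≫ x)
      (key' (hc (E.comp i)) (kc i) (hc (E.comp j)) (kc j) _ _)).trans ?_
    refine (congrArg (· ≫ _) (Cofunctor.comp'_act E F a b h)).trans ?_
    refine (Category.assoc _ _ _).symm.trans ?_
    refine (congrArg (· ≫ _) (ha _ _ _ _ _)).trans ?_
    exact ka _ _ _ _ _

/-- The contravariant functor from covering functors to cofunctors. -/
noncomputable def coveringToCofunctor (C : Type u) [Category.{v} C] [RestrictionCategory C] :
    (PCov.{w} C)ᵒᵖ ⥤ PCat.{w} C where
  obj A := A.unop.toPCat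
  map G := G.unop.2.cofunctor
  map_id A := Corresponds.unique (PartiteFunctor.IsCovering.id _)
    (PartiteFunctor.IsCovering.corresponds _) (Corresponds.id _)
  map_comp F G := Corresponds.unique (G.unop.2.comp F.unop.2)
    (PartiteFunctor.IsCovering.corresponds _)
    (Corresponds.comp G.unop.2.corresponds F.unop.2.corresponds)

/-- Cofunctors bijective on components. -/
def bijComp (C : Type u) [Category.{v} C] [RestrictionCategory C] :
    MorphismProperty (PCat.{w} C) := fun _ _ (F : Cofunctor _ _) => Function.Bijective F.comp

/-- Cofunctors bijective on objects. -/
def bijObj (C : Type u) [Category.{v} C] [RestrictionCategory C] :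
    MorphismProperty (PCat.{w} C) := fun _ _ (F : Cofunctor _ _) => ∀ i, IsIso (F.onObj i)

/-- Cofunctors bijective on arrows. -/
def bijArr (C : Type u) [Category.{v} C] [RestrictionCategory C] :
    MorphismProperty (PCat.{w} C) := fun _ _ (F : Cofunctor _ _) => ∀ i j, IsIso (F.onArr i j)

/-- Cofunctors bijective on components and arrows. -/
def bijCA (C : Type u) [Category.{v} C] [RestrictionCategory C] :
    MorphismProperty (PCat.{w} C) := bijComp C ⊓ bijArr C

end

/-! ### Full subcategories -/

section

variable {C : Type u} [Category.{v} C] [RestrictionCategory C]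

/-- Étale partite internal groupoids. -/
def IsEtaleGpd (C : Type u) [Category.{v} C] [RestrictionCategory C] :
    ObjectProperty (PCat.{w} C) := IsEtale C ⊓ IsPGpd C

/-- The objects of the category of covering functors with the property `P`. -/
def covOf (P : ObjectProperty (PCat.{w} C)) : ObjectProperty (PCov.{w} C) :=
  fun A => P A.toPCat

/-- The functor from covering functors to cofunctors, between objects with the property `P`. -/
noncomputable def coveringToCofunctorOf (P : ObjectProperty (PCat.{w} C)) :
    (covOf P).FullSubcategoryᵒᵖ ⥤ P.FullSubcategory :=
  P.lift ((covOf P).ι.op ⋙ coveringToCofunctor C) fun A => A.unop.property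

/-- `Φ` on source-étale partite internal categories. -/
noncomputable def etaleExt (C : Type u) [Category.{v} C] [RestrictionCategory C] :
    (IsEtale.{w} C).FullSubcategory ⥤ RCatOver.{w} C :=
  (IsEtale C).ι ⋙ externalisation C

/-- `Φ_g` on étale partite internal groupoids. -/
noncomputable def etaleExtG (C : Type u) [Category.{v} C] [RestrictionCategory C] :
    (IsEtaleGpd.{w} C).FullSubcategory ⥤ RCatOver.{w} C :=
  (IsPGpd C).lift (IsEtaleGpd C).ι (fun A => A.property.2) ⋙ externalisationG C

/-! ### Étale internal groupoids and pseudogroups -/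

/-- Étale internal groupoids in `C`. -/
structure EtaleGpd (C : Type u) [Category.{v} C] [RestrictionCategory C] where
  cat : PartiteCat PUnit.{1} C
  etale : cat.SourceEtale
  groupoid : cat.IsGroupoid

/-- An internal groupoid as a partite one. -/
def EtaleGpd.toPGpd (A : EtaleGpd C) : (IsPGpd.{0} C).FullSubcategory := ⟨⟨_, A.cat⟩, A.groupoid⟩

/-- An internal groupoid as an object of the category of covering functors. -/
def EtaleGpd.toPCov (A : EtaleGpd C) : PCov.{0} C := ⟨⟨_, A.cat⟩⟩

/-- The category of étale internal groupoids and cofunctors. -/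
abbrev EtaleGpdCof (C : Type u) [Category.{v} C] [RestrictionCategory C] :=
  InducedCategory _ (EtaleGpd.toPGpd (C := C))

/-- The category of étale internal groupoids and covering functors. -/
abbrev EtaleGpdCov (C : Type u) [Category.{v} C] [RestrictionCategory C] :=
  InducedCategory _ (EtaleGpd.toPCov (C := C))

/-- The functor from covering functors to cofunctors, for étale internal groupoids. -/
noncomputable def gpdCoveringToCofunctor (C : Type u) [Category.{v} C] [RestrictionCategory C] :
    (EtaleGpdCov C)ᵒᵖ ⥤ EtaleGpdCof C where
  obj A := A.unop
  map f := InducedCategory.homMk (ObjectProperty.homMk ((coveringToCofunctor C).map f.unop.hom.op))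
  map_id A := by
    apply InducedCategory.hom_ext
    apply ObjectProperty.hom_ext
    exact (coveringToCofunctor C).map_id _
  map_comp f g := by
    apply InducedCategory.hom_ext
    apply ObjectProperty.hom_ext
    exact (coveringToCofunctor C).map_comp f.unop.hom.op g.unop.hom.op

/-- The monoid of partial automorphisms of `X`; the product `s * t` is "first `t`, then `s`". -/
def partialAut (X : C) : Submonoid (End X) where
  carrier := {s | PartialIso (s : X ⟶ X)}
  one_mem' := PartialIso.id X
  mul_mem' hs ht := PartialIso.comp ht hs

/-- A monoid with a homomorphism to the partial automorphisms of an object `X` of `C`. -/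
structure MonOver (C : Type u) [Category.{v} C] [RestrictionCategory C] where
  carrier : Type v
  [monoid : Monoid carrier]
  X : C
  θ : carrier →* partialAut X

attribute [instance] MonOver.monoid

/-- Morphisms of monoids acting by partial automorphisms: a homomorphism `f` and a total map `g`
with `θ(s) ∘ g = g ∘ γ(f s)`. -/
structure MonOver.Hom (S T : MonOver C) where
  hom : S.carrier →* T.carrier
  map : T.X ⟶ S.X
  map_total : Total map
  comm : ∀ s, map ≫ (show S.X ⟶ S.X from (S.θ s).1) = (show T.X ⟶ T.X from (T.θ (hom s)).1) ≫ map

theorem MonOver.Hom.ext' {S T : MonOver C} {f g : MonOver.Hom S T}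
    (h : ∀ s, f.hom s = g.hom s) (h' : f.map = g.map) : f = g := by
  obtain ⟨f, fm, ft, fc⟩ := f
  obtain ⟨g, gm, gt, gc⟩ := g
  obtain rfl : f = g := MonoidHom.ext h
  obtain rfl : fm = gm := h'
  rfl

instance : Category (MonOver C) where
  Hom S T := MonOver.Hom S T
  id S := ⟨MonoidHom.id _, 𝟙 _, Total.id _,
    fun _ => (Category.id_comp _).trans (Category.comp_id _).symm⟩
  comp f g := ⟨g.hom.comp f.hom, g.map ≫ f.map, g.map_total.comp f.map_total, fun s => by
    rw [Category.assoc, f.comm, ← Category.assoc, g.comm, Category.assoc]; rfl⟩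
  id_comp f := MonOver.Hom.ext' (fun _ => rfl) (Category.comp_id _)
  comp_id f := MonOver.Hom.ext' (fun _ => rfl) (Category.id_comp _)
  assoc f g h := MonOver.Hom.ext' (fun _ => rfl) (Category.assoc _ _ _).symm

end

section

variable {S : Type w}

/-- `t` is a generalised inverse of `s`. -/
def MInverse [Monoid S] (s t : S) : Prop := s * t * s = s ∧ t * s * t = t

/-- The natural partial order of an inverse monoid: `s = t s* s`. -/
def MLe [Monoid S] (s t : S) : Prop := ∃ s', MInverse s s' ∧ t * (s' * s) = s

/-- Bicompatible elements `s` and `t` of an inverse monoid: `t s* s = s t* t` and likewise for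
`s*` and `t*`. -/
def MBicompatible [Monoid S] (s t : S) : Prop :=
  ∀ s' t', MInverse s s' → MInverse t t' →
    t * (s' * s) = s * (t' * t) ∧ t' * (s * s') = s' * (t * t')

/-- `j` is the join of the family `F`. -/
def MIsJoin [Monoid S] (F : Set S) (j : S) : Prop :=
  (∀ f ∈ F, MLe f j) ∧ ∀ k, (∀ f ∈ F, MLe f k) → MLe j k

/-- `m` is the meet of `f` and `g`. -/
def MIsMeet [Monoid S] (f g m : S) : Prop :=
  MLe m f ∧ MLe m g ∧ ∀ k, MLe k f → MLe k g → MLe k m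

/-- Join inverse monoids. -/
class JoinInverseMonoid (S : Type w) [Monoid S] : Prop where
  inverse : ∀ s : S, ∃! t, MInverse s t
  exists_join : ∀ F : Set S, (∀ f ∈ F, ∀ g ∈ F, MBicompatible f g) → ∃ j, MIsJoin F j
  join_mul : ∀ (g : S) (F : Set S) (j : S), MIsJoin F j → MIsJoin ((fun f => f * g) '' F) (j * g)

/-- Localic homomorphisms between inverse monoids. -/
def MLocalic {T : Type w'} [Monoid S] [Monoid T] (φ : S →* T) : Prop :=
  (∀ F j, MIsJoin F j → MIsJoin (φ '' F) (φ j)) ∧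
    (∀ f g m, MIsMeet f g m → MIsMeet (φ f) (φ g) (φ m)) ∧
      ∀ g, MIsJoin {h | ∃ f, MIsMeet g (φ f) h} g

end

section

variable {C : Type u} [Category.{v} C] [RestrictionCategory C]

/-- Complete `C`-pseudogroups. -/
def psGrp (C : Type u) [Category.{v} C] [RestrictionCategory C] : ObjectProperty (MonOver C) :=
  fun S => JoinInverseMonoid S.carrier ∧ Set.BijOn S.θ {e | e * e = e} {e | e * e = e}

/-- Morphisms whose homomorphism is localic. -/
def mLocalic (C : Type u) [Category.{v} C] [RestrictionCategory C] :
    MorphismProperty (MonOver C) := fun _ _ f => MLocalic f.hom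

/-- The unique object of the category of partial bisections of an internal groupoid. -/
def EtaleGpd.pt (A : EtaleGpd C) : ((externalisationG C).obj A.toPGpd).carrier := ⟨⟨PUnit.unit⟩⟩

/-- The functor taking an internal groupoid to its monoid of partial bisections, with its action
on the object of objects. -/
noncomputable def bisections (C : Type u) [Category.{v} C] [RestrictionCategory C] :
    EtaleGpdCof C ⥤ MonOver C where
  obj A :=
    { carrier := End (EtaleGpd.pt A)
      X := A.cat.obj PUnit.unit
      θ :=
        { toFun := fun s => ⟨((externalisationG C).obj (EtaleGpd.toPGpd A)).proj.map s, s.2⟩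
          map_one' := Subtype.ext
            (((externalisationG C).obj (EtaleGpd.toPGpd A)).proj.map_id (EtaleGpd.pt A))
          map_mul' := fun s t => Subtype.ext
            (((externalisationG C).obj (EtaleGpd.toPGpd A)).proj.map_comp
              (Y := EtaleGpd.pt A) t s) } }
  map {A B} F :=
    { hom :=
        { toFun := fun s => ((externalisationG C).map F.hom).functor.map s
          map_one' := ((externalisationG C).map F.hom).functor.map_id (EtaleGpd.pt A)
          map_mul' := fun s t =>
            ((externalisationG C).map F.hom).functor.map_comp (Y := EtaleGpd.pt A) t s }
      map := ((externalisationG C).map F.hom).trans.app (EtaleGpd.pt A)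
      map_total := ((externalisationG C).map F.hom).trans_total (EtaleGpd.pt A)
      comm := fun s => (((externalisationG C).map F.hom).trans.naturality
        (X := EtaleGpd.pt A) (Y := EtaleGpd.pt A) s).symm }
  map_id A := MonOver.Hom.ext'
    (fun s => eq_of_heq (congr_arg_heq
      (fun x : RCatOver.Hom _ _ => x.functor.map (X := EtaleGpd.pt A) (Y := EtaleGpd.pt A) s)
      ((externalisationG C).map_id (EtaleGpd.toPGpd A))))
    rfl
  map_comp {A B D} F G := MonOver.Hom.ext'
    (fun s => eq_of_heq (congr_arg_heq
      (fun x : RCatOver.Hom _ _ => x.functor.map (X := EtaleGpd.pt A) (Y := EtaleGpd.pt A) s)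
      ((externalisationG C).map_comp F.hom G.hom)))
    rfl

end

/-- Morphisms over `C` whose functor is bijective on objects. -/
def overBijObj (C : Type u) [Category.{v} C] [RestrictionCategory C] :
    MorphismProperty (RCatOver.{w} C) := fun _ _ F => Function.Bijective F.functor.obj

/-- Morphisms over `C` whose transformation is invertible. -/
def overIso (C : Type u) [Category.{v} C] [RestrictionCategory C] :
    MorphismProperty (RCatOver.{w} C) := fun _ _ F => ∀ X, IsIso (F.trans.app X)

/-- Morphisms over `C` whose functor satisfies the two conditions on meets. -/
def overMeet (C : Type u) [Category.{v} C] [RestrictionCategory C] :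
    MorphismProperty (RCatOver.{w} C) := fun _ _ F => MeetCondition F.functor

/-! ### Restricting functors and equivalences -/

section

variable {D : Type w₁} [Category.{w₂} D] {E : Type w₃} [Category.{w'} E]

/-- A functor all of whose values on maps lie in `V`, as a functor to the wide subcategory. -/
def wideLift (V : MorphismProperty E) [V.IsMultiplicative] (T : D ⥤ E)
    (h : ∀ {X Y : D} (f : X ⟶ Y), V (T.map f)) : D ⥤ WideSubcategory V where
  obj X := ⟨T.obj X⟩
  map f := ⟨T.map f, h f⟩
  map_id X := by ext; exact T.map_id X
  map_comp f g := by ext; exact T.map_comp f g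

/-- `T` factors through an isomorphism of categories onto the subcategory of all objects and the
maps in `V`. -/
def IsIsoOntoWide (T : D ⥤ E) (V : MorphismProperty E) : Prop :=
  ∃ (_ : V.IsMultiplicative) (hV : ∀ {X Y : D} (f : X ⟶ Y), V (T.map f)),
    (wideLift V T hV).IsIso

/-- `T` factors through an equivalence onto the full subcategory of the objects in `P`. -/
def IsEquivOnto (T : D ⥤ E) (P : ObjectProperty E) : Prop :=
  ∃ hP : ∀ X, P (T.obj X), (P.lift T hP).IsEquivalence

/-- `T` factors through an equivalence onto the subcategory of the objects in `P` and the maps in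
`V` between them. -/
def IsEquivOntoWide (T : D ⥤ E) (P : ObjectProperty E) (V : MorphismProperty E) : Prop :=
  ∃ (hP : ∀ X, P (T.obj X)) (_ : (V.inverseImage P.ι).IsMultiplicative)
    (hV : ∀ {X Y : D} (f : X ⟶ Y), V (T.map f)),
    (wideLift (V.inverseImage P.ι) (P.lift T hP) hV).IsEquivalence

/-- Under the functor `T : D ⥤ P` and any left adjoint `Ψ` of it, the maps of `D` in `W` and the
maps of `P` in `V` correspond. -/
def Matches (T : D ⥤ E) (P : ObjectProperty E) (W : MorphismProperty D)
    (V : MorphismProperty E) : Prop :=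
  ∃ hP : ∀ X, P (T.obj X), (∀ {X Y : D} (f : X ⟶ Y), W f ↔ V (T.map f)) ∧
    ∀ Ψ : P.FullSubcategory ⥤ D, Nonempty (Ψ ⊣ P.lift T hP) →
      ∀ {X Y : P.FullSubcategory} (g : X ⟶ Y), W (Ψ.map g) ↔ V g.hom

end

end EtaleCat

open EtaleCat CategoryTheory

/-! An étale category can be recovered from its partial sections. Because `σ_ij` is a total join of
partial isomorphisms, the partial inverses of these are partial sections that are jointly epic into
`A_ij`. This is recorded as an `Atlas`. Consequently an equation between maps out of `A_ij`, or out
of a fibre product formed with it, can be checked on sections (`Atlas.hom_ext`, `Atlas.ext_gen`),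
and a map out of it can be defined by a family of maps that agree on overlaps (`Atlas.exists_desc`).
Atlases pull back along total maps (`Atlas.pullback`).

Faithfulness and fullness of `Φ` follow. A cofunctor is determined by its action on a covering
family of sections (`Cofunctor.ext_push`), and a restriction functor with a total transformation
acts on sections compatibly with restriction and composition, so its values glue to a cofunctor
(`SectionRep`). For `Φ_g` the same argument applies to partial bisections, since these already cover
the arrows of an étale groupoid (`PartiteCat.SourceEtale.exists_atlas_bisections`).

For essential surjectivity let `P : 𝒜 ⥤ C` be hyperconnected. Meets of parallel maps exist in `𝒜`,
being joins of lower bounds, and `P (rest (f ∧ g))` for `f g : x ⟶ y` is a local atlas on `P x`. Its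
glueing is the object of arrows from `x` to `y`: one copy of `P x` for each map, identified where
the maps agree. Composition in `𝒜` respects these identifications and descends to an internal
category (`Glueing`, `GermSystem`). Each partial section of the glueing is locally a restriction of
a map of `𝒜`; hyperconnectedness supplies the restrictions in `𝒜` and joins put them together
(`Glueing.exists_sec_eq`). In the inverse case the join needs bicompatibility, which holds for
sections with partially invertible target (`compatible_inverse`).

A map over `C` between such categories preserves joins automatically, since joins are detected on
domains and the action on domains is pullback along `α` (`RCatOver.Hom.preservesJoins`). So localic
means bijective on objects together with (i) and (ii). These two conditions say that `F_ij` is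
invertible: by (ii) the images of the sections cover `B_ij`, and by (i) two images agree only where
the sections do (`Cofunctor.isIso_onArr`).

A functor is covering exactly when the comparison maps into the fibre products are invertible, and
their inverses form a cofunctor. The relation `Corresponds` expresses this without naming inverses,
which makes functoriality and bijectivity a matter of uniqueness. Finally, an inverse monoid is a
one-object inverse category with restriction `s* s`; functors between inverse categories preserve
restriction for free, so the statement on pseudogroups is the one-object case. -/

namespace EtaleCat

open RestrictionCategory

/-! ### The canonical order and partial inverses. -/

section Order

variable {D : Type u} [Category.{v} D] [RestrictionCategory D] {A B E : D}

theorem RLe.refl (f : A ⟶ B) : RLe f f := rest_comp f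

theorem rle_rest_comp {B' : D} (h : A ⟶ B') (g : A ⟶ B) : RLe (rest h ≫ g) g := by
  rw [RLe, rest_rest_comp, Category.assoc, rest_comp]

theorem RLe.trans {f g h : A ⟶ B} (h₁ : RLe f g) (h₂ : RLe g h) : RLe f h := by
  rw [RLe] at *
  rw [← h₁, rest_rest_comp, Category.assoc, h₂]

theorem RLe.rest_comp_rest {f g : A ⟶ B} (h : RLe f g) : rest f ≫ rest g = rest f := by
  rw [← rest_rest_comp, h]

theorem RLe.antisymm {f g : A ⟶ B} (h : RLe f g) (h' : RLe g f) : f = g := by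
  have e : rest f = rest g := by
    rw [← h.rest_comp_rest, rest_comm, h'.rest_comp_rest]
  rw [← h, e, rest_comp]

theorem RLe.rest {f g : A ⟶ B} (h : RLe f g) : RLe (rest f) (rest g) := by
  rw [RLe, rest_rest]; exact h.rest_comp_rest

theorem RLe.comp {f g : A ⟶ B} {f' g' : B ⟶ E} (h : RLe f g) (h' : RLe f' g') :
    RLe (f ≫ f') (g ≫ g') := by
  have h₁ : f ≫ f' = RestrictionCategory.rest (f ≫ f') ≫ f ≫ g' := by
    conv_lhs => rw [← h', ← Category.assoc, comp_rest, Category.assoc]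
  have h₂ : f ≫ g' = RestrictionCategory.rest f ≫ g ≫ g' := by rw [← Category.assoc, h]
  rw [RLe]
  conv_rhs => rw [h₁, h₂]
  rw [← Category.assoc _ (RestrictionCategory.rest f), rest_le]

theorem RLe.comp_left (h : E ⟶ A) {f g : A ⟶ B} (k : RLe f g) : RLe (h ≫ f) (h ≫ g) :=
  (RLe.refl h).comp k

theorem RLe.comp_right {f g : A ⟶ B} (k : RLe f g) (h : B ⟶ E) : RLe (f ≫ h) (g ≫ h) :=
  k.comp (RLe.refl h)

theorem RLe.compatible {f g k : A ⟶ B} (hf : RLe f k) (hg : RLe g k) : Compatible f g := by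
  rw [Compatible]
  conv_lhs => rw [← hf]
  conv_rhs => rw [← hg]
  rw [← Category.assoc, rest_comm, Category.assoc]

/-- A map below `g` is the restriction of `g` to its own domain, so only domains need comparing.
Equalities of joins are reduced to idempotents in this way. -/
theorem RLe.eq_of_rest {f g : A ⟶ B} (h : RLe f g) (h' : RLe (RestrictionCategory.rest g)
    (RestrictionCategory.rest f)) : f = g := by
  rw [RLe, rest_rest] at h'
  rw [← h, ← rest_comp g, ← Category.assoc, rest_comm, h']

theorem rle_of_rest {f g k : A ⟶ B} (hf : RLe f k) (hg : RLe g k)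
    (h : RLe (rest f) (rest g)) : RLe f g := by
  rw [RLe, rest_rest] at h
  rw [RLe, ← hg, ← Category.assoc, h, hf]

theorem rle_id_iff {e : A ⟶ A} : RLe e (𝟙 A) ↔ rest e = e := by
  rw [RLe, Category.comp_id]

theorem rest_of_rle_rest {B' : D} {e : A ⟶ A} {f : A ⟶ B'} (h : RLe e (rest f)) : rest e = e :=
  rle_id_iff.1 (h.trans (rle_id_iff.2 (rest_rest f)))

theorem rest_eq_comp {e : A ⟶ A} (he : rest e = e) (f : A ⟶ B) :
    rest (e ≫ f) = e ≫ rest f := by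
  conv_lhs => rw [← he, rest_rest_comp, he]

theorem rle_idem_comp {e : A ⟶ A} (he : rest e = e) (f : A ⟶ B) : RLe (e ≫ f) f := by
  rw [← he]; exact rle_rest_comp e f

theorem idem_idem {e : A ⟶ A} (he : rest e = e) : e ≫ e = e := by
  conv_lhs => rw [← he, rest_idem, he]

theorem idem_comm {e d : A ⟶ A} (he : rest e = e) (hd : rest d = d) : e ≫ d = d ≫ e := by
  rw [← he, ← hd, rest_comm]

theorem rest_idem_comp {e d : A ⟶ A} (he : rest e = e) (hd : rest d = d) :
    rest (e ≫ d) = e ≫ d := by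
  rw [rest_eq_comp he, hd]

theorem idem_rle_iff {e d : A ⟶ A} (he : rest e = e) : RLe e d ↔ e ≫ d = e := by
  rw [RLe, he]

theorem PartialInverse.symm {s : A ⟶ B} {t : B ⟶ A} (h : PartialInverse s t) :
    PartialInverse t s := ⟨h.2, h.1⟩

theorem PartialInverse.comp_rest {s : A ⟶ B} {t : B ⟶ A} (h : PartialInverse s t) :
    t ≫ rest s = t := by
  rw [RestrictionCategory.comp_rest, h.2, rest_rest, RestrictionCategory.rest_comp]

/-- `rest t ≫ t' = t ≫ s ≫ t' = t ≫ rest s = t`, so each of the two inverses is below the other. -/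
theorem PartialInverse.unique {s : A ⟶ B} {t t' : B ⟶ A} (h : PartialInverse s t)
    (h' : PartialInverse s t') : t = t' := by
  have key : ∀ {t t' : B ⟶ A}, PartialInverse s t → PartialInverse s t' → RLe t t' := by
    intro t t' h h'
    rw [RLe, ← h.2, Category.assoc, h'.1, h.comp_rest]
  exact (key h h').antisymm (key h' h)

theorem PartialInverse.of_rle {f g : A ⟶ B} {g' : B ⟶ A} (h : PartialInverse g g')
    (hf : RLe f g) : PartialInverse f (g' ≫ rest f) := by
  have h₁ : f = rest f ≫ g := hf.symm
  constructor
  · calc f ≫ g' ≫ rest f = (rest f ≫ g) ≫ g' ≫ rest f := by rw [← h₁]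
      _ = rest f := by
        rw [Category.assoc, reassoc_of% h.1, ← Category.assoc, hf.rest_comp_rest, rest_idem]
  · rw [Category.assoc, RestrictionCategory.rest_comp]
    conv_lhs => rw [h₁, ← Category.assoc, RestrictionCategory.comp_rest, Category.assoc, h.2]
    rw [rest_le, rest_comp_rest]

theorem PartialIso.of_rle {f g : A ⟶ B} (h : PartialIso g) (hf : RLe f g) : PartialIso f :=
  let ⟨_, h⟩ := h
  ⟨_, h.of_rle hf⟩

/-- By uniqueness `f'` is `g' ≫ rest f`, and composing with an idempotent makes a map smaller. -/
theorem PartialInverse.mono {f g : A ⟶ B} {f' g' : B ⟶ A} (hf : PartialInverse f f')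
    (hg : PartialInverse g g') (h : RLe f g) : RLe f' g' := by
  rw [hf.unique (hg.of_rle h)]
  conv_rhs => rw [← Category.comp_id g']
  exact RLe.comp_left _ (rle_id_iff.2 (rest_rest f))

theorem PartialInverse.idem {e : A ⟶ A} (he : rest e = e) : PartialInverse e e :=
  ⟨by rw [idem_idem he, he], by rw [idem_idem he, he]⟩

theorem IsJoin.unique {S : Set (A ⟶ B)} {j k : A ⟶ B} (h : IsJoin S j) (h' : IsJoin S k) :
    j = k := (h.2 k h'.1).antisymm (h'.2 j h.1)

theorem IsMeet.unique {f g m n : A ⟶ B} (h : IsMeet f g m) (h' : IsMeet f g n) :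
    m = n := (h'.2.2 m h.1 h.2.1).antisymm (h.2.2 n h'.1 h'.2.1)

theorem IsMeet.symm {f g m : A ⟶ B} (h : IsMeet f g m) : IsMeet g f m :=
  ⟨h.2.1, h.1, fun k hk hk' => h.2.2 k hk' hk⟩

end Order

/-! ### Joins of bounded families. -/

/-- Restriction categories in which families of parallel maps that are bounded above have joins,
preserved by precomposition. -/
class BoundedJoins (D : Type u) [Category.{v} D] [RestrictionCategory D] : Prop where
  exists_join : ∀ {A B : D} (S : Set (A ⟶ B)) (k : A ⟶ B), (∀ f ∈ S, RLe f k) → ∃ j, IsJoin S j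
  comp_join : ∀ {A' A B : D} (g : A' ⟶ A) (S : Set (A ⟶ B)) (j : A ⟶ B),
    IsJoin S j → IsJoin ((fun f => g ≫ f) '' S) (g ≫ j)

instance (D : Type u) [Category.{v} D] [RestrictionCategory D] [JoinRestriction D] :
    BoundedJoins D where
  exists_join S _ h := JoinRestriction.exists_join S fun f hf g hg => (h f hf).compatible (h g hg)
  comp_join := JoinRestriction.comp_join

/-- The inverses of maps below `k` lie below the inverse of `k`, so a bounded family is
bicompatible. `BoundedJoins` is therefore common ground for the join restriction and the join
inverse case. -/
theorem BoundedJoins.of_joinInverse (D : Type u) [Category.{v} D] [RestrictionCategory D]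
    [JoinInverse D] : BoundedJoins D where
  exists_join S k h := JoinInverse.exists_join S fun f hf g hg =>
    ⟨(h f hf).compatible (h g hg), fun s' t' hs ht => by
      obtain ⟨k', hk⟩ := JoinInverse.partialIso k
      exact (hs.mono hk (h f hf)).compatible (ht.mono hk (h g hg))⟩
  comp_join := JoinInverse.comp_join

section Joins

variable {D : Type u} [Category.{v} D] [RestrictionCategory D] [BoundedJoins D] {A B E : D}

theorem IsJoin.rest {S : Set (A ⟶ B)} {j : A ⟶ B} (h : IsJoin S j) :
    IsJoin (RestrictionCategory.rest '' S) (RestrictionCategory.rest j) := by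
  have hb : ∀ e ∈ RestrictionCategory.rest '' S, RLe e (RestrictionCategory.rest j) := by
    rintro _ ⟨f, hf, rfl⟩; exact (h.1 f hf).rest
  obtain ⟨e, he⟩ := BoundedJoins.exists_join _ _ hb
  have hle := he.2 _ hb
  have hee := rest_of_rle_rest hle
  -- `e` is the join of the domains, so cutting `j` down to `e` still leaves an upper bound of `S`;
  -- hence the domain of `j` is no larger than `e`.
  have : RLe j (e ≫ j) := h.2 _ fun f hf => by
    have h₁ := he.1 _ ⟨f, hf, rfl⟩
    rw [RLe, rest_rest] at h₁
    rw [RLe, ← Category.assoc, h₁]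
    exact h.1 f hf
  have : RLe (RestrictionCategory.rest j) e := by
    have h₂ := this.rest_comp_rest
    rw [rest_eq_comp hee] at h₂
    rw [RLe, rest_rest]
    have h₃ : RestrictionCategory.rest j ≫ e = e ≫ RestrictionCategory.rest j :=
      idem_comm (rest_rest j) hee
    rw [← h₃, ← Category.assoc, rest_idem] at h₂
    exact h₂
  rwa [← hle.antisymm this]

theorem IsJoin.comp_left {S : Set (A ⟶ B)} {j : A ⟶ B} (h : IsJoin S j) (g : E ⟶ A) :
    IsJoin ((fun f => g ≫ f) '' S) (g ≫ j) := BoundedJoins.comp_join g S j h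

/-- The join `k` of `S` lies below `j`, and its domain contains every `rest f`, hence that of `j`.
-/
theorem isJoin_of_rest {S : Set (A ⟶ B)} {j : A ⟶ B} (h : ∀ f ∈ S, RLe f j)
    (h' : IsJoin (RestrictionCategory.rest '' S) (RestrictionCategory.rest j)) : IsJoin S j := by
  obtain ⟨k, hk⟩ := BoundedJoins.exists_join S j h
  have hkj := hk.2 j h
  have := hkj.eq_of_rest (h'.2 _ hk.rest.1)
  rwa [← this]

/-- Only precomposition is assumed to preserve joins. For postcomposition it suffices to compare
domains, and `rest (f ≫ g)` is the domain of `rest (j ≫ g) ≫ f`, which is a precomposite. -/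
theorem IsJoin.comp_right {S : Set (A ⟶ B)} {j : A ⟶ B} (h : IsJoin S j) (g : B ⟶ E) :
    IsJoin ((fun f => f ≫ g) '' S) (j ≫ g) := by
  refine isJoin_of_rest ?_ ?_
  · rintro _ ⟨f, hf, rfl⟩; exact (h.1 f hf).comp_right g
  · have h₁ := (h.comp_left (RestrictionCategory.rest (j ≫ g))).rest
    rw [rest_rest_comp, rest_le] at h₁
    convert h₁ using 1
    ext e
    simp only [Set.mem_image, exists_exists_and_eq_and]
    have key : ∀ f ∈ S, RestrictionCategory.rest (f ≫ g) =
        RestrictionCategory.rest (RestrictionCategory.rest (j ≫ g) ≫ f) := by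
      intro f hf
      conv_lhs => rw [← h.1 f hf, Category.assoc, rest_rest_comp]
      rw [rest_rest_comp, rest_comm]
    exact ⟨fun ⟨f, hf, hh⟩ => ⟨f, hf, (key f hf).symm.trans hh⟩,
      fun ⟨f, hf, hh⟩ => ⟨f, hf, (key f hf).trans hh⟩⟩

/-- The meet is the join of all common lower bounds, a family bounded by `f`. -/
theorem exists_isMeet (f g : A ⟶ B) : ∃ m, IsMeet f g m := by
  obtain ⟨m, hm⟩ := BoundedJoins.exists_join {k | RLe k f ∧ RLe k g} f fun k hk => hk.1
  exact ⟨m, hm.2 _ fun k hk => hk.1, hm.2 _ fun k hk => hk.2, fun k h h' => hm.1 k ⟨h, h'⟩⟩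

/-- Maps agreeing on a family of restriction idempotents with join `e` agree on `e`. -/
theorem IsJoin.ext {T : D} {S : Set (T ⟶ T)} {e : T ⟶ T} (h : IsJoin S e) {u v : T ⟶ B}
    (huv : ∀ d ∈ S, d ≫ u = d ≫ v) : e ≫ u = e ≫ v := by
  have h₁ := h.comp_right u
  have h₂ := h.comp_right v
  have : (fun f => f ≫ u) '' S = (fun f => f ≫ v) '' S := Set.image_congr huv
  rw [this] at h₁
  exact h₁.unique h₂

theorem isJoin_partialInverse {S : Set (A ⟶ B)} {S' : Set (B ⟶ A)} {j : A ⟶ B} {j' : B ⟶ A}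
    (hj : IsJoin S j) (hj' : IsJoin S' j') (h : ∀ s ∈ S, ∃ s' ∈ S', PartialInverse s s')
    (h' : ∀ s' ∈ S', ∃ s ∈ S, PartialInverse s s') : PartialInverse j j' := by
  have key : ∀ {A B : D} {S : Set (A ⟶ B)} {S' : Set (B ⟶ A)} {j : A ⟶ B} {j' : B ⟶ A},
      IsJoin S j → IsJoin S' j' → (∀ s ∈ S, ∃ s' ∈ S', PartialInverse s s') →
      j ≫ j' = RestrictionCategory.rest j := by
    intro A B S S' j j' hj hj' h
    have h₁ := hj.comp_right j'
    have : (fun f => f ≫ j') '' S = RestrictionCategory.rest '' S := by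
      refine Set.image_congr fun s hs => ?_
      obtain ⟨s', hs', hi⟩ := h s hs
      -- The range of `s` lies in the domain of `s'`, where `j'` coincides with `s'`.
      have h₂ : s = s ≫ RestrictionCategory.rest s' := by
        rw [hi.symm.comp_rest]
      conv_lhs => rw [h₂, Category.assoc, hj'.1 s' hs', hi.1]
    rw [this] at h₁
    exact h₁.unique hj.rest
  exact ⟨key hj hj' h, key hj' hj fun s' hs' =>
    let ⟨s, hs, hi⟩ := h' s' hs'
    ⟨s, hs, hi.symm⟩⟩

end Joins

end EtaleCat

/-! ### Atlases of local homeomorphisms. -/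

namespace EtaleCat

open RestrictionCategory

variable {C : Type u} [Category.{v} C] [RestrictionCategory C]

theorem rest_comp_idem {T X Z : C} (f : T ⟶ X) {e : X ⟶ X} (he : rest e = e) (g : X ⟶ Z) :
    f ≫ e ≫ g = rest (f ≫ e) ≫ f ≫ g := by
  have := comp_rest_assoc' f e g
  rwa [he] at this

/-- A presentation of a total map `p` as a join of partial isomorphisms `q k`, with partial inverses
`s k` that are jointly epic. -/
structure Atlas {A X : C} (p : A ⟶ X) {K : Type w} (q : K → (A ⟶ X)) (s : K → (X ⟶ A)) :
    Prop where
  total : Total p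
  le : ∀ k, RLe (q k) p
  inv : ∀ k, PartialInverse (q k) (s k)
  hom_ext : ∀ {Z : C} (u v : A ⟶ Z), (∀ k, s k ≫ u = s k ≫ v) → u = v

/-- Taking domains preserves the join, so the idempotents `rest (q k) = q k ≫ s k` have join `rest p
= 𝟙`. Maps that agree after every `s k` agree on each of these idempotents. -/
theorem Atlas.of_isJoin [BoundedJoins C] {A X : C} {p : A ⟶ X} {K : Type w} {q : K → (A ⟶ X)}
    {s : K → (X ⟶ A)} (hp : Total p) (hj : IsJoin (Set.range q) p)
    (hi : ∀ k, PartialInverse (q k) (s k)) : Atlas p q s where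
  total := hp
  le k := hj.1 _ ⟨k, rfl⟩
  inv := hi
  hom_ext u v h := by
    have hr := hj.rest
    rw [hp] at hr
    have := hr.ext (u := u) (v := v) (by
      rintro _ ⟨_, ⟨k, rfl⟩, rfl⟩
      rw [← (hi k).1, Category.assoc, Category.assoc, h])
    simpa using this

namespace Atlas

section

variable {A X : C} {p : A ⟶ X} {K : Type w} {q : K → (A ⟶ X)} {s : K → (X ⟶ A)}
variable (a : Atlas p q s)

include a

theorem q_eq (k : K) : rest (q k) ≫ p = q k := a.le k

theorem sec_q (k : K) : s k ≫ rest (q k) = s k := (a.inv k).comp_rest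

theorem sec (k : K) : s k ≫ p = rest (s k) := by
  rw [← a.sec_q, Category.assoc, a.q_eq, a.sec_q, (a.inv k).2]

/-- `s k ≫ q l` lies below `s k ≫ p = rest (s k)`, so it is an idempotent of `X`. By `phi_sec` the
sections `s k` and `s l` agree on it; it plays the role of the overlap of two charts, seen in the
base. -/
theorem rest_phi (k l : K) : rest (s k ≫ q l) = s k ≫ q l := by
  refine rest_of_rle_rest (f := s k) ?_
  rw [← a.sec k]
  exact (a.le l).comp_left _

theorem phi_self (k : K) : s k ≫ q k = rest (s k) := (a.inv k).2

theorem phi_symm (k l : K) : s k ≫ q l = s l ≫ q k := by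
  have key : ∀ k l, RLe (s k ≫ q l) (s l ≫ q k) := by
    intro k l
    rw [RLe, a.rest_phi, Category.assoc, ← Category.assoc (q l), (a.inv l).1, comp_rest_assoc',
      (a.inv k).2, a.rest_phi]
    nth_rw 1 [← a.rest_phi k l]
    rw [rest_le, a.rest_phi]
  exact (key k l).antisymm (key l k)

theorem sec_rest (k l : K) : s k ≫ rest (q l) = (s k ≫ q l) ≫ s k := by
  rw [comp_rest, a.rest_phi]

theorem phi_sec (k l : K) : (s k ≫ q l) ≫ s l = (s k ≫ q l) ≫ s k := by
  rw [← a.sec_rest, Category.assoc, (a.inv l).1]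

theorem phi_trans (k l m : K) : RLe ((s k ≫ q l) ≫ s l ≫ q m) (s k ≫ q m) := by
  rw [Category.assoc, ← Category.assoc (q l), (a.inv l).1]
  exact (rle_rest_comp _ _).comp_left _

/-- Local form of a generalised element: on the part of `T` that `x` sends into the chart `k`, `x`
is recovered from its image in the base by the section `s k`. -/
theorem rest_comp_eq {T : C} (x : T ⟶ A) (k : K) :
    rest (x ≫ q k) ≫ x = (rest (x ≫ q k) ≫ x ≫ p) ≫ s k := by
  rw [← comp_rest]
  nth_rw 1 [← (a.inv k).1]
  rw [← comp_rest_assoc', a.q_eq, Category.assoc]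

theorem comp {A' : C} {p' : A' ⟶ A} {L : Type w'} {q' : L → (A' ⟶ A)} {s' : L → (A ⟶ A')}
    (a' : Atlas p' q' s') : Atlas (p' ≫ p) (fun x : K × L => q' x.2 ≫ q x.1)
      (fun x => s x.1 ≫ s' x.2) where
  total := a'.total.comp a.total
  le x := (a'.le _).comp (a.le _)
  inv x := (a'.inv _).comp (a.inv _)
  hom_ext u v h := a'.hom_ext _ _ fun l => a.hom_ext _ _ fun k => by
    have := h (k, l)
    simpa using this

variable [JoinRestriction C]

/-- The converse of `Atlas.of_isJoin`: the join `e` of the chart domains satisfies `s k ≫ e = s k`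
for all `k`, and the `s k` are jointly epic. -/
theorem isJoin : IsJoin (Set.range fun k => rest (q k)) (𝟙 A) := by
  obtain ⟨e, he⟩ := BoundedJoins.exists_join (Set.range fun k => rest (q k)) (𝟙 A) (by
    rintro _ ⟨k, rfl⟩; exact rle_id_iff.2 (rest_rest _))
  have h1 : RLe e (𝟙 A) := he.2 _ (by rintro _ ⟨k, rfl⟩; exact rle_id_iff.2 (rest_rest _))
  have : e = 𝟙 A := a.hom_ext _ _ fun k => by
    refine (h1.comp_left (s k)).antisymm ?_
    rw [Category.comp_id]
    nth_rw 1 [← a.sec_q k]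
    exact (he.1 _ ⟨k, rfl⟩).comp_left _
  rwa [← this]

theorem isJoin_comp {T : C} (x : T ⟶ A) : IsJoin (Set.range fun k => x ≫ rest (q k)) x := by
  have := a.isJoin.comp_left x
  rw [Category.comp_id, ← Set.range_comp] at this
  exact this

theorem isJoin_rest {T : C} (x : T ⟶ A) :
    IsJoin (Set.range fun k => rest (x ≫ q k)) (rest x) := by
  have := (a.isJoin_comp x).rest
  rw [← Set.range_comp] at this
  simpa [Function.comp_def, rest_comp_rest] using this

theorem ext_gen {T Z : C} (x : T ⟶ A) {u v : T ⟶ Z}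
    (h : ∀ k, rest (x ≫ q k) ≫ u = rest (x ≫ q k) ≫ v) : rest x ≫ u = rest x ≫ v :=
  (a.isJoin_rest x).ext (by rintro _ ⟨k, rfl⟩; exact h k)

/-- Maps out of `A` are glued from compatible maps on the charts. -/
theorem exists_desc {Z : C} (h : K → (X ⟶ Z))
    (hc : ∀ k l, (s k ≫ q l) ≫ h l = (s k ≫ q l) ≫ h k) :
    ∃ u : A ⟶ Z, ∀ k, s k ≫ u = rest (s k) ≫ h k := by
  have key : ∀ k l, rest (q k) ≫ q l ≫ h l = rest (q l) ≫ q k ≫ h k := by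
    intro k l
    have e : rest (q k) ≫ q l = rest (q l) ≫ q k := (a.le l).compatible (a.le k)
    have e' : rest (q l) ≫ q k = q l ≫ s l ≫ q k := by
      rw [← (a.inv l).1, Category.assoc]
    have := congrArg (fun x => q l ≫ x) (hc l k)
    simp only [Category.assoc] at this
    rw [← Category.assoc, e, e', ← Category.assoc (rest (q l)), e']
    simp [this]
  have hcomp : ∀ f ∈ Set.range (fun k => q k ≫ h k), ∀ g ∈ Set.range (fun k => q k ≫ h k),
      Compatible f g := by
    rintro _ ⟨k, rfl⟩ _ ⟨l, rfl⟩
    have h1 : ∀ k l, rest (q k ≫ h k) ≫ q l ≫ h l = rest (q l) ≫ q k ≫ h k := by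
      intro k l
      rw [← rest_le (q k) (h k), Category.assoc, key, ← Category.assoc, rest_comm,
        Category.assoc, rest_comp]
    change rest (q l ≫ h l) ≫ q k ≫ h k = rest (q k ≫ h k) ≫ q l ≫ h l
    rw [h1, h1, key]
  -- The glued map is the join of the local candidates `q k ≫ h k`.
  obtain ⟨u, hu⟩ := JoinRestriction.exists_join _ hcomp
  refine ⟨u, fun k => ?_⟩
  have hk := hu.comp_left (s k)
  refine (hk.2 _ ?_).antisymm ?_
  · rintro _ ⟨_, ⟨l, rfl⟩, rfl⟩
    change RLe (s k ≫ q l ≫ h l) _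
    rw [← Category.assoc, hc]
    refine RLe.comp_right ?_ _
    rw [← a.sec k]
    exact (a.le l).comp_left _
  · refine hk.1 _ ⟨_, ⟨k, rfl⟩, ?_⟩
    change s k ≫ q k ≫ h k = _
    rw [← Category.assoc, a.phi_self]

/-- Every partial section is a partial isomorphism. -/
theorem exists_inverse (t : X ⟶ A) (ht : t ≫ p = rest t) :
    ∃ t' : A ⟶ X, PartialInverse t' t ∧ RLe t' p := by
  have hid : ∀ k, rest (t ≫ q k) = t ≫ q k := fun k => by
    refine rest_of_rle_rest (f := t) ?_
    rw [← ht]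
    exact (a.le k).comp_left _
  -- On the chart `k` the inverse of `t` is `q k`, cut down to the idempotent `t ≫ q k` on which `t`
  -- and `s k` coincide. These pieces lie below `p`, so they have a join.
  have hle : ∀ f ∈ Set.range (fun k => q k ≫ t ≫ q k), RLe f p := by
    rintro _ ⟨k, rfl⟩
    refine RLe.trans ?_ (a.le k)
    have := (rle_id_iff.2 (hid k)).comp_left (q k)
    rwa [Category.comp_id] at this
  obtain ⟨t', ht'⟩ := BoundedJoins.exists_join _ p hle
  have hpi : ∀ k, PartialInverse (t ≫ rest (q k)) (q k ≫ t ≫ q k) := fun k => by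
    have := (PartialInverse.idem (hid k)).comp (a.inv k).symm
    rwa [Category.assoc, (a.inv k).1] at this
  refine ⟨t', (isJoin_partialInverse (a.isJoin_comp t) ht' ?_ ?_).symm, ht'.2 _ hle⟩
  · rintro _ ⟨k, rfl⟩; exact ⟨_, ⟨k, rfl⟩, hpi k⟩
  · rintro _ ⟨k, rfl⟩; exact ⟨_, ⟨k, rfl⟩, hpi k⟩

/-- The charts of `P` are the preimages under `fst` of the charts of `A`, and the map `r k` is the
lift of `s k`. They cover `P` because `fst` and `snd` have the same domain and the charts of `A`
cover every generalised element. -/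
theorem pullback {P Y : C} {fst : P ⟶ A} {snd : P ⟶ Y} {f : Y ⟶ X} (hf : Total f)
    (hP : IsPullback fst snd p f) (r : K → (Y ⟶ P)) (hr : ∀ k, r k ≫ fst = f ≫ s k)
    (hr' : ∀ k, r k ≫ snd = rest (f ≫ s k)) :
    Atlas snd (fun k => rest (fst ≫ q k) ≫ snd) r := by
  have hs : rest fst = rest snd := by
    rw [← rest_comp_total _ a.total, hP.w, rest_comp_total _ hf]
  have ht : Total snd := by
    apply hP.hom_ext
    · rw [← hs, rest_comp, Category.id_comp]
    · rw [rest_comp, Category.id_comp]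
  have h0 : ∀ k, rest (fst ≫ q k) ≫ fst = fst ≫ rest (q k) := fun k => (comp_rest _ _).symm
  have hqs : ∀ k, rest (fst ≫ q k) ≫ fst ≫ p ≫ s k = rest (fst ≫ q k) ≫ fst := fun k => by
    have e : rest (q k) ≫ p ≫ s k = rest (q k) := by
      rw [← Category.assoc, a.q_eq, (a.inv k).1]
    rw [← Category.assoc, h0, Category.assoc, e]
  have hpi : ∀ k, (rest (fst ≫ q k) ≫ snd) ≫ r k = rest (fst ≫ q k) := fun k => by
    have e1 : snd ≫ f ≫ s k = fst ≫ p ≫ s k := by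
      rw [← Category.assoc, ← hP.w, Category.assoc]
    apply hP.hom_ext
    · rw [Category.assoc, Category.assoc, hr, e1, hqs]
    · rw [Category.assoc, Category.assoc, hr', comp_rest, e1, ← Category.assoc,
        ← rest_rest_comp, hqs, rest_rest_comp, Total] at *
      rw [hs, ht, Category.comp_id]
  have hrr : ∀ k, rest (r k) = rest (f ≫ s k) := fun k => by
    rw [← rest_comp_total _ ht, hr', rest_rest]
  refine ⟨ht, fun k => rle_rest_comp _ _, fun k => ⟨?_, ?_⟩, fun u v h => ?_⟩
  · rw [hpi, rest_rest_comp, ht, Category.comp_id]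
  · have e : rest (f ≫ s k ≫ q k) = rest (f ≫ s k) := by
      rw [a.phi_self, rest_comp_rest]
    rw [comp_rest_assoc', hr', ← Category.assoc, hr, Category.assoc, e, rest_idem, hrr]
  · have := a.ext_gen fst (u := u) (v := v) fun k => by
      rw [← hpi k, Category.assoc, h, ← Category.assoc]
    rwa [hs, ht, Category.id_comp, Category.id_comp] at this

end

end Atlas

/-! ### Pullbacks of local homeomorphisms. -/

section

variable [JoinRestriction C]

/-- Every partial section is invertible onto a part of `A` by `Atlas.exists_inverse`, so all of them
may serve as charts. The index type of this maximal atlas is a subtype of a hom-set, which is the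
size for which local glueings exist. -/
theorem LocalHomeo.exists_atlas {A X : C} {p : A ⟶ X} (hp : LocalHomeo p) :
    ∃ q : {s : X ⟶ A // s ≫ p = rest s} → (A ⟶ X), Atlas p q (fun s => s.1) := by
  obtain ⟨ht, S, hS, hj⟩ := hp
  choose inv hinv using hS
  have a : Atlas p (fun s : S => s.1) (fun s => inv s.1 s.2) := by
    refine Atlas.of_isJoin ht ?_ fun s => hinv s.1 s.2
    simpa using hj
  choose q hq hq' using fun t : {s : X ⟶ A // s ≫ p = rest s} => a.exists_inverse t.1 t.2
  exact ⟨q, ht, hq', hq, fun u v h => a.hom_ext u v fun k => h ⟨_, a.sec k⟩⟩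

theorem Atlas.localHomeo {A X : C} {p : A ⟶ X} {K : Type w} {q : K → (A ⟶ X)} {s : K → (X ⟶ A)}
    (a : Atlas p q s) : LocalHomeo p := by
  refine ⟨a.total, Set.range q, ?_, ?_⟩
  · rintro _ ⟨k, rfl⟩; exact ⟨_, a.inv k⟩
  · have := a.isJoin.comp_right p
    rw [Category.id_comp, ← Set.range_comp] at this
    convert this using 2
    funext k
    exact (a.q_eq k).symm

theorem exists_atlas_of_localAtlas [HasLocalGlueings C] {X : C} {I : Type v}
    (φ : I → I → (X ⟶ X)) (h : IsLocalAtlas φ) :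
    ∃ (A : C) (p : A ⟶ X) (q : I → (A ⟶ X)) (s : I → (X ⟶ A)), Atlas p q s ∧
      ∀ i j, s i ≫ q j = φ i j := by
  obtain ⟨A, p, q, s, ht, hj, hi, hφ⟩ := HasLocalGlueings.exists_glueing φ h
  exact ⟨A, p, q, s, Atlas.of_isJoin ht hj hi, fun i j => (hφ i j).symm⟩

/-- Local homeomorphisms have pullbacks along total maps. -/
theorem LocalHomeo.hasPullback [HasLocalGlueings C] {A X Y : C} {p : A ⟶ X} (hp : LocalHomeo p)
    (f : Y ⟶ X) (hf : Total f) : HasPullback p f := by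
  obtain ⟨K, q, s, a⟩ : ∃ (K : Type v) (q : K → (A ⟶ X)) (s : K → (X ⟶ A)), Atlas p q s :=
    ⟨_, _, _, hp.exists_atlas.choose_spec⟩
  -- The inverse images along `f` of the overlaps on `X`. The glueing `E` of this atlas is the
  -- pullback, `p'` its projection to `Y`, and the projection `fst` to `A` is glued from the maps `f
  -- ≫ s k`.
  let φ : K → K → (Y ⟶ Y) := fun k l => rest (f ≫ s k ≫ q l)
  have hφ : IsLocalAtlas φ := by
    refine ⟨fun k l => rest_rest _, fun k l => ?_, fun k l m => ?_⟩
    · change rest _ = rest _; rw [a.phi_symm]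
    · change RLe (rest _ ≫ rest _) (rest _)
      rw [← rest_rest_comp, ← rest_comp_idem f (a.rest_phi k l)]
      exact ((a.phi_trans k l m).comp_left f).rest
  obtain ⟨E, p', q', r, b, hb⟩ := exists_atlas_of_localAtlas φ hφ
  have hrr : ∀ k, rest (r k) = rest (f ≫ s k) := fun k => by
    rw [← b.phi_self, hb]; change rest _ = _; rw [a.phi_self, rest_comp_rest]
  have hfφ : ∀ k l {Z : C} (g : X ⟶ Z), φ k l ≫ f ≫ g = f ≫ (s k ≫ q l) ≫ g := fun k l _ g =>
    (rest_comp_idem f (a.rest_phi k l) g).symm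
  obtain ⟨fst, hfst⟩ := b.exists_desc (fun k => f ≫ s k) (fun k l => by
    rw [hb, hfφ, hfφ, a.phi_sec])
  have hfst' : ∀ k, r k ≫ fst = f ≫ s k := fun k => by rw [hfst, hrr, rest_comp]
  have hw : fst ≫ p = p' ≫ f := b.hom_ext _ _ fun k => by
    rw [← Category.assoc, hfst', Category.assoc, a.sec, comp_rest, ← Category.assoc, b.sec, hrr]
  have hqq : ∀ k, rest (q' k) = rest (fst ≫ q k) := fun k => b.hom_ext _ _ fun l => by
    rw [b.sec_rest, hb, comp_rest, ← Category.assoc, hfst', Category.assoc]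
  have huniq : ∀ {T : C} (x y : T ⟶ E), x ≫ fst = y ≫ fst → x ≫ p' = y ≫ p' → x = y := by
    intro T x y h h'
    have key : ∀ k, x ≫ rest (q' k) = y ≫ rest (q' k) := fun k => by
      -- On the chart `k` a generalised element of `E` is determined by its two projections.
      have : ∀ z : T ⟶ E, z ≫ rest (q' k) = (rest ((z ≫ fst) ≫ q k) ≫ z ≫ p') ≫ r k := by
        intro z
        rw [← (b.inv k).1]
        conv_lhs => rw [← b.q_eq, hqq, ← Category.assoc, ← Category.assoc, comp_rest]
        simp
      rw [this, this, h, h']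
    have hx := b.isJoin_comp x
    simp only [key] at hx
    exact hx.unique (b.isJoin_comp y)
  refine (IsPullback.of_isLimit' (f := p) (g := f) (fst := fst) (snd := p') ⟨hw⟩ ?_).hasPullback
  have hex : ∀ {T : C} (x : T ⟶ A) (y : T ⟶ Y), x ≫ p = y ≫ f →
      ∃ z : T ⟶ E, z ≫ fst = x ∧ z ≫ p' = y := by
    intro T x y hxy
    have hxy' : rest x = rest y := by
      rw [← rest_comp_total x a.total, hxy, rest_comp_total _ hf]
    -- Where `x` lies in the chart `k`, the lift has to be `y` followed by the section `r k`; the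
    -- lift is the join of these pieces.
    let z : K → (T ⟶ E) := fun k => rest (x ≫ q k) ≫ y ≫ r k
    have key : ∀ k l, rest (x ≫ q l) ≫ z k = rest (x ≫ q k) ≫ z l := by
      -- Where `x` lies in both charts, `y` lands in the overlap `φ k l`, and there `r k` and `r l`
      -- agree.
      have h1 : ∀ k l, rest (x ≫ q k) ≫ rest (x ≫ q l) =
          (rest (x ≫ q k) ≫ rest (x ≫ q l)) ≫ rest (y ≫ φ k l) := by
        intro k l
        have e1 : rest (y ≫ φ k l) = rest (x ≫ p ≫ s k ≫ q l) := by
          change rest (y ≫ rest _) = _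
          rw [rest_comp_rest, ← Category.assoc y, ← hxy, Category.assoc]
        have e2 : RLe (rest (x ≫ q k ≫ s k ≫ q l)) (rest (x ≫ p ≫ s k ≫ q l)) :=
          (((a.le k).comp_right _).comp_left x).rest
        have e3 : rest (x ≫ q k ≫ s k ≫ q l) = rest (x ≫ q k) ≫ rest (x ≫ q l) := by
          rw [← Category.assoc (q k), (a.inv k).1, comp_rest_assoc', rest_rest_comp]
        rw [e1, ← e3, (idem_rle_iff (rest_rest _)).1 e2]
      intro k l
      have h2 : ∀ k l m, (rest (x ≫ q k) ≫ rest (x ≫ q l)) ≫ y ≫ r m =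
          (rest (x ≫ q k) ≫ rest (x ≫ q l)) ≫ y ≫ φ k l ≫ r m := by
        intro k l m
        have : y ≫ φ k l ≫ r m = rest (y ≫ φ k l) ≫ y ≫ r m :=
          rest_comp_idem y (rest_rest _) _
        rw [this, ← Category.assoc _ (rest (y ≫ φ k l)), ← h1]
      change rest _ ≫ rest _ ≫ _ = rest _ ≫ rest _ ≫ _
      rw [← Category.assoc (rest (x ≫ q l)) (rest (x ≫ q k)),
        ← Category.assoc (rest (x ≫ q k)) (rest (x ≫ q l)), rest_comm (x ≫ q l) (x ≫ q k), h2 k l k,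
        h2 k l l, ← hb, b.phi_sec]
    have hcomp : ∀ u ∈ Set.range z, ∀ v ∈ Set.range z, Compatible u v := by
      rintro _ ⟨k, rfl⟩ _ ⟨l, rfl⟩
      have hz : ∀ k, rest (z k) ≫ rest (x ≫ q k) = rest (z k) := fun k => by
        change rest (rest _ ≫ _) ≫ _ = rest (rest _ ≫ _)
        rw [rest_comm, rest_rest_comp, ← Category.assoc, rest_idem]
      have : ∀ k l, rest (z l) ≫ z k = rest (x ≫ q k) ≫ z l := fun k l => by
        rw [← hz, Category.assoc, key, ← Category.assoc, rest_comm, Category.assoc, rest_comp]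
      rw [Compatible, this, this, key]
    obtain ⟨t, ht⟩ := JoinRestriction.exists_join _ hcomp
    refine ⟨t, ?_, ?_⟩
    · have h1 := ht.comp_right fst
      rw [← Set.range_comp] at h1
      refine h1.unique ?_
      convert a.isJoin_comp x using 2
      funext k
      change (rest _ ≫ _) ≫ _ = _
      rw [Category.assoc, Category.assoc, hfst', ← Category.assoc y, ← hxy, Category.assoc,
        ← Category.assoc, ← comp_rest, Category.assoc, ← Category.assoc (rest (q k)), a.q_eq,
        (a.inv k).1]
    · have h1 := ht.comp_right p'
      rw [← Set.range_comp] at h1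
      refine h1.unique ?_
      have h2 := (a.isJoin_rest x).comp_right y
      rw [← Set.range_comp, hxy', rest_comp] at h2
      convert h2 using 2
      funext k
      change (rest _ ≫ _) ≫ _ = rest _ ≫ _
      have e : rest (x ≫ q k) ≫ rest (y ≫ r k) = rest (x ≫ q k) := by
        have e1 : rest (y ≫ r k) = rest (x ≫ p ≫ s k) := by
          rw [← rest_comp_rest, hrr, rest_comp_rest, ← Category.assoc, ← hxy, Category.assoc]
        have e2 : rest (x ≫ q k) = rest (x ≫ q k ≫ s k) := by
          rw [(a.inv k).1, rest_comp_rest]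
        rw [e1, e2]
        exact (((a.le k).comp_right _).comp_left x).rest_comp_rest
      rw [Category.assoc, Category.assoc, b.sec, comp_rest, ← Category.assoc, e]
  exact PullbackCone.IsLimit.mk _ (fun c => (hex c.fst c.snd c.condition).choose)
    (fun c => (hex c.fst c.snd c.condition).choose_spec.1)
    (fun c => (hex c.fst c.snd c.condition).choose_spec.2)
    (fun c m h h' => huniq _ _ (h.trans (hex c.fst c.snd c.condition).choose_spec.1.symm)
      (h'.trans (hex c.fst c.snd c.condition).choose_spec.2.symm))

end

end EtaleCat

/-! ### Cofunctors described by their action on partial sections. -/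

namespace EtaleCat

open RestrictionCategory PartiteCat

section

variable {C : Type u} [Category.{v} C] [RestrictionCategory C]
variable {I : Type w₁} {J : Type w₂} {A : PartiteCat I C} {B : PartiteCat J C}

theorem CofunctorBase.isPullback (F : CofunctorBase A B) (i j : I) :
    IsPullback (F.fibFst i j) (F.fibSnd i j) (A.src i j) (F.onObj i) :=
  IsPullback.of_hasPullback _ _

theorem CofunctorBase.sec_aux (F : CofunctorBase A B) {i j : I} {s : A.obj i ⟶ A.arr i j}
    (hs : s ≫ A.src i j = rest s) :
    (F.onObj i ≫ s) ≫ A.src i j = rest (F.onObj i ≫ s) ≫ F.onObj i := by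
  rw [Category.assoc, hs, comp_rest]

/-- The partial section of `fib` induced by a partial section. -/
noncomputable def CofunctorBase.fibSec (F : CofunctorBase A B) {i j : I}
    (s : A.PartialSection i j) : B.obj (F.comp i) ⟶ F.fib i j :=
  F.fibLift (F.onObj i ≫ s.val) (rest (F.onObj i ≫ s.val)) (F.sec_aux s.comp_src)

section

variable (F : CofunctorBase A B) {i j : I} (s : A.PartialSection i j)

@[simp]
theorem CofunctorBase.fibSec_fst : F.fibSec s ≫ F.fibFst i j = F.onObj i ≫ s.val :=
  F.fibLift_fst _ _ _

@[simp]
theorem CofunctorBase.fibSec_snd : F.fibSec s ≫ F.fibSnd i j = rest (F.onObj i ≫ s.val) :=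
  F.fibLift_snd _ _ _

theorem CofunctorBase.fibSnd_total (i j : I) : Total (F.fibSnd i j) :=
  total_snd _ _ (A.src_total i j) (F.onObj_total i)

theorem CofunctorBase.rest_fibSec : rest (F.fibSec s) = rest (F.onObj i ≫ s.val) := by
  rw [← rest_comp_total _ (F.fibSnd_total i j), F.fibSec_snd, rest_rest]

theorem CofunctorBase.atlas [JoinRestriction C] {K : Type w}
    {q : K → (A.arr i j ⟶ A.obj i)} {s : K → A.PartialSection i j}
    (a : Atlas (A.src i j) q (fun k => (s k).val)) :
    Atlas (F.fibSnd i j) (fun k => rest (F.fibFst i j ≫ q k) ≫ F.fibSnd i j)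
      (fun k => F.fibSec (s k)) :=
  a.pullback (F.onObj_total i) (F.isPullback i j) _ (fun _ => F.fibSec_fst _)
    (fun _ => F.fibSec_snd _)

end

/-- Over the part where the arrow `a` comes from a section `s`, the action factors through the lift
of `s` to the fibre product. The condition on domains is needed because `s` is only partial. -/
theorem PreCofunctor.act_sec (F : PreCofunctor A B) {T : C} {i j : I} (s : A.PartialSection i j)
    (a : T ⟶ A.arr i j) (y : T ⟶ B.obj (F.comp i)) (h : a ≫ A.src i j = y ≫ F.onObj i)
    (ha : a = y ≫ F.onObj i ≫ s.val) (hr : rest a = rest y) :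
    F.act a y h = y ≫ F.fibSec s ≫ F.onArr i j := by
  refine Eq.trans ?_ (F.comp_act y _ _ (F.sec_aux s.comp_src)).symm
  refine F.act_congr _ ha ?_
  rw [comp_rest, ← ha, hr, rest_comp]

theorem PartiteCat.comp_star {T : C} {i j k : I} (t : A.PartialSection j k)
    (s : A.PartialSection i j) (x : T ⟶ A.obj i) (c : T ⟶ A.arr j k) (a : T ⟶ A.arr i j) (h)
    (hc : c = x ≫ s.val ≫ A.tgt i j ≫ t.val) (ha : a = x ≫ s.val) (hr : rest c = rest a) :
    x ≫ star t s = A.mu c a h := by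
  rw [star_eq, A.comp_mu]
  refine A.mu_congr _ hc.symm ?_
  rw [comp_rest_assoc', ← hc, hr, ← ha, rest_comp]

/-- A family of partial sections of `A` closed under the operations and covering the objects of
arrows, with a compatible family of partial sections of `B`. -/
structure SectionRep (F : CofunctorBase A B) where
  K : I → I → Type w
  sec : ∀ {i j : I}, K i j → A.PartialSection i j
  img : ∀ {i j : I}, K i j → B.PartialSection (F.comp i) (F.comp j)
  cover : ∀ i j, ∃ q, Atlas (A.src i j) q (fun k : K i j => (sec k).val)
  img_eq : ∀ {i j} (k l : K i j), sec k = sec l → img k = img l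
  img_tgt : ∀ {i j} (k : K i j), (img k).val ≫ B.tgt _ _ ≫ F.onObj j =
    F.onObj i ≫ (sec k).val ≫ A.tgt i j
  unit : ∀ i, ∃ k : K i i, (sec k).val = A.ident i ∧ (img k).val = B.ident (F.comp i)
  star : ∀ {i j l} (t : K j l) (s : K i j), ∃ r : K i l,
    (sec r).val = PartiteCat.star (sec t) (sec s) ∧ (img r).val = PartiteCat.star (img t) (img s)
  restr : ∀ {i j} (s : K i j) (e : A.obj i ⟶ A.obj i), rest e = e → ∃ r : K i j,
    (sec r).val = e ≫ (sec s).val ∧ (img r).val = rest (F.onObj i ≫ e) ≫ (img s).val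

namespace SectionRep

variable {F : CofunctorBase A B} (R : SectionRep.{w} F)

theorem rest_img {i j : I} (k : R.K i j) : rest (R.img k).val = rest (F.onObj i ≫ (R.sec k).val) := by
  rw [← rest_comp_total _ ((B.tgt_total _ _).comp (F.onObj_total j)), R.img_tgt, ← Category.assoc,
    rest_comp_total _ (A.tgt_total _ _)]

variable [JoinRestriction C]

/-- The lifts of the sections form an atlas of the fibre product. On an overlap the two sections
have equal restrictions, which belong to the family by `restr`; their images are then equal by
`img_eq`, so the images descend. -/
theorem exists_onArr (i j : I) : ∃ u : F.fib i j ⟶ B.arr (F.comp i) (F.comp j),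
    ∀ k : R.K i j, F.fibSec (R.sec k) ≫ u = (R.img k).val := by
  obtain ⟨q, a⟩ := R.cover i j
  obtain ⟨u, hu⟩ := (F.atlas a).exists_desc (fun k => (R.img k).val) (fun k l => by
    have e : F.fibSec (R.sec k) ≫ rest (F.fibFst i j ≫ q l) ≫ F.fibSnd i j =
        rest (F.onObj i ≫ (R.sec k).val ≫ q l) := by
      rw [comp_rest_assoc', ← Category.assoc (F.fibSec _), F.fibSec_fst, F.fibSec_snd,
        ← Category.assoc, rest_le]
    rw [e]
    obtain ⟨k', hk, hk'⟩ := R.restr k _ (a.rest_phi k l)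
    obtain ⟨l', hl, hl'⟩ := R.restr l _ (a.rest_phi k l)
    rw [← hk', ← hl', R.img_eq k' l']
    apply PartialSection.ext'
    rw [hk, hl]
    exact (a.phi_sec k l).symm)
  refine ⟨u, fun k => ?_⟩
  rw [hu, F.rest_fibSec, ← R.rest_img, rest_comp]

/-- The cofunctor, before checking the identity and composition axioms. -/
noncomputable def preCofunctor : PreCofunctor A B where
  toCofunctorBase := F
  onArr i j := (R.exists_onArr i j).choose
  onArr_src i j := by
    obtain ⟨q, a⟩ := R.cover i j
    refine (F.atlas a).hom_ext _ _ fun k => ?_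
    rw [← Category.assoc, (R.exists_onArr i j).choose_spec, (R.img k).comp_src, R.rest_img,
      F.fibSec_snd]
  onArr_tgt i j := by
    obtain ⟨q, a⟩ := R.cover i j
    refine (F.atlas a).hom_ext _ _ fun k => ?_
    rw [← Category.assoc, (R.exists_onArr i j).choose_spec, R.img_tgt,
      ← Category.assoc (F.fibSec _), F.fibSec_fst, Category.assoc]

theorem fibSec_onArr {i j : I} (k : R.K i j) :
    F.fibSec (R.sec k) ≫ R.preCofunctor.onArr i j = (R.img k).val :=
  (R.exists_onArr i j).choose_spec k

end SectionRep

section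

variable {G : PreCofunctor A B} (R : SectionRep.{w} G.toCofunctorBase)
  (hG : ∀ {i j} (k : R.K i j), G.fibSec (R.sec k) ≫ G.onArr i j = (R.img k).val)

include hG

theorem SectionRep.act_sec {T : C} {i j : I} (s : R.K i j)
    (a : T ⟶ A.arr i j) (y : T ⟶ B.obj (G.comp i)) (h : a ≫ A.src i j = y ≫ G.onObj i)
    (ha : a = y ≫ G.onObj i ≫ (R.sec s).val) (hr : rest a = rest y) :
    G.act a y h = y ≫ (R.img s).val :=
  (G.act_sec (R.sec s) a y h ha hr).trans (congrArg _ (hG s))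

theorem SectionRep.act_ident (i : I) (h) : G.act (G.onObj i ≫ A.ident i) (𝟙 _) h =
    B.ident (G.comp i) := by
  obtain ⟨k, hk, hk'⟩ := R.unit i
  refine (R.act_sec hG k _ _ _ (by rw [hk, Category.id_comp]) ?_).trans
    ((Category.id_comp _).trans hk')
  rw [rest_comp_ident, G.onObj_total, rest_id]

variable [JoinRestriction C]

/-- The domain is cut into pieces on which `a` comes from a section `s` and `c` from a section `t`.
On such a piece both sides are given by the image of the composite section, by the closure property
`star` of the family. -/
theorem SectionRep.act_mu {T : C} {i j k : I} (c : T ⟶ A.arr j k) (a : T ⟶ A.arr i j)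
    (b : T ⟶ B.obj (G.comp i)) (h : c ≫ A.src j k = a ≫ A.tgt i j)
    (h' : a ≫ A.src i j = b ≫ G.onObj i) (h₁ h₂ h₃) :
    G.act (A.mu c a h) b h₁ =
      B.mu (G.act c (G.act a b h' ≫ B.tgt _ _) h₂) (G.act a b h') h₃ := by
  obtain ⟨q, α⟩ := R.cover i j
  obtain ⟨q', β⟩ := R.cover j k
  have hab : rest a = rest b := by
    rw [← rest_comp_total _ (A.src_total i j), h']; exact rest_comp_total _ (G.onObj_total i)
  have hca : rest c = rest a := by
    rw [← rest_comp_total _ (A.src_total j k), h, rest_comp_total _ (A.tgt_total i j)]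
  have hu : rest (G.act (A.mu c a h) b h₁) = rest a := (G.rest_act _ _ _).trans hab.symm
  have hv : rest (B.mu (G.act c (G.act a b h' ≫ B.tgt _ _) h₂) (G.act a b h') h₃) = rest a :=
    (B.rest_mu _ _ _).trans ((G.rest_act _ _ _).trans hab.symm)
  rw [← rest_comp (G.act (A.mu c a h) b h₁), ← rest_comp (B.mu _ _ h₃), hu, hv]
  refine α.ext_gen a fun s => ?_
  -- `d` is the part where `a` lies in the chart of `s`; the idempotent `e` introduced below is the
  -- part of `d` where `c` lies in the chart of `t`.
  set d := rest (a ≫ q s) with hd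
  have hdc : rest (d ≫ c) = d := by
    rw [hd, rest_rest_comp, hca, rest_le]
  suffices H : rest (d ≫ c) ≫ G.act (A.mu c a h) b h₁ = rest (d ≫ c) ≫ B.mu _ _ h₃ by
    rwa [hdc] at H
  refine β.ext_gen (d ≫ c) fun t => ?_
  set e := rest ((d ≫ c) ≫ q' t) with he
  have hed : e ≫ d = e := by
    rw [he]; nth_rw 2 [← hdc]; rw [rest_le]
  have hee : rest e = e := rest_rest _
  have hea : e ≫ rest a = e := by
    have : d ≫ rest a = d := rest_le _ _
    rw [← hed, Category.assoc, this]
  have hra : rest (e ≫ a) = e := by rw [rest_eq_comp hee, hea]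
  have hrb : rest (e ≫ b) = e := by rw [rest_eq_comp hee, ← hab, hea]
  have hrc : rest (e ≫ c) = e := by rw [rest_eq_comp hee, hca, hea]
  have ha : e ≫ a = (e ≫ b) ≫ G.onObj i ≫ (R.sec s).val := by
    have h₄ : d ≫ a = (d ≫ a ≫ A.src i j) ≫ (R.sec s).val := by
      exact α.rest_comp_eq a s
    rw [← hed, Category.assoc, h₄, h']
    simp
  have hc : e ≫ c = (e ≫ b) ≫ G.onObj i ≫ (R.sec s).val ≫ A.tgt i j ≫ (R.sec t).val := by
    have h₄ : e ≫ c = (e ≫ c ≫ A.src j k) ≫ (R.sec t).val := by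
      have := β.rest_comp_eq (d ≫ c) t
      rw [← he, ← Category.assoc, hed, Category.assoc d, ← Category.assoc e d, hed] at this
      exact this
    rw [h₄, h, ← Category.assoc e, ha]
    simp
  obtain ⟨r, hr, hr'⟩ := R.star t s
  have hms : e ≫ G.act a b h' = (e ≫ b) ≫ (R.img s).val :=
    (G.comp_act _ _ _ _).trans (R.act_sec hG s _ _ _ ha (hra.trans hrb.symm))
  have hmt : e ≫ G.act c (G.act a b h' ≫ B.tgt _ _) h₂ =
      ((e ≫ b) ≫ (R.img s).val ≫ B.tgt _ _) ≫ (R.img t).val := by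
    refine (G.comp_act _ _ _ _).trans ((R.act_sec hG t _ _ _ ?_ ?_).trans ?_)
    · have := R.img_tgt s
      rw [← Category.assoc e, hms]
      simp only [Category.assoc]
      rw [reassoc_of% this, hc]
      simp
    · rw [hrc, ← Category.assoc, rest_comp_total _ (B.tgt_total _ _), rest_eq_comp hee,
        G.rest_act, ← hab, hea]
    · rw [← Category.assoc e, hms, Category.assoc (e ≫ b)]
  rw [B.comp_mu, G.comp_act]
  refine (R.act_sec hG r _ _ _ ?_ ?_).trans ?_
  · rw [hr, A.comp_mu, ← Category.assoc (e ≫ b)]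
    refine (PartiteCat.comp_star _ _ _ _ _ _ (by rw [hc]; simp) (by rw [ha]; simp) ?_).symm
    rw [hrc, hra]
  · rw [A.comp_mu, A.rest_mu, hra, hrb]
  · rw [hr']
    refine PartiteCat.comp_star _ _ _ _ _ _ (hmt.trans (by simp)) hms ?_
    rw [rest_eq_comp hee, rest_eq_comp hee, G.rest_act, rest_comp_total _ (B.tgt_total _ _)]

end

namespace SectionRep

variable [JoinRestriction C] {F : CofunctorBase A B} (R : SectionRep.{w} F)

/-- The cofunctor extending a family of partial sections. -/
noncomputable def cofunctor : Cofunctor A B where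
  toPreCofunctor := R.preCofunctor
  act_ident i := SectionRep.act_ident (G := R.preCofunctor) R R.fibSec_onArr i _
  act_mu c a b h h' := SectionRep.act_mu (G := R.preCofunctor) R R.fibSec_onArr c a b h h' _ _ _

theorem push_sec {i j : I} (k : R.K i j) : R.cofunctor.push (R.sec k) = (R.img k).val :=
  R.fibSec_onArr k

end SectionRep

/-- The lifts of a covering family of sections are jointly epic into the domain of `F_ij`.
Heterogeneous equality is used because the codomains depend on the action on components. -/
theorem Cofunctor.ext_push [JoinRestriction C] {F G : Cofunctor A B} {K : I → I → Type w}
    {sec : ∀ {i j : I}, K i j → A.PartialSection i j}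
    (cover : ∀ i j, ∃ q, Atlas (A.src i j) q (fun k : K i j => (sec k).val))
    (hc : F.comp = G.comp) (ho : HEq F.onObj G.onObj)
    (hp : ∀ {i j} (k : K i j), HEq (F.push (sec k)) (G.push (sec k))) : F = G := by
  obtain ⟨⟨⟨fc, fo, ft⟩, fa, fs, fg⟩, fi, fm⟩ := F
  obtain ⟨⟨⟨gc, go, gt⟩, ga, gs, gg⟩, gi, gm⟩ := G
  obtain rfl : fc = gc := hc
  obtain rfl : fo = go := eq_of_heq ho
  obtain rfl : fa = ga := by
    funext i j
    obtain ⟨q, a⟩ := cover i j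
    exact ((CofunctorBase.mk fc fo ft).atlas a).hom_ext _ _ fun k => eq_of_heq (hp k)
  rfl

section

variable (F : Cofunctor A B)

theorem Cofunctor.push_fibSec {i j : I} (s : A.PartialSection i j) :
    F.push s = F.fibSec s ≫ F.onArr i j := rfl

theorem Cofunctor.push_mono {i j : I} {s t : A.PartialSection i j} (h : RLe s.val t.val) :
    RLe (F.push s) (F.push t) := by
  have h₁ : rest (F.onObj i ≫ s.val) ≫ F.onObj i ≫ t.val = F.onObj i ≫ s.val := h.comp_left _
  rw [RLe, F.rest_push, F.push_eq, F.comp_act, F.push_eq]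
  exact F.act_congr _ h₁ (h.comp_left _).rest_comp_rest

variable [JoinRestriction C]

/-- If `k` lies below both images, then, `F_ij` being monic, the lifts of `s` and `t` already agree
on the domain of `k`. There `s` runs in the chart of `t`, that is, in the meet `m`. -/
theorem Cofunctor.isMeet_push {i j : I} (hA : LocalHomeo (A.src i j)) [IsIso (F.onArr i j)]
    {s t m : A.PartialSection i j}
    (h : IsMeet s.val t.val m.val) : IsMeet (F.push s) (F.push t) (F.push m) := by
  refine ⟨F.push_mono h.1, F.push_mono h.2.1, fun k hs ht => ?_⟩
  obtain ⟨q, a⟩ := hA.exists_atlas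
  have e : rest k ≫ F.fibSec s = rest k ≫ F.fibSec t := by
    rw [← cancel_mono (F.onArr i j), Category.assoc, Category.assoc]
    exact Eq.trans hs (Eq.symm ht)
  have e' : rest k ≫ F.onObj i ≫ s.val = rest k ≫ F.onObj i ≫ t.val := by
    rw [← F.fibSec_fst, ← F.fibSec_fst, ← Category.assoc, e, Category.assoc]
  let t' : {s : A.obj i ⟶ A.arr i j // s ≫ A.src i j = rest s} := ⟨t.val, t.comp_src⟩
  let s' : {s : A.obj i ⟶ A.arr i j // s ≫ A.src i j = rest s} := ⟨s.val, s.comp_src⟩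
  -- The part of `s` that lies in the chart of `t` is below both sections.
  have hn : RLe (s.val ≫ rest (q t')) m.val := by
    refine h.2.2 _ ?_ ?_
    · rw [comp_rest]; exact rle_rest_comp _ _
    · rw [← (a.inv t').1, ← Category.assoc]
      exact rle_idem_comp (a.rest_phi s' t') _
  have hw : RLe (rest k ≫ F.onObj i ≫ s.val) (F.onObj i ≫ m.val) := by
    have : rest k ≫ F.onObj i ≫ s.val = rest k ≫ F.onObj i ≫ s.val ≫ rest (q t') := by
      have h₁ : t.val ≫ rest (q t') = t.val := a.sec_q t'
      calc rest k ≫ F.onObj i ≫ s.val = rest k ≫ F.onObj i ≫ t.val ≫ rest (q t') := by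
            rw [h₁, e']
        _ = (rest k ≫ F.onObj i ≫ t.val) ≫ rest (q t') := by simp
        _ = _ := by rw [← e']; simp
    rw [this]
    exact (rle_rest_comp _ _).trans (hn.comp_left _)
  refine rle_of_rest hs (F.push_mono h.1) ?_
  have h₂ := hw.rest
  have h₃ := hs.rest_comp_rest
  rw [F.rest_push] at h₃
  rw [F.rest_push]
  rwa [rest_rest_comp, h₃] at h₂

/-- Pulling `g` back along the inverse of `F_ij` gives a generalised element `x` of `A_ij`. Where
`x` lies in the chart of `s k`, it is given by `s k`, so `g` agrees there with the image of `s k`.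
These pieces cover the domain of `g`. -/
theorem Cofunctor.isJoin_push {i j : I} [IsIso (F.onArr i j)] {K : Type w}
    {q : K → (A.arr i j ⟶ A.obj i)} {s : K → A.PartialSection i j}
    (a : Atlas (A.src i j) q (fun k => (s k).val))
    (g : B.PartialSection (F.comp i) (F.comp j)) :
    IsJoin {h | ∃ k, IsMeet g.val (F.push (s k)) h} g.val := by
  refine ⟨fun f ⟨_, hf⟩ => hf.1, fun u hu => ?_⟩
  set x := g.val ≫ inv (F.onArr i j) ≫ F.fibFst i j with hx
  have hsrc : inv (F.onArr i j) ≫ F.fibSnd i j = B.src _ _ := by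
    rw [← F.onArr_src, IsIso.inv_hom_id_assoc]
  have hxs : x ≫ A.src i j = rest g.val ≫ F.onObj i := by
    rw [hx, Category.assoc, Category.assoc, F.fib_condition, reassoc_of% hsrc,
      reassoc_of% g.comp_src]
  have hxr : rest x = rest g.val := by
    rw [← rest_comp_total _ (A.src_total i j), hxs, rest_comp_total _ (F.onObj_total i), rest_rest]
  have hj := (a.isJoin_rest x).comp_right g.val
  rw [← Set.range_comp, hxr, rest_comp] at hj
  refine hj.2 _ ?_
  rintro _ ⟨k, rfl⟩
  have hxg : rest (x ≫ q k) ≫ rest g.val = rest (x ≫ q k) := by rw [← hxr, rest_le]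
  have h₁ : rest (x ≫ q k) ≫ x = rest (x ≫ q k) ≫ F.onObj i ≫ (s k).val := by
    have h₀ : x ≫ q k = rest (x ≫ q k) ≫ F.onObj i := by
      conv_lhs => rw [← a.q_eq, comp_rest_assoc', hxs, ← Category.assoc, hxg]
    rw [← comp_rest, ← (a.inv k).1, ← Category.assoc, h₀, Category.assoc, ← h₀]
  have h₂ : rest (x ≫ q k) ≫ rest (F.onObj i ≫ (s k).val) = rest (x ≫ q k) := by
    rw [← rest_rest_comp, ← h₁, rest_rest_comp, rest_le]
  have h₃ : rest (x ≫ q k) ≫ g.val = rest (x ≫ q k) ≫ F.push (s k) := by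
    rw [F.push_fibSec, ← cancel_mono (inv (F.onArr i j))]
    simp only [Category.assoc, IsIso.hom_inv_id, Category.comp_id]
    apply F.fib_hom_ext
    · simp only [Category.assoc, CofunctorBase.fibSec_fst]; exact h₁
    · simp only [Category.assoc, CofunctorBase.fibSec_snd]
      rw [hsrc, g.comp_src, hxg, h₂]
  obtain ⟨m, hm⟩ := exists_isMeet g.val (F.push (s k))
  refine (hm.2.2 _ (rle_rest_comp _ _) ?_).trans (hu m ⟨k, hm⟩)
  rw [h₃]; exact rle_rest_comp _ _

/-- By `hj`, the images of the sections `s k` are jointly epic into `B_ij`, so they form an atlas.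
The inverse is glued from the lifts of the `s k` to the fibre product, and `hm` makes these agree on
overlaps. -/
theorem Cofunctor.isIso_onArr {i j : I} {K : Type w}
    {q : K → (A.arr i j ⟶ A.obj i)} {s : K → A.PartialSection i j}
    (a : Atlas (A.src i j) q (fun k => (s k).val)) {L : Type w'}
    {q' : L → (B.arr (F.comp i) (F.comp j) ⟶ B.obj (F.comp i))}
    {s' : L → B.PartialSection (F.comp i) (F.comp j)}
    (b : Atlas (B.src _ _) q' (fun k => (s' k).val))
    (hm : ∀ k l, ∃ m : A.PartialSection i j, IsMeet (s k).val (s l).val m.val ∧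
      IsMeet (F.push (s k)) (F.push (s l)) (F.push m))
    (hj : ∀ l, IsJoin {h | ∃ k, IsMeet (s' l).val (F.push (s k)) h} (s' l).val) :
    IsIso (F.onArr i j) := by
  choose r hr hr' using fun k => b.exists_inverse (F.push (s k)) (F.push_section (s k))
  have β : Atlas (B.src (F.comp i) (F.comp j)) r (fun k => F.push (s k)) := by
    refine ⟨b.total, hr', hr, fun u v h => b.hom_ext _ _ fun l => ?_⟩
    have h₁ := (hj l).comp_right u
    have h₂ := (hj l).comp_right v
    have : (fun f => f ≫ u) '' {h | ∃ k, IsMeet (s' l).val (F.push (s k)) h} =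
        (fun f => f ≫ v) '' {h | ∃ k, IsMeet (s' l).val (F.push (s k)) h} := by
      refine Set.image_congr ?_
      rintro x ⟨k, hk⟩
      rw [← hk.2.1, Category.assoc, Category.assoc, h]
    rw [this] at h₁
    exact h₁.unique h₂
  obtain ⟨G, hG⟩ := β.exists_desc (fun k => F.fibSec (s k)) (fun k l => by
    set e := F.push (s k) ≫ r l with he
    have hee : rest e = e := β.rest_phi k l
    obtain ⟨m, h₁, h₂⟩ := hm k l
    -- On the overlap `e` the two images coincide, so they lie below their meet, which is the image
    -- of the meet `m` of the sections. Hence `e` lies over the domain of `m`, where the two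
    -- sections are equal.
    have h₃ : RLe (e ≫ F.push (s k)) (F.push m) := h₂.2.2 _ (rle_idem_comp hee _) (by
      rw [he, ← β.phi_sec]; exact rle_idem_comp hee _)
    have h₄ : e ≫ rest (F.push (s k)) = e := by
      rw [← hee, he, rest_le]
    have h₅ : e ≫ rest (F.onObj i ≫ m.val) = e := by
      have := h₃.rest_comp_rest
      rwa [rest_eq_comp hee, h₄, F.rest_push] at this
    have h₆ : ∀ n : A.PartialSection i j, RLe m.val n.val → e ≫ F.fibSec n = e ≫ F.fibSec m := by
      intro n hn
      have h₇ : rest (F.onObj i ≫ m.val) ≫ F.onObj i ≫ n.val = F.onObj i ≫ m.val :=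
        hn.comp_left _
      apply F.fib_hom_ext
      · rw [Category.assoc e, Category.assoc e, F.fibSec_fst, F.fibSec_fst, ← h₇,
          ← Category.assoc e (rest _), h₅]
      · rw [Category.assoc e, Category.assoc e, F.fibSec_snd, F.fibSec_snd, h₅, ← h₅,
          Category.assoc e, (hn.comp_left _).rest_comp_rest]
    rw [h₆ _ h₁.1, h₆ _ h₁.2.1])
  have hG' : ∀ k, F.push (s k) ≫ G = F.fibSec (s k) := fun k => by
    rw [hG, F.rest_push, ← F.rest_fibSec, rest_comp]
  refine ⟨G, (F.atlas a).hom_ext _ _ fun k => ?_, β.hom_ext _ _ fun k => ?_⟩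
  · rw [← Category.assoc, ← F.push_fibSec, hG', Category.comp_id]
  · rw [← Category.assoc, hG', ← F.push_fibSec, Category.comp_id]

end

end

end EtaleCat

/-! ### Internal categories from the composition of sections. -/

namespace EtaleCat

open RestrictionCategory PartiteCat

section

variable {C : Type u} [Category.{v} C] [RestrictionCategory C]
variable {I : Type w₁}

/-- A family of partial sections covering the objects of arrows of a graph, with units and
composition. -/
structure GermSystem (A : PartiteGraph I C) where
  K : I → I → Type w
  sec : ∀ {i j : I}, K i j → (A.obj i ⟶ A.arr i j)
  q : ∀ {i j : I}, K i j → (A.arr i j ⟶ A.obj i)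
  atlas : ∀ i j, Atlas (A.src i j) (q (i := i) (j := j)) sec
  one : ∀ i, K i i
  one_src : ∀ i, sec (one i) ≫ A.src i i = 𝟙 _
  one_tgt : ∀ i, sec (one i) ≫ A.tgt i i = 𝟙 _
  cmp : ∀ {i j k : I}, K i j → K j k → K i k
  rest_cmp : ∀ {i j k} (f : K i j) (t : K j k),
    rest (sec (cmp f t)) = rest (sec f ≫ A.tgt i j ≫ sec t)
  cmp_tgt : ∀ {i j k} (f : K i j) (t : K j k),
    sec (cmp f t) ≫ A.tgt i k = sec f ≫ A.tgt i j ≫ sec t ≫ A.tgt j k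
  cmp_congr : ∀ {i j k} (f g : K i j) (t u : K j k),
    (rest (sec f ≫ A.tgt i j ≫ sec t ≫ q u) ≫ sec f ≫ q g) ≫ sec (cmp g u) =
      (rest (sec f ≫ A.tgt i j ≫ sec t ≫ q u) ≫ sec f ≫ q g) ≫ sec (cmp f t)
  cmp_one : ∀ {i j} (f : K i j), cmp f (one j) = f
  one_cmp : ∀ {i j} (f : K i j), cmp (one i) f = f
  cmp_assoc : ∀ {i j k l} (f : K i j) (t : K j k) (r : K k l), cmp (cmp f t) r = cmp f (cmp t r)

namespace GermSystem

section

variable {A : PartiteGraph I C} (D : GermSystem.{w} A) {i j k : I}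

theorem sec_src (f : D.K i j) : D.sec f ≫ A.src i j = rest (D.sec f) := (D.atlas i j).sec f

theorem fib_aux (i : I) (t : D.K j k) :
    (A.tgt i j ≫ D.sec t) ≫ A.src j k = rest (A.tgt i j ≫ D.sec t) ≫ A.tgt i j := by
  rw [Category.assoc, D.sec_src, comp_rest]

/-- The partial section of `fib` over `A_ij` induced by a partial section. -/
noncomputable def fibSec (i : I) (t : D.K j k) : A.arr i j ⟶ A.fib i j k :=
  A.fibLift (A.tgt i j ≫ D.sec t) (rest (A.tgt i j ≫ D.sec t)) (D.fib_aux i t)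

theorem fibSec_fst (t : D.K j k) : D.fibSec i t ≫ A.fibFst i j k = A.tgt i j ≫ D.sec t :=
  A.fibLift_fst _ _ _

theorem fibSec_snd (t : D.K j k) :
    D.fibSec i t ≫ A.fibSnd i j k = rest (A.tgt i j ≫ D.sec t) :=
  A.fibLift_snd _ _ _

variable [JoinRestriction C]

theorem fibAtlas (i j k : I) : Atlas (A.fibSnd i j k)
    (fun t : D.K j k => rest (A.fibFst i j k ≫ D.q t) ≫ A.fibSnd i j k) (D.fibSec i) :=
  (D.atlas j k).pullback (A.tgt_total i j) (IsPullback.of_hasPullback _ _) _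
    (fun _ => D.fibSec_fst _) (fun _ => D.fibSec_snd _)

theorem rest_fibSec (t : D.K j k) : rest (D.fibSec i t) = rest (A.tgt i j ≫ D.sec t) := by
  rw [← rest_comp_total _ (D.fibAtlas i j k).total, D.fibSec_snd, rest_rest]

theorem rest_sec_fibSec (f : D.K i j) (t : D.K j k) :
    rest (D.sec f ≫ D.fibSec i t) = rest (D.sec (D.cmp f t)) := by
  rw [← rest_comp_rest, D.rest_fibSec, rest_comp_rest, D.rest_cmp]

/-- Composable pairs of sections form an atlas of the fibre product, by composing the atlas of
`A_ij` with the pullback of the atlas of `A_jk`. On an overlap, the agreement of the composite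
sections is exactly `cmp_congr`. -/
theorem exists_mul (i j k : I) : ∃ u : A.fib i j k ⟶ A.arr i k,
    ∀ (f : D.K i j) (t : D.K j k), D.sec f ≫ D.fibSec i t ≫ u = D.sec (D.cmp f t) := by
  obtain ⟨u, hu⟩ := ((D.atlas i j).comp (D.fibAtlas i j k)).exists_desc
    (fun x => D.sec (D.cmp x.1 x.2)) (fun x y => by
      obtain ⟨f, t⟩ := x
      obtain ⟨g, u⟩ := y
      have e : (D.sec f ≫ D.fibSec i t) ≫ (rest (A.fibFst i j k ≫ D.q u) ≫ A.fibSnd i j k) ≫ D.q g =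
          rest (D.sec f ≫ A.tgt i j ≫ D.sec t ≫ D.q u) ≫ D.sec f ≫ D.q g := by
        have e₁ : D.fibSec i t ≫ rest (A.fibFst i j k ≫ D.q u) ≫ A.fibSnd i j k =
            rest (A.tgt i j ≫ D.sec t ≫ D.q u) := by
          rw [comp_rest_assoc', ← Category.assoc (D.fibSec i t), D.fibSec_fst, D.fibSec_snd,
            ← Category.assoc (A.tgt i j), rest_le]
        rw [Category.assoc, ← Category.assoc (D.fibSec i t), e₁, comp_rest_assoc']
      change (_ ≫ _) ≫ _ = (_ ≫ _) ≫ _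
      rw [e]
      exact D.cmp_congr f g t u)
  refine ⟨u, fun f t => ?_⟩
  have := hu (f, t)
  rw [← Category.assoc, this, D.rest_sec_fibSec, rest_comp]

/-- The composition map determined by the composition of sections. -/
noncomputable def mul (i j k : I) : A.fib i j k ⟶ A.arr i k := (D.exists_mul i j k).choose

theorem sec_mul (f : D.K i j) (t : D.K j k) :
    D.sec f ≫ D.fibSec i t ≫ D.mul i j k = D.sec (D.cmp f t) :=
  (D.exists_mul i j k).choose_spec f t

theorem fib_ext {Z : C} {x y : A.fib i j k ⟶ Z} (h : ∀ (f : D.K i j) (t : D.K j k),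
    D.sec f ≫ D.fibSec i t ≫ x = D.sec f ≫ D.fibSec i t ≫ y) : x = y :=
  ((D.atlas i j).comp (D.fibAtlas i j k)).hom_ext _ _ fun z => by
    simpa using h z.1 z.2

/-- The identities and composition determined by a system of germs. -/
noncomputable def pre : PrePartiteCat I C where
  toPartiteGraph := A
  ident i := D.sec (D.one i)
  ident_src := D.one_src
  ident_tgt := D.one_tgt
  mul := D.mul
  mul_src i j k := D.fib_ext fun f t => by
    have := D.sec_mul f t
    rw [reassoc_of% this, ← Category.assoc (D.fibSec i t), D.fibSec_snd, comp_rest_assoc',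
      D.sec_src, D.sec_src, D.rest_cmp, rest_le]
  mul_tgt i j k := D.fib_ext fun f t => by
    have := D.sec_mul f t
    rw [reassoc_of% this, D.cmp_tgt, ← Category.assoc (D.fibSec i t), D.fibSec_fst]
    simp

end

section

variable {A : PrePartiteCat I C} (D : GermSystem.{w} A.toPartiteGraph) {i j k l : I}
variable (hone : ∀ i, A.ident i = D.sec (D.one i))

/-- A form of `Atlas.rest_comp_eq` for any `e` inside the chart of `f`, so that several arrows can
be put in local form on one common piece. -/
theorem piece {T : C} (a : T ⟶ A.arr i j) (f : D.K i j) {e : T ⟶ T}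
    (he : e ≫ rest (a ≫ D.q f) = e) : e ≫ a = (e ≫ a ≫ A.src i j) ≫ D.sec f := by
  have := congrArg (e ≫ ·) ((D.atlas i j).rest_comp_eq a f)
  simp only [← Category.assoc, he] at this ⊢
  exact this

variable (hmul : ∀ {i j k} (f : D.K i j) (t : D.K j k),
  D.sec f ≫ D.fibSec i t ≫ A.mul i j k = D.sec (D.cmp f t))

include hmul

/-- Composing arrows in local form amounts to composing the sections. The laws of an internal
category are thereby reduced to those of `cmp`. -/
theorem mu_sec {T : C} (f : D.K i j) (t : D.K j k) (x : T ⟶ A.obj i) (c : T ⟶ A.arr j k)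
    (a : T ⟶ A.arr i j) (h) (hc : c = x ≫ D.sec f ≫ A.tgt i j ≫ D.sec t) (ha : a = x ≫ D.sec f)
    (hr : rest c = rest a) : A.mu c a h = x ≫ D.sec (D.cmp f t) := by
  rw [PrePartiteCat.mu, ← hmul]
  have : A.fibLift c a h = x ≫ D.sec f ≫ D.fibSec i t := by
    apply A.fib_hom_ext
    · rw [A.fibLift_fst, hc, Category.assoc, Category.assoc, D.fibSec_fst]
    · rw [A.fibLift_snd, Category.assoc, Category.assoc, D.fibSec_snd, ← Category.assoc,
        comp_rest, Category.assoc x, ← hc, ← ha, hr, rest_comp]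
  rw [this]
  simp

include hone

variable [JoinRestriction C]

omit [JoinRestriction C] in
theorem unit_left (i j : I) (h) :
    A.mu (A.tgt i j ≫ A.ident j) (𝟙 (A.arr i j)) h = 𝟙 (A.arr i j) :=
  (D.atlas i j).hom_ext _ _ fun f => by
    rw [A.comp_mu]
    refine (D.mu_sec hmul f (D.one j) (𝟙 _) _ _ _ (by simp [hone]) (by simp) ?_).trans ?_
    · rw [← rest_comp_total _ (A.src_total j j)]
      simp only [Category.assoc]
      rw [A.ident_src, Category.comp_id, Category.comp_id, rest_comp_total _ (A.tgt_total i j)]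
    · rw [D.cmp_one]; simp

omit [JoinRestriction C] in
theorem unit_right (i j : I) (h) :
    A.mu (𝟙 (A.arr i j)) (A.src i j ≫ A.ident i) h = 𝟙 (A.arr i j) :=
  (D.atlas i j).hom_ext _ _ fun f => by
    rw [A.comp_mu]
    have e : D.sec f ≫ A.src i j ≫ A.ident i = rest (D.sec f) ≫ D.sec (D.one i) := by
      rw [hone, ← Category.assoc, D.sec_src]
    refine (D.mu_sec hmul (D.one i) f (rest (D.sec f)) _ _ _ ?_ e ?_).trans ?_
    · rw [← Category.assoc (D.sec (D.one i)), D.one_tgt, Category.id_comp, rest_comp,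
        Category.comp_id]
    · have h1 := A.ident_src i
      rw [← rest_comp_total (D.sec f ≫ A.src i j ≫ A.ident i) (A.src_total i i)]
      simp only [Category.assoc]
      rw [h1, Category.comp_id, Category.comp_id, rest_comp_total _ (A.src_total i j)]
    · rw [D.one_cmp]; simp [rest_comp]

omit hone

/-- The common domain is cut three times, until `a`, `b` and `c` come from sections `f`, `t` and
`r`. On such a piece both sides are given by the triple composite, and `cmp` is associative. -/
theorem mu_assoc {T : C} (c : T ⟶ A.arr k l) (b : T ⟶ A.arr j k) (a : T ⟶ A.arr i j)
    (h : c ≫ A.src k l = b ≫ A.tgt j k) (h' : b ≫ A.src j k = a ≫ A.tgt i j) (h₁ h₂) :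
    A.mu c (A.mu b a h') h₁ = A.mu (A.mu c b h) a h₂ := by
  have hba : rest b = rest a := by
    rw [← rest_comp_total _ (A.src_total j k), h', rest_comp_total _ (A.tgt_total i j)]
  have hcb : rest c = rest b := by
    rw [← rest_comp_total _ (A.src_total k l), h, rest_comp_total _ (A.tgt_total j k)]
  rw [← rest_comp (A.mu c (A.mu b a h') h₁), ← rest_comp (A.mu (A.mu c b h) a h₂), A.rest_mu,
    A.rest_mu, A.rest_mu]
  refine (D.atlas i j).ext_gen a fun f => ?_
  set d := rest (a ≫ D.q f) with hd
  have hdr : rest d = d := rest_rest _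
  have hda : d ≫ rest a = d := rest_le _ _
  have hdb : rest (d ≫ b) = d := by rw [rest_eq_comp hdr, hba, hda]
  rw [← hdb]
  refine (D.atlas j k).ext_gen (d ≫ b) fun t => ?_
  set d' := rest ((d ≫ b) ≫ D.q t) with hd'
  have hdr' : rest d' = d' := rest_rest _
  have hdd : d' ≫ d = d' := by rw [hd', ← hdb, hdb]; nth_rw 2 [← hdb]; rw [rest_le]
  have hdc : rest (d' ≫ c) = d' := by
    rw [rest_eq_comp hdr', hcb, hba, ← hdd, Category.assoc, hda]
  rw [← hdc]
  refine (D.atlas k l).ext_gen (d' ≫ c) fun r => ?_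
  -- A piece on which all three arrows have local form; `x` below is the source of `a` there, and
  -- `b` and `c` are expressed through it.
  set e := rest ((d' ≫ c) ≫ D.q r) with he
  have her : rest e = e := rest_rest _
  have hed' : e ≫ d' = e := by rw [he]; nth_rw 2 [← hdc]; rw [rest_le]
  have hed : e ≫ d = e := by rw [← hed', Category.assoc, hdd]
  have hea : rest (e ≫ a) = e := by rw [rest_eq_comp her, ← hed, Category.assoc, hda]
  have heb : rest (e ≫ b) = e := by rw [rest_eq_comp her, hba, ← hed, Category.assoc, hda]
  have hec : rest (e ≫ c) = e := by rw [rest_eq_comp her, hcb, hba, ← hed, Category.assoc, hda]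
  have hdb' : e ≫ d ≫ b = e ≫ b := by rw [← Category.assoc, hed]
  have hdc' : e ≫ d' ≫ c = e ≫ c := by rw [← Category.assoc, hed']
  have ha := D.piece a f (e := e) hed
  have hb := D.piece (d ≫ b) t (e := e) hed'
  have hc := D.piece (d' ≫ c) r (e := e) (by rw [← he]; exact idem_idem her)
  simp only [Category.assoc, h, h'] at hb hc
  rw [hdb'] at hb
  rw [hdc'] at hc
  have h1 : e ≫ a ≫ A.tgt i j = (e ≫ a ≫ A.src i j) ≫ D.sec f ≫ A.tgt i j := by
    rw [← Category.assoc (e ≫ a ≫ A.src i j), ← ha, Category.assoc]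
  set x := e ≫ a ≫ A.src i j with hx
  have hxr : rest x = e := by
    rw [hx, ← Category.assoc, rest_comp_total _ (A.src_total i j), hea]
  have hb' : e ≫ b = x ≫ D.sec f ≫ A.tgt i j ≫ D.sec t := by
    rw [hb, reassoc_of% hed, reassoc_of% h1]
  have hc' : e ≫ c = x ≫ D.sec f ≫ A.tgt i j ≫ D.sec t ≫ A.tgt j k ≫ D.sec r := by
    rw [hc, reassoc_of% hed', reassoc_of% hb']
  have h2 : A.mu (e ≫ b) (e ≫ a) (by simp [h']) = x ≫ D.sec (D.cmp f t) :=
    D.mu_sec hmul f t x _ _ _ hb' ha (by rw [heb, hea])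
  have h3 : A.mu (e ≫ c) (e ≫ b) (by simp [h]) = x ≫ D.sec f ≫ A.tgt i j ≫ D.sec (D.cmp t r) :=
    (D.mu_sec hmul t r (x ≫ D.sec f ≫ A.tgt i j) _ _ _ (by rw [hc']; simp) (by rw [hb']; simp)
      (by rw [hec, heb])).trans (by simp)
  rw [A.comp_mu e c (A.mu b a h') h₁, A.comp_mu e (A.mu c b h) a h₂]
  refine (D.mu_sec hmul (D.cmp f t) r x _ _ _ ?_ ((A.comp_mu e b a h').trans h2) ?_).trans
    (Eq.trans ?_ (D.mu_sec hmul f (D.cmp t r) x _ _ _ ((A.comp_mu e c b h).trans h3) ha ?_).symm)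
  · have := D.cmp_tgt f t
    rw [reassoc_of% this, hc']
  · rw [hec, A.comp_mu, A.rest_mu, hea]
  · rw [D.cmp_assoc]
  · rw [A.comp_mu, A.rest_mu, heb, hea]

end

variable [JoinRestriction C] {A : PartiteGraph I C} (D : GermSystem.{w} A)

/-- The partite internal category determined by a system of germs. -/
noncomputable def cat : PartiteCat I C where
  toPrePartiteCat := D.pre
  unit_left i j := unit_left (A := D.pre) D (fun _ => rfl) D.sec_mul i j _
  unit_right i j := unit_right (A := D.pre) D (fun _ => rfl) D.sec_mul i j _
  assoc c b a h h' := mu_assoc (A := D.pre) D D.sec_mul c b a h h' _ _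

theorem cat_sourceEtale : D.cat.SourceEtale := fun i j => (D.atlas i j).localHomeo

/-- The members of the system, as partial sections. -/
def partialSection {i j : I} (f : D.K i j) : D.cat.PartialSection i j := ⟨D.sec f, D.sec_src f⟩

theorem star_partialSection {i j k : I} (t : D.K j k) (f : D.K i j) :
    star (D.partialSection t) (D.partialSection f) = D.sec (D.cmp f t) := by
  have e : rest (D.sec f ≫ D.cat.tgt i j ≫ D.sec t) = rest (D.sec (D.cmp f t)) :=
    (D.rest_cmp f t).symm
  refine (star_eq _ _).trans ((mu_sec (A := D.pre) D D.sec_mul f t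
    (rest (D.sec f ≫ D.cat.tgt i j ≫ D.sec t)) _ _ _ (rest_comp _).symm rfl ?_).trans ?_)
  · exact (rest_rest_comp _ _).trans (rest_le _ _) |>.symm
  · exact (congrArg (· ≫ D.sec (D.cmp f t)) e).trans (rest_comp _)

end GermSystem

end

end EtaleCat

/-! ### The internal category of a restriction category over `C`. -/

namespace EtaleCat

open RestrictionCategory PartiteCat

section

variable {D : Type u} [Category.{v} D] [RestrictionCategory D] [BoundedJoins D] {A B E : D}

/-- The meet of two parallel maps. -/
noncomputable def meet (f g : A ⟶ B) : A ⟶ B := (exists_isMeet f g).choose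

theorem meet_isMeet (f g : A ⟶ B) : IsMeet f g (meet f g) := (exists_isMeet f g).choose_spec

theorem meet_self (f : A ⟶ B) : meet f f = f :=
  (meet_isMeet f f).unique ⟨RLe.refl f, RLe.refl f, fun _ h _ => h⟩

theorem meet_comm (f g : A ⟶ B) : meet f g = meet g f :=
  (meet_isMeet f g).unique (meet_isMeet g f).symm

theorem rest_meet_comp_left (f g : A ⟶ B) : rest (meet f g) ≫ f = meet f g := (meet_isMeet f g).1

theorem rest_meet_comp_right (f g : A ⟶ B) : rest (meet f g) ≫ g = meet f g :=
  (meet_isMeet f g).2.1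

/-- Where `f` agrees with `g` and `g` with `h`, `f` agrees with `h`. This is the transitivity of the
local atlas on `P x`. -/
theorem rest_meet_trans (f g h : A ⟶ B) :
    RLe (rest (meet f g) ≫ rest (meet g h)) (rest (meet f h)) := by
  have e : rest (meet f g) ≫ meet g h = rest (meet g h) ≫ meet f g := by
    conv_lhs => rw [← rest_meet_comp_left g h, ← Category.assoc, rest_comm, Category.assoc]
    rw [rest_meet_comp_right f g]
  rw [← rest_rest_comp]
  refine ((meet_isMeet f h).2.2 _ ?_ ?_).rest
  · rw [e]; exact (rle_rest_comp _ _).trans (meet_isMeet f g).1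
  · exact (rle_rest_comp _ _).trans (meet_isMeet g h).2.1

end

section

variable {C : Type u} [Category.{v} C] [RestrictionCategory C]
variable {𝒜 : Type w} [Category.{v} 𝒜] [RestrictionCategory 𝒜] {P : 𝒜 ⥤ C}

theorem PreservesRest.rle (hP : PreservesRest P) {x y : 𝒜} {f g : x ⟶ y} (h : RLe f g) :
    RLe (P.map f) (P.map g) := by
  rw [RLe, ← hP, ← P.map_comp, h]

theorem PreservesRest.partialInverse (hP : PreservesRest P) {x y : 𝒜} {f : x ⟶ y} {g : y ⟶ x}
    (h : PartialInverse f g) : PartialInverse (P.map f) (P.map g) :=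
  ⟨by rw [← P.map_comp, h.1, hP], by rw [← P.map_comp, h.2, hP]⟩

/-- For idempotents the order is the equation `d ≫ e = d` between idempotents, and `P` is injective
on these. -/
theorem Hyperconnected.reflects_rle (hP : PreservesRest P) (hc : Hyperconnected P) {x : 𝒜}
    {d e : x ⟶ x} (hd : rest d = d) (he : rest e = e) (h : RLe (P.map d) (P.map e)) : RLe d e := by
  rw [idem_rle_iff hd]
  refine (hc x).injOn (rest_idem_comp hd he) hd ?_
  rw [P.map_comp]
  refine (idem_rle_iff ?_).1 h
  rw [← hP, hd]

/-- The objects of arrows of the internal category of `P`: glueings of the objects `P x` along the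
equalizers of the maps out of `x`. -/
structure Glueing [BoundedJoins 𝒜] (P : 𝒜 ⥤ C) where
  arr : 𝒜 → 𝒜 → C
  src : ∀ x y, arr x y ⟶ P.obj x
  q : ∀ {x y : 𝒜}, (x ⟶ y) → (arr x y ⟶ P.obj x)
  sec : ∀ {x y : 𝒜}, (x ⟶ y) → (P.obj x ⟶ arr x y)
  atlas : ∀ x y, Atlas (src x y) (q (x := x) (y := y)) sec
  phi : ∀ {x y : 𝒜} (f g : x ⟶ y), sec f ≫ q g = P.map (rest (meet f g))

variable [BoundedJoins 𝒜]

theorem exists_glueing [HasLocalGlueings C] [JoinRestriction C] (hP : PreservesRest P) :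
    Nonempty (Glueing P) := by
  have h : ∀ x y : 𝒜, ∃ (A : C) (p : A ⟶ P.obj x) (q : (x ⟶ y) → (A ⟶ P.obj x))
      (s : (x ⟶ y) → (P.obj x ⟶ A)), Atlas p q s ∧
        ∀ f g, s f ≫ q g = P.map (rest (meet f g)) := fun x y => by
    refine exists_atlas_of_localAtlas (fun f g => P.map (rest (meet f g))) ⟨fun f g => ?_,
      fun f g => ?_, fun f g h => ?_⟩
    · change rest (P.map _) = P.map _
      rw [← hP, rest_rest]
    · exact congrArg (fun m => P.map (rest m)) (meet_comm f g)
    · rw [← P.map_comp]; exact hP.rle (rest_meet_trans f g h)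
  choose A p q s a φ using h
  exact ⟨⟨A, p, fun f => q _ _ f, fun f => s _ _ f, a, φ _ _⟩⟩

namespace Glueing

variable (D : Glueing P)

theorem rest_sec {x y : 𝒜} (f : x ⟶ y) : rest (D.sec f) = P.map (rest f) := by
  rw [← (D.atlas x y).phi_self, D.phi, meet_self]

/-- The map `e ≫ f` agrees with `f` on its whole domain, so its chart is glued into that of `f`.
Hence restricting a section amounts to restricting the map it comes from. -/
theorem map_sec {x y : 𝒜} {e : x ⟶ x} (he : rest e = e) (f : x ⟶ y) :
    P.map e ≫ D.sec f = D.sec (e ≫ f) := by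
  have h₁ := (D.atlas x y).phi_sec f (e ≫ f)
  have h₂ : meet f (e ≫ f) = e ≫ f := (meet_isMeet _ _).unique
    ⟨rle_idem_comp he f, RLe.refl _, fun _ _ h => h⟩
  have h₃ : D.sec f = P.map (rest f) ≫ D.sec f := by rw [← D.rest_sec, rest_comp]
  rw [D.phi, h₂, ← D.rest_sec, rest_comp] at h₁
  rw [h₁, D.rest_sec, rest_eq_comp he, P.map_comp, Category.assoc, ← h₃]

theorem rle_sec {x y : 𝒜} {f g : x ⟶ y} (h : RLe f g) : RLe (D.sec f) (D.sec g) := by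
  rw [RLe, D.rest_sec, D.map_sec (rest_rest f), h]

/-- Equal sections overlap on their whole domain, so `P` identifies `rest f` with `rest (meet f g)`.
Injectivity on idempotents gives that `f` agrees with `g` on all of its domain. -/
theorem sec_injective (hc : Hyperconnected P) {x y : 𝒜} {f g : x ⟶ y} (h : D.sec f = D.sec g) :
    f = g := by
  have key : ∀ {f g : x ⟶ y}, D.sec f = D.sec g → RLe f g := by
    intro f g h
    have h₁ := D.phi f g
    rw [h, (D.atlas x y).phi_self, ← h, D.rest_sec] at h₁
    have h₂ := (hc x).injOn (rest_rest _) (rest_rest _) h₁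
    rw [RLe, h₂, rest_meet_comp_right, ← rest_meet_comp_left, ← h₂, rest_comp]
  exact (key h).antisymm (key h.symm)

variable (hP : PreservesRest P)

include hP

variable [JoinRestriction C]

theorem exists_tgt (x y : 𝒜) : ∃ u : D.arr x y ⟶ P.obj y, ∀ f : x ⟶ y, D.sec f ≫ u = P.map f := by
  obtain ⟨u, hu⟩ := (D.atlas x y).exists_desc (fun f : x ⟶ y => P.map f) (fun f g => by
    rw [D.phi, ← P.map_comp, ← P.map_comp, rest_meet_comp_left, rest_meet_comp_right])
  refine ⟨u, fun f => ?_⟩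
  rw [hu, D.rest_sec, hP, rest_comp]

variable [HasLocalGlueings C]

/-- The underlying graph of the internal category of `P`. -/
noncomputable def graph : PartiteGraph 𝒜 C where
  obj := P.obj
  arr := D.arr
  src := D.src
  tgt x y := (D.exists_tgt hP x y).choose
  src_total x y := (D.atlas x y).total
  tgt_total x y := (D.atlas x y).hom_ext _ _ fun f => by
    have h := (D.exists_tgt hP x y).choose_spec f
    rw [comp_rest, h, ← hP, ← D.rest_sec, rest_comp, Category.comp_id]
  hasPullback x y _ f hf := (D.atlas x y).localHomeo.hasPullback f hf

theorem sec_tgt {x y : 𝒜} (f : x ⟶ y) : D.sec f ≫ (D.graph hP).tgt x y = P.map f :=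
  (D.exists_tgt hP x y).choose_spec f

omit [JoinRestriction C] [HasLocalGlueings C] in
theorem rest_aux {x y z : 𝒜} (f : x ⟶ y) (t : y ⟶ z) :
    rest (P.map f ≫ D.sec t) = P.map (rest (f ≫ t)) := by
  rw [← rest_comp_rest, D.rest_sec, ← P.map_comp, ← hP, rest_comp_rest]

omit [JoinRestriction C] [HasLocalGlueings C] in
-- Composition is independent of representatives: the overlap is the image under `P` of the
-- idempotent on which `f` agrees with `g` and `t` agrees with `u` after `f`, and on it `f ≫ t` and
-- `g ≫ u` coincide.
theorem congr_aux {x y z : 𝒜} (f g : x ⟶ y) (t u : y ⟶ z) :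
    (rest (P.map f ≫ D.sec t ≫ D.q u) ≫ D.sec f ≫ D.q g) ≫ D.sec (g ≫ u) =
      (rest (P.map f ≫ D.sec t ≫ D.q u) ≫ D.sec f ≫ D.q g) ≫ D.sec (f ≫ t) := by
  have hd : rest (rest (f ≫ meet t u) ≫ rest (meet f g)) =
      rest (f ≫ meet t u) ≫ rest (meet f g) := rest_idem_comp (rest_rest _) (rest_rest _)
  have e : rest (P.map f ≫ D.sec t ≫ D.q u) ≫ D.sec f ≫ D.q g =
      P.map (rest (f ≫ meet t u) ≫ rest (meet f g)) := by
    rw [D.phi, D.phi, ← P.map_comp, ← hP, ← P.map_comp, rest_comp_rest]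
  rw [e, D.map_sec hd, D.map_sec hd]
  congr 1
  have h₁ : rest (meet f g) ≫ g ≫ u = rest (meet f g) ≫ f ≫ u := by
    simpa using congrArg (· ≫ u) ((rest_meet_comp_right f g).trans (rest_meet_comp_left f g).symm)
  have h₂ : ∀ v, v = t ∨ v = u → rest (f ≫ meet t u) ≫ f ≫ v = f ≫ meet t u := by
    intro v hv
    rw [← comp_rest_assoc']
    rcases hv with rfl | rfl
    · rw [rest_meet_comp_left]
    · rw [rest_meet_comp_right]
  refine Eq.trans (b := rest (meet f g) ≫ f ≫ meet t u) ?_ ?_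
  · rw [Category.assoc, h₁, ← Category.assoc, rest_comm, Category.assoc, h₂ u (Or.inr rfl)]
  · rw [rest_comm, Category.assoc, h₂ t (Or.inl rfl)]

/-- The system of germs of the internal category of `P`. -/
noncomputable def germs : GermSystem.{v} (D.graph hP) where
  K x y := x ⟶ y
  sec := D.sec
  q := D.q
  atlas := D.atlas
  one x := 𝟙 x
  one_src x := by
    refine ((D.atlas x x).sec (𝟙 x)).trans ?_
    rw [D.rest_sec, rest_id, P.map_id]; rfl
  one_tgt x := (D.sec_tgt hP (𝟙 x)).trans (P.map_id x)
  cmp f t := f ≫ t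
  rest_cmp {x y z} f t := by
    refine (D.rest_sec _).trans ((D.rest_aux hP f t).symm.trans ?_)
    exact congrArg rest ((congrArg (· ≫ D.sec t) (D.sec_tgt hP f)).symm.trans (Category.assoc _ _ _))
  cmp_tgt {x y z} f t := by
    refine (D.sec_tgt hP _).trans ((P.map_comp f t).trans ?_)
    exact (congrArg₂ (· ≫ ·) (D.sec_tgt hP f).symm (D.sec_tgt hP t).symm).trans
      (Category.assoc _ _ _)
  cmp_congr {x y z} f g t u := by
    have e : D.sec f ≫ (D.graph hP).tgt x y ≫ D.sec t ≫ D.q u = P.map f ≫ D.sec t ≫ D.q u :=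
      (Category.assoc _ _ _).symm.trans (congrArg (· ≫ D.sec t ≫ D.q u) (D.sec_tgt hP f))
    have := D.congr_aux hP f g t u
    rw [← e] at this
    exact this
  cmp_one f := Category.comp_id f
  one_cmp f := Category.id_comp f
  cmp_assoc f t r := Category.assoc f t r

/-- The internal category of `P`. -/
noncomputable def cat : PartiteCat 𝒜 C := (D.germs hP).cat

/-- The partial section of the source map induced by a map. -/
noncomputable def partialSection {x y : 𝒜} (f : x ⟶ y) : (D.cat hP).PartialSection x y :=
  (D.germs hP).partialSection f

theorem cat_sourceEtale : (D.cat hP).SourceEtale := (D.germs hP).cat_sourceEtale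

theorem star_partialSection {x y z : 𝒜} (t : y ⟶ z) (f : x ⟶ y) :
    star (D.partialSection hP t) (D.partialSection hP f) = (D.partialSection hP (f ≫ t)).val :=
  (D.germs hP).star_partialSection t f

theorem partialSection_id (x : 𝒜) : (D.partialSection hP (𝟙 x)).val = (D.cat hP).ident x := rfl

theorem partialSection_tgt {x y : 𝒜} (f : x ⟶ y) :
    (D.partialSection hP f).val ≫ (D.cat hP).tgt x y = P.map f := D.sec_tgt hP f

theorem rest_partialSection {x y : 𝒜} (f : x ⟶ y) :
    rest (D.partialSection hP f).val ≫ (D.cat hP).ident x =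
      (D.partialSection hP (rest f)).val := by
  have h₁ : rest (D.partialSection hP f).val = P.map (rest f) := D.rest_sec f
  refine (congrArg (· ≫ D.sec (𝟙 x)) h₁).trans ((D.map_sec (rest_rest f) (𝟙 x)).trans ?_)
  rw [Category.comp_id]; rfl

omit [HasLocalGlueings C] in
/-- A partial section for which the maps below it have a join comes from that join. -/
theorem exists_sec_eq (hc : Hyperconnected P) {x y : 𝒜} (t : P.obj x ⟶ D.arr x y)
    (ht : t ≫ D.src x y = rest t) (hj : ∃ j, IsJoin {g : x ⟶ y | RLe (D.sec g) t} j) :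
    ∃ f : x ⟶ y, D.sec f = t := by
  obtain ⟨j, hj⟩ := hj
  refine ⟨j, ?_⟩
  -- `t` is the join of its parts in the charts. The part in the chart of `f` is `sec (e ≫ f)`,
  -- where `e` is the idempotent of `x` over `t ≫ q f`; it lies below `t`, so `e ≫ f` is in the
  -- family.
  have h₁ : RLe t (D.sec j) := by
    refine ((D.atlas x y).isJoin_comp t).2 _ ?_
    rintro _ ⟨f, rfl⟩
    have h₂ : rest (t ≫ D.q f) = t ≫ D.q f := by
      refine rest_of_rle_rest (f := t) ?_
      rw [← ht]
      exact ((D.atlas x y).le f).comp_left _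
    obtain ⟨e, he, he'⟩ := (hc x).surjOn h₂
    have h₃ : t ≫ rest (D.q f) = D.sec (e ≫ f) := by
      rw [← D.map_sec he, he', Category.assoc, ((D.atlas x y).inv f).1]
    have h₄ : RLe (D.sec (e ≫ f)) t := by
      rw [← h₃, comp_rest]; exact rle_rest_comp _ _
    change RLe (t ≫ rest (D.q f)) _
    rw [h₃]
    exact D.rle_sec (hj.1 (e ≫ f) h₄)
  refine (h₁.eq_of_rest ?_).symm
  -- It remains to see that the domain of `sec j` is not too large. The domain of `t` lifts to an
  -- idempotent `e` of `x`, every member of the family is defined inside `e`, and hence so is the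
  -- join.
  obtain ⟨e, he, he'⟩ := (hc x).surjOn (show rest (rest t) = rest t from rest_rest _)
  have h₂ : RLe j (e ≫ j) := hj.2 _ fun g hg => by
    have h₃ : RLe (rest g) e := Hyperconnected.reflects_rle hP hc (rest_rest g) he (by
      rw [he', ← D.rest_sec]; exact RLe.rest hg)
    rw [idem_rle_iff (rest_rest g)] at h₃
    rw [RLe, ← Category.assoc, h₃]
    exact hj.1 g hg
  have h₃ := h₂.rest
  rw [rest_eq_comp he] at h₃
  have h₄ := hP.rle h₃
  rw [P.map_comp, ← D.rest_sec j, he'] at h₄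
  exact h₄.trans (by rw [rest_comm]; exact rle_rest_comp _ _)

omit [JoinRestriction C] [HasLocalGlueings C] hP in
theorem compatible_of_rle (hc : Hyperconnected P) {x y : 𝒜}
    {t : P.obj x ⟶ D.arr x y} {f g : x ⟶ y} (hf : RLe (D.sec f) t) (hg : RLe (D.sec g) t) :
    Compatible f g := by
  have := hf.compatible hg
  rw [Compatible, D.rest_sec, D.rest_sec, D.map_sec (rest_rest _),
    D.map_sec (rest_rest _)] at this
  exact D.sec_injective hc this

theorem exists_eq [JoinRestriction 𝒜] (hc : Hyperconnected P) {x y : 𝒜}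
    (t : (D.cat hP).PartialSection x y) :
    ∃ f : x ⟶ y, D.partialSection hP f = t := by
  obtain ⟨f, hf⟩ := D.exists_sec_eq hP hc t.val t.comp_src
    (JoinRestriction.exists_join _ fun _ hf _ hg => D.compatible_of_rle hc hf hg)
  exact ⟨f, PartialSection.ext' hf⟩

end Glueing

omit [BoundedJoins 𝒜] in
-- The images of `f'` and `g'` are compatible, both lying below the inverse of `k`, but `P` need not
-- be faithful. Compatibility is lifted by comparing domains, the only thing that `P` reflects: the
-- overlap of the inverses must come from the overlap `h` of `f` and `g`.
theorem compatible_inverse (hP : PreservesRest P) (hc : Hyperconnected P) {x y : 𝒜} {f g : x ⟶ y}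
    {f' g' : y ⟶ x} (hf : PartialInverse f f') (hg : PartialInverse g g') (hfg : Compatible f g)
    {k : P.obj x ⟶ P.obj y} (hk : PartialIso k) (hfk : RLe (P.map f) k) (hgk : RLe (P.map g) k) :
    Compatible f' g' := by
  obtain ⟨k', hk⟩ := hk
  -- `h` is the common part of `f` and `g`, so its inverse `f' ≫ rest h` lies below both `f'` and
  -- `g'`.
  set h := rest g ≫ f with hh
  have hhf : RLe h f := rle_rest_comp _ _
  have hhg : RLe h g := by rw [hh, hfg]; exact rle_rest_comp _ _
  have hif := hf.of_rle hhf
  have hig := hg.of_rle hhg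
  have hPf := hP.partialInverse hf
  have hPg := hP.partialInverse hg
  have hPf' := hPf.mono hk hfk
  have hPg' := hPg.mono hk hgk
  set y' := rest (P.map g') ≫ P.map f' with hy
  have hyf : RLe y' (P.map f') := rle_rest_comp _ _
  have hyg : RLe y' (P.map g') := by
    rw [hy, hPf'.compatible hPg']; exact rle_rest_comp _ _
  have hy1 := hPf.symm.of_rle hyf
  have hy2 := hPg.symm.of_rle hyg
  -- `y'` is the common part of the images of the inverses. Its own inverse lies below the images of
  -- both `f` and `g`, hence below that of `h`.
  have hm : RLe y' (P.map (f' ≫ rest h)) := by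
    refine hy1.symm.mono (hP.partialInverse hif) ?_
    have h1 := (hy1.mono hPf.symm hyf)
    have h2 : RLe (P.map f ≫ rest y') (P.map g) := by
      rw [hy1.unique hy2]; exact hy2.mono hPg.symm hyg
    have h3 : RLe (P.map f ≫ rest y') (rest (P.map g) ≫ P.map f) := by
      rw [RLe, ← Category.assoc, h2.rest_comp_rest]; exact h1
    rwa [hh, P.map_comp, hP]
  -- Hyperconnectedness turns the inequality of domains in `C` into one in `𝒜`: where `f'` and `g'`
  -- are both defined, so is the inverse of `h`, which agrees with both.
  have hle : RLe (rest g' ≫ rest f') (rest (f' ≫ rest h)) := by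
    refine Hyperconnected.reflects_rle hP hc (rest_idem_comp (rest_rest _) (rest_rest _))
      (rest_rest _) ?_
    rw [P.map_comp, hP, hP, hP, ← rest_rest_comp]
    exact hm.rest
  have hf1 : RLe (f' ≫ rest h) f' := hif.mono hf hhf
  have hg1 : RLe (f' ≫ rest h) g' := by
    rw [hif.unique hig]; exact hig.mono hg hhg
  have e1 : f' ≫ rest h = rest g' ≫ f' := by
    refine RLe.eq_of_rest ?_ (by rw [rest_rest_comp]; exact hle)
    rw [RLe, ← Category.assoc, hg1.rest_comp_rest, hf1]
  have e2 : f' ≫ rest h = rest f' ≫ g' := by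
    refine RLe.eq_of_rest ?_ (by rw [rest_rest_comp, rest_comm]; exact hle)
    rw [RLe, ← Category.assoc, hf1.rest_comp_rest, hg1]
  rw [Compatible, ← e1, e2]

namespace Glueing

variable (D : Glueing P) (hP : PreservesRest P) [JoinRestriction C] [HasLocalGlueings C]

/-- Compatible families need not have joins here. That the target of `t` is a partial isomorphism is
what makes the maps below `t` bicompatible. -/
theorem exists_eq_of_partialIso [JoinInverse 𝒜] (hc : Hyperconnected P) {x y : 𝒜}
    (t : (D.cat hP).PartialSection x y) (ht : PartialIso (t.val ≫ (D.cat hP).tgt x y)) :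
    ∃ f : x ⟶ y, D.partialSection hP f = t := by
  suffices h : ∃ j, IsJoin {g : x ⟶ y | RLe (D.sec g) t.val} j by
    obtain ⟨f, hf⟩ := D.exists_sec_eq hP hc t.val t.comp_src h
    exact ⟨f, PartialSection.ext' hf⟩
  refine JoinInverse.exists_join _ fun f hf g hg => ?_
  have hfg := D.compatible_of_rle hc hf hg
  have key : ∀ f : x ⟶ y, RLe (D.partialSection hP f).val t.val →
      RLe (P.map f) (t.val ≫ (D.cat hP).tgt x y) := fun f hf => by
    rw [← D.partialSection_tgt hP]; exact hf.comp_right _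
  exact ⟨hfg, fun f' g' hf' hg' =>
    compatible_inverse hP hc hf' hg' hfg ht (key f hf) (key g hg)⟩

section

variable (hinv : ∀ {x y : 𝒜} (f : x ⟶ y), PartialIso f)

include hinv hP

omit [HasLocalGlueings C] in
-- The germ of `f` at a point is sent to the germ of its inverse at the image point. On the overlap
-- of `f` and `g` both candidates equal the one defined by their meet.
theorem exists_inv (x y : 𝒜) : ∃ u : D.arr x y ⟶ D.arr y x, ∀ (f : x ⟶ y) (f' : y ⟶ x),
    PartialInverse f f' → D.sec f ≫ u = P.map f ≫ D.sec f' := by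
  have key : ∀ (m g : x ⟶ y) (m' g' : y ⟶ x), RLe m g → PartialInverse m m' →
      PartialInverse g g' → P.map m ≫ D.sec g' = P.map m ≫ D.sec m' := by
    intro m g m' g' h hm hg
    have h₁ : m ≫ rest m' = m := hm.symm.comp_rest
    rw [← h₁, P.map_comp, Category.assoc, D.map_sec (rest_rest _), hm.mono hg h,
      Category.assoc, D.map_sec (rest_rest _), rest_comp]
  choose inv hi using fun f : x ⟶ y => hinv f
  obtain ⟨u, hu⟩ := (D.atlas x y).exists_desc (fun f => P.map f ≫ D.sec (inv f)) (fun f g => by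
    rw [D.phi, ← Category.assoc, ← P.map_comp, ← Category.assoc, ← P.map_comp,
      rest_meet_comp_left, rest_meet_comp_right,
      key _ _ _ _ (meet_isMeet f g).1 (hi (meet f g)) (hi f),
      key _ _ _ _ (meet_isMeet f g).2.1 (hi (meet f g)) (hi g)])
  refine ⟨u, fun f f' h => ?_⟩
  rw [hu, D.rest_sec, hP, ← Category.assoc, rest_comp, (hi f).unique h]

theorem cat_isGroupoid : (D.cat hP).IsGroupoid := by
  choose ι hι using D.exists_inv hP hinv
  have hii : ∀ x y, ι x y ≫ ι y x = 𝟙 (D.arr x y) := fun x y =>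
    (D.atlas x y).hom_ext _ _ fun f => by
      obtain ⟨f', hf⟩ := hinv f
      rw [← Category.assoc, hι _ _ f f' hf, Category.assoc, hι _ _ f' f hf.symm, ← Category.assoc,
        ← P.map_comp, hf.1, D.map_sec (rest_rest f), rest_comp, Category.comp_id]
  have hs : ∀ x y, ι x y ≫ D.src y x = (D.graph hP).tgt x y := fun x y =>
    (D.atlas x y).hom_ext _ _ fun f => by
      obtain ⟨f', hf⟩ := hinv f
      refine Eq.trans ?_ (D.sec_tgt hP f).symm
      rw [← Category.assoc, hι _ _ f f' hf, Category.assoc, (D.atlas y x).sec f', D.rest_sec,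
        ← P.map_comp, hf.symm.comp_rest]
  refine ⟨ι, fun x y => Total.of_comp (g := ι y x) ?_, hii, hs,
    fun x y => (D.atlas x y).hom_ext _ _ fun f => ?_⟩
  · exact (congrArg rest (hii x y)).trans (rest_id _)
  obtain ⟨f', hf⟩ := hinv f
  have h₁ : D.sec f ≫ ι x y = (D.partialSection hP f).val ≫ (D.cat hP).tgt x y ≫
      (D.partialSection hP f').val :=
    (hι x y f f' hf).trans ((congrArg (· ≫ D.sec f') (D.sec_tgt hP f).symm).trans
      (Category.assoc _ _ _))
  have h₂ : rest ((D.partialSection hP f).val ≫ (D.cat hP).tgt x y ≫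
      (D.partialSection hP f').val) ≫ (D.partialSection hP f).val = D.sec f ≫ 𝟙 (D.arr x y) := by
    have h₃ : rest (D.sec f ≫ ι x y) = rest (D.sec f) := by
      rw [hι x y f f' hf, D.rest_aux hP, hf.1, rest_rest, D.rest_sec]
    exact (congrArg (fun k => rest k ≫ D.sec f) h₁.symm).trans
      ((congrArg (· ≫ D.sec f) h₃).trans ((rest_comp _).trans (Category.comp_id _).symm))
  refine ((D.cat hP).comp_mu (D.partialSection hP f).val _ _ _).trans ?_
  refine ((D.cat hP).mu_congr _ h₁ h₂.symm).trans ((star_eq _ _).symm.trans ?_)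
  refine (D.star_partialSection hP f' f).trans ?_
  refine Eq.trans ?_ (Category.assoc _ _ _)
  refine Eq.trans ?_ (congrArg (· ≫ (D.cat hP).ident x) (D.partialSection hP f).comp_src).symm
  rw [D.rest_partialSection, hf.1]

end

end Glueing

end

end EtaleCat

/-! ### Meets, hyperconnected functors and localic maps. -/

namespace EtaleCat

open RestrictionCategory PartiteCat

section

variable {D : Type w₁} [Category.{v} D] [RestrictionCategory D]
variable {E : Type w₂} [Category.{v} E] [RestrictionCategory E]
variable {D' : Type w₃} [Category.{v} D'] [RestrictionCategory D']

theorem MeetCondition.of_full_faithful (F : D ⥤ E) (hF : PreservesRest F) [F.Full] [F.Faithful] :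
    MeetCondition F := by
  have key : ∀ {x y : D} {f g : x ⟶ y}, RLe (F.map f) (F.map g) → RLe f g := fun {x y f g} h => by
    apply F.map_injective
    rw [F.map_comp, hF, h]
  refine ⟨fun f g m h => ⟨hF.rle h.1, hF.rle h.2.1, fun k hk hk' => ?_⟩, fun g => ?_⟩
  · obtain ⟨k, rfl⟩ := F.map_surjective k
    exact hF.rle (h.2.2 k (key hk) (key hk'))
  · obtain ⟨f, rfl⟩ := F.map_surjective g
    exact ⟨fun _ ⟨_, h⟩ => h.1, fun _ h =>
      h _ ⟨f, RLe.refl _, RLe.refl _, fun _ h _ => h⟩⟩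

/-- For the second condition, `g` is a join of pieces `h` below maps `G f'`, and each `f'` is a join
of pieces below maps `F f`. Since `G` preserves that join, each `h` is a join of pieces below maps
`G (F f)`. -/
theorem MeetCondition.comp {F : D ⥤ E} {G : E ⥤ D'} (hF : MeetCondition F) (hG : MeetCondition G)
    (hr : PreservesRest G) (hj : PreservesJoins G) [BoundedJoins D'] : MeetCondition (F ⋙ G) := by
  refine ⟨fun f g m h => hG.1 _ _ _ (hF.1 f g m h), fun {x y} g => ⟨fun _ ⟨_, h⟩ => h.1,
    fun k hk => (hG.2 g).2 k ?_⟩⟩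
  rintro h ⟨f', hh⟩
  have h₁ := (hj _ _ (hF.2 f')).comp_left (rest h)
  rw [hh.2.1] at h₁
  refine h₁.2 k ?_
  rintro _ ⟨_, ⟨m, ⟨f, hm⟩, rfl⟩, rfl⟩
  have h₂ : RLe (rest h ≫ G.map m) h := by
    conv_rhs => rw [← hh.2.1]
    exact (hr.rle hm.1).comp_left _
  have h₃ : RLe (rest h ≫ G.map m) (G.map (F.map f)) :=
    (rle_rest_comp _ _).trans (hr.rle hm.2.1)
  exact ((meet_isMeet g (G.map (F.map f))).2.2 _ (h₂.trans hh.1) h₃).trans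
    (hk _ ⟨f, meet_isMeet _ _⟩)

end

section

variable {C : Type u} [Category.{v} C] [RestrictionCategory C]

/-- Restriction categories hyperconnected over `C` in which bounded families have joins. -/
def bhcon (C : Type u) [Category.{v} C] [RestrictionCategory C] :
    ObjectProperty (RCatOver.{w} C) :=
  fun A => BoundedJoins A.carrier ∧ Hyperconnected A.proj

theorem hcon_le : hcon.{w} C ≤ bhcon C := fun _ ⟨_, h⟩ => ⟨inferInstance, h⟩

theorem jihcon_le : jihcon.{w} C ≤ bhcon C := fun A ⟨_, h⟩ =>
  ⟨BoundedJoins.of_joinInverse A.carrier, h⟩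

section

variable {𝒜 : Type w} [Category.{v} 𝒜] [RestrictionCategory 𝒜] {P : 𝒜 ⥤ C}

theorem Hyperconnected.of_exists (hP : PreservesRest P)
    (hi : ∀ {x : 𝒜} {d e : x ⟶ x}, rest d = d → rest e = e → P.map d = P.map e → d = e)
    (hs : ∀ {x : 𝒜} (e : P.obj x ⟶ P.obj x), rest e = e → ∃ d : x ⟶ x, rest d = d ∧ P.map d = e) :
    Hyperconnected P := fun x =>
  ⟨fun d (hd : rest d = d) => show rest (P.map d) = P.map d by rw [← hP, hd],
    fun _ hd _ he h => hi hd he h, fun e he => hs e he⟩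

/-- The join in `C` of the images lies below the idempotent `P e`, so it is the image of an
idempotent `d`; since `P` reflects the order, `d` is an upper bound of `S`. -/
theorem Hyperconnected.isJoin_map [BoundedJoins C] (hP : PreservesRest P) (hc : Hyperconnected P)
    {x : 𝒜} {S : Set (x ⟶ x)} {e : x ⟶ x} (hS : ∀ d ∈ S, rest d = d) (he : rest e = e)
    (h : IsJoin S e) : IsJoin (P.map '' S) (P.map e) := by
  have hb : ∀ d ∈ P.map '' S, RLe d (P.map e) := by
    rintro _ ⟨d, hd, rfl⟩; exact hP.rle (h.1 d hd)
  obtain ⟨m, hm⟩ := BoundedJoins.exists_join _ _ hb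
  have hle := hm.2 _ hb
  rw [← he, hP] at hle
  obtain ⟨d, hd, rfl⟩ := (hc x).surjOn (rest_of_rle_rest hle)
  have : RLe e d := h.2 d fun c hc' =>
    Hyperconnected.reflects_rle hP hc (hS c hc') hd (hm.1 _ ⟨c, hc', rfl⟩)
  rw [← hP, he] at hle
  rwa [← hle.antisymm (hP.rle this)]

theorem Hyperconnected.isJoin_of_map [BoundedJoins 𝒜] [BoundedJoins C] (hP : PreservesRest P)
    (hc : Hyperconnected P) {x : 𝒜} {S : Set (x ⟶ x)} {e : x ⟶ x} (hS : ∀ d ∈ S, rest d = d)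
    (he : rest e = e) (h : IsJoin (P.map '' S) (P.map e)) : IsJoin S e := by
  have hb : ∀ d ∈ S, RLe d e := fun d hd =>
    Hyperconnected.reflects_rle hP hc (hS d hd) he (h.1 _ ⟨d, hd, rfl⟩)
  obtain ⟨m, hm⟩ := BoundedJoins.exists_join _ _ hb
  have hle := hm.2 _ hb
  have hm' : rest m = m := rest_of_rle_rest (f := e) (by rwa [he])
  rwa [← (hc x).injOn hm' he ((Hyperconnected.isJoin_map hP hc hS hm' hm).unique h)]

end

/-- Naturality and totality of the transformation force the action on idempotents to be inverse
image along `α`. -/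
theorem RCatOver.Hom.proj_map_idem {A B : RCatOver.{w} C} (F : RCatOver.Hom A B) {x : A.carrier}
    {e : x ⟶ x} (he : rest e = e) :
    B.proj.map (F.functor.map e) = rest (F.trans.app x ≫ A.proj.map e) := by
  have h := F.trans.naturality e
  rw [← h, rest_comp_total _ (F.trans_total x)]
  change _ = rest (B.proj.map (F.functor.map e))
  rw [← B.proj_rest, ← F.functor_rest, he]

/-- Joins are detected on domains, and domains may be compared in `C`. There the functor acts by
inverse image along `α`, which preserves joins. -/
theorem RCatOver.Hom.preservesJoins [BoundedJoins C] {A B : RCatOver.{w} C} (F : RCatOver.Hom A B)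
    (hA : bhcon C A) (hB : bhcon C B) : PreservesJoins F.functor := by
  intro x y S j h
  have := hA.1
  have := hB.1
  refine isJoin_of_rest ?_ ?_
  · rintro _ ⟨f, hf, rfl⟩; exact PreservesRest.rle F.functor_rest (h.1 f hf)
  have key : ∀ f : x ⟶ y, B.proj.map (rest (F.functor.map f)) =
      rest (F.trans.app x ≫ A.proj.map (rest f)) := fun f => by
    rw [← F.functor_rest, F.proj_map_idem (rest_rest f)]
  refine Hyperconnected.isJoin_of_map B.proj_rest hB.2 ?_ (rest_rest _) ?_
  · rintro _ ⟨_, _, rfl⟩; exact rest_rest _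
  have h₁ := ((Hyperconnected.isJoin_map A.proj_rest hA.2 (by
    rintro _ ⟨_, _, rfl⟩; exact rest_rest _) (rest_rest j) h.rest).comp_left (F.trans.app x)).rest
  rw [Set.image_image, Set.image_image, Set.image_image] at h₁
  rw [Set.image_image, Set.image_image]
  have h₂ := Set.image_congr (s := S) fun f _ => key f
  rw [h₂, key]
  exact h₁

theorem overBijObj_id (A : RCatOver.{w} C) : overBijObj C (𝟙 A) := Function.bijective_id

instance : (overBijObj.{w} C).IsMultiplicative where
  id_mem := overBijObj_id
  comp_mem _ _ hf hg := hg.comp hf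

instance : (overIso.{w} C).IsMultiplicative where
  id_mem A X := inferInstanceAs (IsIso (𝟙 (A.proj.obj X)))
  comp_mem {A B E} f g hf hg X := by
    have := hf X
    have := hg (f.functor.obj X)
    exact inferInstanceAs (IsIso (𝟙 _ ≫ g.trans.app (f.functor.obj X) ≫ f.trans.app X))

theorem RCatOver.functor_hom_inv {A B : RCatOver.{w} C} (e : A ≅ B) :
    e.hom.functor ⋙ e.inv.functor = 𝟭 A.carrier :=
  congrArg RCatOver.Hom.functor e.hom_inv_id

instance RCatOver.faithful_hom {A B : RCatOver.{w} C} (e : A ≅ B) : e.hom.functor.Faithful :=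
  Functor.Faithful.of_comp_eq (RCatOver.functor_hom_inv e)

instance RCatOver.full_hom {A B : RCatOver.{w} C} (e : A ≅ B) : e.hom.functor.Full := by
  have : (e.hom.functor ⋙ e.inv.functor).Full := by
    rw [RCatOver.functor_hom_inv e]; infer_instance
  have : e.inv.functor.Faithful := RCatOver.faithful_hom e.symm
  exact Functor.Full.of_comp_faithful e.hom.functor e.inv.functor

theorem overMeet_iso {A B : RCatOver.{w} C} (e : A ≅ B) : overMeet C e.hom :=
  MeetCondition.of_full_faithful _ e.hom.functor_rest

theorem overBijObj_iso {A B : RCatOver.{w} C} (e : A ≅ B) : overBijObj C e.hom := by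
  refine Function.bijective_iff_has_inverse.2 ⟨e.inv.functor.obj, fun X => ?_, fun X => ?_⟩
  · exact Functor.congr_obj (RCatOver.functor_hom_inv e) X
  · exact Functor.congr_obj (RCatOver.functor_hom_inv e.symm) X

/-- In a chain of three components taken alternately from `e.hom` and `e.inv`, both consecutive
composites are invertible. The middle one is thus a split epimorphism and a monomorphism, hence
invertible, and so is its neighbour. -/
theorem overIso_iso {A B : RCatOver.{w} C} (e : A ≅ B) : overIso C e.hom := by
  have key : ∀ {A B : RCatOver.{w} C} (e : A ≅ B) (X : A.carrier),
      IsIso (e.inv.trans.app (e.hom.functor.obj X) ≫ e.hom.trans.app X) := fun {A B} e X => by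
    have h : overIso C (e.hom ≫ e.inv) := by
      rw [e.hom_inv_id]; exact MorphismProperty.id_mem _ _
    have h' : IsIso (𝟙 _ ≫ e.inv.trans.app (e.hom.functor.obj X) ≫ e.hom.trans.app X) := h X
    rwa [Category.id_comp] at h'
  intro X
  have h₁ := key e X
  have h₂ := key e.symm (e.hom.functor.obj X)
  have h₃ : IsIso (e.inv.trans.app (e.hom.functor.obj X)) := by
    have : IsSplitEpi (e.inv.trans.app (e.hom.functor.obj X)) :=
      ⟨⟨⟨_, (Category.assoc _ _ _).trans (IsIso.inv_hom_id (I := h₂))⟩⟩⟩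
    have : Mono (e.inv.trans.app (e.hom.functor.obj X)) :=
      mono_of_mono _ (e.hom.trans.app X)
    exact isIso_of_mono_of_isSplitEpi _
  exact IsIso.of_isIso_comp_left (e.inv.trans.app (e.hom.functor.obj X)) _

section

variable [BoundedJoins C] {P : ObjectProperty (RCatOver.{w} C)} (hP : P ≤ bhcon C)

include hP

theorem isMultiplicative_overMeet : ((overMeet C).inverseImage P.ι).IsMultiplicative where
  id_mem _ := MeetCondition.of_full_faithful (𝟭 _) (fun _ => rfl)
  comp_mem {_ B E} _ g hf hg :=
    have : BoundedJoins (P.ι.obj E).carrier := (hP _ E.property).1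
    MeetCondition.comp hf hg g.hom.functor_rest
      (g.hom.preservesJoins (hP _ B.property) (hP _ E.property))

theorem localic_iff {A B : RCatOver.{w} C} (hA : P A) (hB : P B) (F : A ⟶ B) :
    localic C F ↔ overBijObj C F ∧ overMeet C F :=
  ⟨fun h => h.2, fun h => ⟨RCatOver.Hom.preservesJoins F (hP _ hA) (hP _ hB), h⟩⟩

theorem localic_inverseImage : (localic C).inverseImage P.ι =
    (overBijObj C).inverseImage P.ι ⊓ (overMeet C).inverseImage P.ι := by
  ext A B f
  exact localic_iff hP A.property B.property f.hom

theorem isMultiplicative_localic : ((localic C).inverseImage P.ι).IsMultiplicative := by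
  have := isMultiplicative_overMeet hP
  rw [localic_inverseImage hP]
  infer_instance

theorem localic_iso {A B : RCatOver.{w} C} (hA : P A) (hB : P B) (e : A ≅ B) :
    localic C e.hom :=
  (localic_iff hP hA hB e.hom).2 ⟨overBijObj_iso e, overMeet_iso e⟩

end

/-- A multiplicative property of the maps of a full subcategory that holds for isomorphisms
respects isomorphisms. -/
theorem respectsIso_inverseImage {E : Type w₁} [Category.{w₂} E] {P : ObjectProperty E}
    {V : MorphismProperty E} (hm : (V.inverseImage P.ι).IsMultiplicative)
    (hi : ∀ {A B : E} (_ : P A) (_ : P B) (e : A ≅ B), V e.hom) :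
    (V.inverseImage P.ι).RespectsIso :=
  MorphismProperty.respectsIso_of_isStableUnderComposition fun A B f hf => by
    have : IsIso f := hf
    exact hi A.property B.property (P.ι.mapIso (asIso f))

end

end EtaleCat

/-! ### Joins, meets and idempotents of the externalisation. -/

namespace EtaleCat

open RestrictionCategory PartiteCat

section

variable {C : Type u} [Category.{v} C] [RestrictionCategory C]
variable {I : Type w₁} {A : PartiteCat I C}

theorem Ext.rle_iff {i j : Ext A} {s t : i ⟶ j} : RLe s t ↔ RLe s.val t.val := by
  have h : (rest s ≫ t).val = rest s.val ≫ t.val := star_idem _ _ _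
  exact ⟨fun e => h.symm.trans (congrArg PartialSection.val e),
    fun e => PartialSection.ext' (h.trans e)⟩

theorem Ext.compatible_iff {i j : Ext A} {s t : i ⟶ j} :
    Compatible s t ↔ Compatible s.val t.val := by
  have h : ∀ s t : i ⟶ j, (rest s ≫ t).val = rest s.val ≫ t.val := fun s t => star_idem _ _ _
  exact ⟨fun e => (h t s).symm.trans ((congrArg PartialSection.val e).trans (h s t)),
    fun e => PartialSection.ext' ((h t s).trans (Eq.trans e (h s t).symm))⟩

theorem PartiteCat.section_of_rle {i j : I} {k : A.obj i ⟶ A.arr i j} {s : A.PartialSection i j}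
    (h : RLe k s.val) : k ≫ A.src i j = rest k := by
  conv_lhs => rw [← h, Category.assoc, s.comp_src, h.rest_comp_rest]

/-- Any map below a partial section is again one, so lower bounds are the same in `Ext A` and in
`C`. -/
theorem Ext.isMeet_iff {i j : Ext A} {s t m : i ⟶ j} :
    IsMeet s t m ↔ IsMeet s.val t.val m.val := by
  refine ⟨fun h => ⟨Ext.rle_iff.1 h.1, Ext.rle_iff.1 h.2.1, fun k hs ht => ?_⟩,
    fun h => ⟨Ext.rle_iff.2 h.1, Ext.rle_iff.2 h.2.1, fun k hs ht =>
      Ext.rle_iff.2 (h.2.2 _ (Ext.rle_iff.1 hs) (Ext.rle_iff.1 ht))⟩⟩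
  exact Ext.rle_iff.1 (h.2.2 ⟨k, section_of_rle hs⟩ (Ext.rle_iff.2 hs) (Ext.rle_iff.2 ht))

theorem Ext.isJoin_of_val {i j : Ext A} {S : Set (i ⟶ j)} {s : i ⟶ j}
    (h : IsJoin (PartialSection.val '' S) s.val) : IsJoin S s :=
  ⟨fun f hf => Ext.rle_iff.2 (h.1 _ ⟨f, hf, rfl⟩), fun k hk => Ext.rle_iff.2 (h.2 _ (by
    rintro _ ⟨f, hf, rfl⟩; exact Ext.rle_iff.1 (hk f hf)))⟩

theorem Ext.isJoin_val [BoundedJoins C] {i j : Ext A} {S : Set (i ⟶ j)} {s : i ⟶ j}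
    (h : IsJoin S s) : IsJoin (PartialSection.val '' S) s.val := by
  have hb : ∀ f ∈ PartialSection.val '' S, RLe f s.val := by
    rintro _ ⟨f, hf, rfl⟩; exact Ext.rle_iff.1 (h.1 f hf)
  obtain ⟨m, hm⟩ := BoundedJoins.exists_join _ _ hb
  have hle := hm.2 _ hb
  have : RLe s.val m := Ext.rle_iff.1 (h.2 ⟨m, section_of_rle hle⟩ fun f hf =>
    Ext.rle_iff.2 (hm.1 _ ⟨f, hf, rfl⟩))
  rwa [← hle.antisymm this]

/-- A join of partial sections is a partial section, because both composing with the source map and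
taking domains preserve joins. -/
theorem Ext.exists_isJoin [BoundedJoins C] {i j : Ext A} {S : Set (i ⟶ j)}
    (h : ∃ m, IsJoin (PartialSection.val '' S) m) : ∃ s, IsJoin S s := by
  obtain ⟨m, hm⟩ := h
  refine ⟨⟨m, ?_⟩, Ext.isJoin_of_val hm⟩
  have h₁ := hm.comp_right (A.src i.idx j.idx)
  have h₂ := hm.rest
  rw [Set.image_image] at h₁ h₂
  have h₃ := Set.image_congr (s := S) fun s _ => PartialSection.comp_src s
  exact (Eq.mp (congrArg (IsJoin · _) h₃) h₁).unique h₂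

instance [JoinRestriction C] : JoinRestriction (Ext A) where
  exists_join S h := Ext.exists_isJoin (JoinRestriction.exists_join _ (by
    rintro _ ⟨f, hf, rfl⟩ _ ⟨g, hg, rfl⟩
    exact Ext.compatible_iff.1 (h f hf g hg)))
  comp_join {k i j} g S s h := by
    refine Ext.isJoin_of_val (isJoin_of_rest ?_ ?_)
    · rintro _ ⟨_, ⟨f, hf, rfl⟩, rfl⟩
      exact Ext.rle_iff.1 ((h.1 f hf).comp_left g)
    · have h₁ := ((Ext.isJoin_val h).comp_left (g.val ≫ A.tgt _ _)).rest
      have h₂ : ∀ f : i ⟶ j, rest (g ≫ f).val = rest ((g.val ≫ A.tgt k.idx i.idx) ≫ f.val) :=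
        fun f => (rest_star f g).trans (congrArg rest (Category.assoc _ _ _).symm)
      rw [Set.image_image, Set.image_image] at h₁
      rw [Set.image_image, Set.image_image, Set.image_congr (s := S) fun f _ => h₂ f, h₂]
      exact h₁

theorem Ext.idem_val {i : Ext A} {d : i ⟶ i} (hd : rest d = d) :
    (extProj A).map d = rest d.val ∧ d.val = rest d.val ≫ A.ident i.idx := by
  have h : d.val = rest d.val ≫ A.ident i.idx := (congrArg PartialSection.val hd).symm
  refine ⟨?_, h⟩
  refine (congrArg (· ≫ A.tgt i.idx i.idx) h).trans ?_
  exact (Category.assoc _ _ _).trans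
    ((congrArg (rest d.val ≫ ·) (A.ident_tgt i.idx)).trans (Category.comp_id _))

theorem Ext.rest_idemSection {i : Ext A} (e : A.obj i.idx ⟶ A.obj i.idx) (he : rest e = e) :
    rest (C := Ext A) (A := i) (B := i) (idemSection e he) = idemSection e he :=
  PartialSection.ext' (congrArg (· ≫ A.ident i.idx) ((rest_comp_ident e).trans he))

theorem Ext.proj_idemSection {i : Ext A} (e : A.obj i.idx ⟶ A.obj i.idx) (he : rest e = e) :
    (extProj A).map (X := i) (Y := i) (idemSection e he) = e :=
  (Category.assoc _ _ _).trans ((congrArg (e ≫ ·) (A.ident_tgt i.idx)).trans (Category.comp_id _))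

theorem Ext.eq_idemSection {i : Ext A} {d : i ⟶ i} (hd : rest d = d)
    (e : A.obj i.idx ⟶ A.obj i.idx) (he : rest e = e) (h : (extProj A).map d = e) :
    d = idemSection e he :=
  PartialSection.ext' ((Ext.idem_val hd).2.trans
    (congrArg (· ≫ A.ident i.idx) ((Ext.idem_val hd).1.symm.trans h)))

/-- An idempotent of `i` in the externalisation is the identity section restricted to an idempotent
of `A_i`, and the projection returns that idempotent. -/
theorem hyperconnected_extProj : Hyperconnected (extProj A) :=
  Hyperconnected.of_exists (extProj_rest A)
    (fun {_ _ e} hd he h => (Ext.eq_idemSection hd ((extProj A).map e)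
      ((extProj_rest A e).symm.trans (congrArg _ he)) h).trans (Ext.eq_idemSection he _ _ rfl).symm)
    fun e he => ⟨idemSection e he, Ext.rest_idemSection e he, Ext.proj_idemSection e he⟩

end

/-! ### The subcategory of partial bisections. -/

section

variable {C : Type u} [Category.{v} C] [RestrictionCategory C] {A : RCatOver.{w} C}

theorem Bis.rle_iff {x y : Bis A} {f g : x ⟶ y} : RLe f g ↔ RLe f.1 g.1 := Subtype.ext_iff

theorem Bis.compatible_iff {x y : Bis A} {f g : x ⟶ y} :
    Compatible f g ↔ Compatible f.1 g.1 := Subtype.ext_iff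

theorem Bis.partialInverse_iff {x y : Bis A} {f : x ⟶ y} {g : y ⟶ x} :
    PartialInverse f g ↔ PartialInverse f.1 g.1 := and_congr Subtype.ext_iff Subtype.ext_iff

theorem RCatOver.partialIso_of_rle {x y : A.carrier} {k f : x ⟶ y} (h : RLe k f)
    (hf : PartialIso (A.proj.map f)) : PartialIso (A.proj.map k) :=
  hf.of_rle (PreservesRest.rle A.proj_rest h)

theorem Bis.isMeet_iff {x y : Bis A} {f g m : x ⟶ y} : IsMeet f g m ↔ IsMeet f.1 g.1 m.1 :=
  ⟨fun h => ⟨Bis.rle_iff.1 h.1, Bis.rle_iff.1 h.2.1, fun _ hf hg =>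
      Bis.rle_iff.1 (h.2.2 ⟨_, RCatOver.partialIso_of_rle hf f.2⟩ (Bis.rle_iff.2 hf)
        (Bis.rle_iff.2 hg))⟩,
    fun h => ⟨Bis.rle_iff.2 h.1, Bis.rle_iff.2 h.2.1, fun _ hf hg =>
      Bis.rle_iff.2 (h.2.2 _ (Bis.rle_iff.1 hf) (Bis.rle_iff.1 hg))⟩⟩

theorem Bis.isJoin_of_val {x y : Bis A} {S : Set (x ⟶ y)} {f : x ⟶ y}
    (h : IsJoin (Subtype.val '' S) f.1) : IsJoin S f :=
  ⟨fun g hg => Bis.rle_iff.2 (h.1 _ ⟨g, hg, rfl⟩), fun k hk => Bis.rle_iff.2 (h.2 _ (by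
    rintro _ ⟨g, hg, rfl⟩; exact Bis.rle_iff.1 (hk g hg)))⟩

theorem Bis.isJoin_val [BoundedJoins A.carrier] {x y : Bis A} {S : Set (x ⟶ y)} {f : x ⟶ y}
    (h : IsJoin S f) : IsJoin (Subtype.val '' S) f.1 := by
  have hb : ∀ g ∈ Subtype.val '' S, RLe g f.1 := by
    rintro _ ⟨g, hg, rfl⟩; exact Bis.rle_iff.1 (h.1 g hg)
  obtain ⟨m, hm⟩ := BoundedJoins.exists_join _ _ hb
  have hle := hm.2 _ hb
  have : RLe f.1 m := Bis.rle_iff.1 (h.2 ⟨m, RCatOver.partialIso_of_rle hle f.2⟩ fun g hg =>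
    Bis.rle_iff.2 (hm.1 _ ⟨g, hg, rfl⟩))
  rwa [← hle.antisymm this]

/-- Bicompatibility gives joins in the ambient category both of the family and of the family of
inverses. These joins are inverse to each other, so the first one is again a partial bisection. -/
theorem joinInverse_bis [JoinRestriction A.carrier] (hA : A.Reflects) : JoinInverse (Bis A) where
  partialIso s := by
    obtain ⟨t, ht⟩ := hA s.1 s.2
    exact ⟨⟨t, ⟨_, PreservesRest.partialInverse A.proj_rest ht.symm⟩⟩,
      Bis.partialInverse_iff.2 ht⟩
  exists_join {x y} S h := by
    obtain ⟨j, hj⟩ := JoinRestriction.exists_join (Subtype.val '' S) (by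
      rintro _ ⟨f, hf, rfl⟩ _ ⟨g, hg, rfl⟩
      exact Bis.compatible_iff.1 (h f hf g hg).1)
    let S' : Set (y.of ⟶ x.of) := {g | ∃ f ∈ S, PartialInverse f.1 g}
    have hS' : ∀ {f : x ⟶ y} {g : y.of ⟶ x.of}, PartialInverse f.1 g →
        ∃ g' : y ⟶ x, g'.1 = g ∧ PartialInverse f g' := fun {f g} hg =>
      ⟨⟨g, ⟨_, PreservesRest.partialInverse A.proj_rest hg.symm⟩⟩, rfl,
        Bis.partialInverse_iff.2 hg⟩
    obtain ⟨j', hj'⟩ := JoinRestriction.exists_join S' (by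
      rintro g ⟨f, hf, hg⟩ k ⟨l, hl, hk⟩
      obtain ⟨g, rfl, hg'⟩ := hS' hg
      obtain ⟨k, rfl, hk'⟩ := hS' hk
      exact Bis.compatible_iff.1 ((h f hf l hl).2 _ _ hg' hk'))
    have hi : PartialInverse j j' := isJoin_partialInverse hj hj' (by
      rintro _ ⟨f, hf, rfl⟩
      obtain ⟨g, hg⟩ := hA f.1 f.2
      exact ⟨g, ⟨f, hf, hg⟩, hg⟩) (by
      rintro g ⟨f, hf, hg⟩
      exact ⟨f.1, ⟨f, hf, rfl⟩, hg⟩)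
    exact ⟨⟨j, ⟨_, PreservesRest.partialInverse A.proj_rest hi⟩⟩, Bis.isJoin_of_val hj⟩
  comp_join g S j h := by
    refine Bis.isJoin_of_val ?_
    have := (Bis.isJoin_val h).comp_left g.1
    rw [Set.image_image] at this
    rw [Set.image_image]
    exact this

theorem hyperconnected_bis (hA : Hyperconnected A.proj) : Hyperconnected A.bis.proj :=
  Hyperconnected.of_exists A.bis.proj_rest
    (fun {x d e} hd he h => Subtype.ext ((hA x.of).injOn (congrArg Subtype.val hd)
      (congrArg Subtype.val he) h))
    fun {x} e he => by
      obtain ⟨d, hd, h⟩ := (hA x.of).surjOn he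
      exact ⟨⟨d, by rw [h, ← he]; exact PartialIso.rest e⟩, Subtype.ext hd, h⟩

end

section

variable {C : Type u} [Category.{v} C] [RestrictionCategory C] [JoinRestriction C]

theorem hcon_externalisation (A : PCat.{w} C) : hcon C ((externalisation C).obj A) :=
  ⟨inferInstanceAs (JoinRestriction (Ext A.cat)), hyperconnected_extProj⟩

theorem jihcon_externalisationG (A : (IsPGpd.{w} C).FullSubcategory) :
    jihcon C ((externalisationG C).obj A) :=
  have : JoinRestriction ((externalisation C).obj A.obj).carrier := (hcon_externalisation _).1
  ⟨joinInverse_bis (reflects_of_groupoid A.obj A.property),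
    hyperconnected_bis (hcon_externalisation _).2⟩

end

end EtaleCat

/-! ### Fullness and faithfulness of the externalisations. -/

namespace EtaleCat

open RestrictionCategory PartiteCat

section

variable {C : Type u} [Category.{v} C] [RestrictionCategory C] [JoinRestriction C]
variable {I : Type w₁} {J : Type w₂} {A : PartiteCat I C} {B : PartiteCat J C}

/-- Jointly epic families of partial sections of local homeomorphisms are atlases. -/
theorem Atlas.of_sections {E X : C} {p : E ⟶ X} (hp : LocalHomeo p) {K : Type w} (s : K → (X ⟶ E))
    (hs : ∀ k, s k ≫ p = rest (s k))
    (h : ∀ {Z : C} (u v : E ⟶ Z), (∀ k, s k ≫ u = s k ≫ v) → u = v) : ∃ q, Atlas p q s := by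
  obtain ⟨q, a⟩ := hp.exists_atlas
  choose q' hi hle using fun k => a.exists_inverse (s k) (hs k)
  exact ⟨q', hp.1, hle, hi, h⟩

theorem PartiteCat.SourceEtale.exists_atlas (hA : A.SourceEtale) (i j : I) :
    ∃ q, Atlas (A.src i j) q (fun s : A.PartialSection i j => s.val) := by
  obtain ⟨q, a⟩ := (hA i j).exists_atlas
  exact Atlas.of_sections (hA i j) _ (fun s => s.comp_src) fun u v h =>
    a.hom_ext u v fun s => h ⟨s.1, s.2⟩

/-- The partial bisections of a partite internal category. -/
def PartiteCat.PartialBisection (A : PartiteCat I C) (i j : I) : Type v :=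
  {s : A.PartialSection i j // PartialIso (s.val ≫ A.tgt i j)}

/-- The objects of arrows of étale groupoids are covered by partial bisections. -/
theorem PartiteCat.SourceEtale.exists_atlas_bisections (hA : A.SourceEtale) (hG : A.IsGroupoid)
    (i j : I) : ∃ q, Atlas (A.src i j) q (fun s : A.PartialBisection i j => s.1.val) := by
  obtain ⟨ι, ht, hi, hs, -⟩ := hG
  obtain ⟨q, a⟩ := hA.exists_atlas i j
  obtain ⟨r, b⟩ := hA.exists_atlas j i
  refine Atlas.of_sections (hA i j) _ (fun s => s.1.comp_src) fun u v h =>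
    a.hom_ext u v fun s => ?_
  have h₁ : rest (s.val ≫ ι i j) = rest s.val := rest_comp_total _ (ht i j)
  -- Each section `s` is a join of bisections: it is restricted to the parts on which its inverse
  -- arrow lies in a chart `t` of `A_ji`.
  have h₂ : rest (s.val ≫ ι i j) ≫ s.val ≫ u = rest (s.val ≫ ι i j) ≫ s.val ≫ v := by
    refine b.ext_gen _ fun t => ?_
    have h₃ : rest ((s.val ≫ ι i j) ≫ r t) ≫ s.val = s.val ≫ rest (ι i j ≫ r t) := by
      rw [Category.assoc, comp_rest]
    have hsec : RLe (s.val ≫ rest (ι i j ≫ r t)) s.val := by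
      rw [comp_rest]; exact rle_rest_comp _ _
    have hb : PartialIso ((s.val ≫ rest (ι i j ≫ r t)) ≫ A.tgt i j) := by
      have h₄ : (s.val ≫ rest (ι i j ≫ r t)) ≫ A.tgt i j = s.val ≫ ι i j ≫ r t := by
        have h₅ : rest (ι i j ≫ r t) ≫ ι i j ≫ A.src j i = ι i j ≫ r t := by
          rw [← comp_rest_assoc', b.q_eq]
        rw [Category.assoc, ← hs, h₅]
      rw [h₄]
      -- On such a part the target of `s` is the source of its inverse arrow: a composite of the
      -- partially invertible section `s`, the isomorphism `ι` and the chart `r t`.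
      refine PartialIso.comp ⟨_, (a.inv s).symm⟩ (PartialIso.comp ⟨ι j i, ?_⟩ ⟨_, b.inv t⟩)
      exact ⟨(hi i j).trans (ht i j).symm, (hi j i).trans (ht j i).symm⟩
    rw [← Category.assoc, ← Category.assoc, h₃]
    exact h ⟨⟨_, section_of_rle hsec⟩, hb⟩
  rwa [h₁, ← Category.assoc, ← Category.assoc, rest_comp] at h₂

section

variable {A B : PCat.{w} C}

theorem externalisation_injective (hA : A.cat.SourceEtale) {F G : Cofunctor A.cat B.cat}
    (h : (externalisation C).map (X := A) (Y := B) F = (externalisation C).map G) : F = G := by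
  have h' : (show RCatOver.Hom ((externalisation C).obj A) ((externalisation C).obj B) from
    (externalisation C).map (X := A) (Y := B) F) = (externalisation C).map (X := A) (Y := B) G := h
  refine Cofunctor.ext_push (sec := fun s => s) hA.exists_atlas (funext fun i => ?_) ?_
    fun {i j} k => ?_
  · exact congrArg (fun x : RCatOver.Hom ((externalisation C).obj A) ((externalisation C).obj B) =>
      (x.functor.obj ⟨i⟩).idx) h'
  · exact congr_arg_heq (fun x : RCatOver.Hom ((externalisation C).obj A)
      ((externalisation C).obj B) => fun i => x.trans.app ⟨i⟩) h'
  · exact congr_arg_heq (fun x : RCatOver.Hom ((externalisation C).obj A)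
      ((externalisation C).obj B) => (x.functor.map (X := ⟨i⟩) (Y := ⟨j⟩) k).val) h'

theorem externalisationG_injective {A B : (IsPGpd.{w} C).FullSubcategory}
    (hA : A.obj.cat.SourceEtale) {F G : A ⟶ B}
    (h : (externalisationG C).map F = (externalisationG C).map G) : F = G := by
  have h' : (show RCatOver.Hom ((externalisationG C).obj A) ((externalisationG C).obj B) from
    (externalisationG C).map F) = (externalisationG C).map G := h
  apply ObjectProperty.hom_ext
  refine Cofunctor.ext_push (F := F.hom) (G := G.hom)
    (K := fun i j => A.obj.cat.PartialBisection i j) (sec := fun s => s.1)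
    (hA.exists_atlas_bisections A.property) (funext fun i => ?_) ?_ fun {i j} k => ?_
  · exact congrArg (fun x : RCatOver.Hom ((externalisationG C).obj A)
      ((externalisationG C).obj B) => (x.functor.obj ⟨⟨i⟩⟩).of.idx) h'
  · exact congr_arg_heq (fun x : RCatOver.Hom ((externalisationG C).obj A)
      ((externalisationG C).obj B) => fun i => x.trans.app ⟨⟨i⟩⟩) h'
  · exact congr_arg_heq (fun x : RCatOver.Hom ((externalisationG C).obj A)
      ((externalisationG C).obj B) => (x.functor.map (X := ⟨⟨i⟩⟩) (Y := ⟨⟨j⟩⟩) k).1.val) h'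

/-- Functoriality on all partial sections gives the data of a `SectionRep`. Compatibility with
restrictions holds because `T` acts on idempotents by inverse image along `α`. -/
theorem externalisation_surjective (hA : A.cat.SourceEtale)
    (H : (externalisation C).obj A ⟶ (externalisation C).obj B) :
    ∃ F : Cofunctor A.cat B.cat, (externalisation C).map (X := A) (Y := B) F = H := by
  let T : Ext A.cat ⥤ Ext B.cat := H.functor
  let α : ∀ i : A.comps, B.cat.obj (T.obj ⟨i⟩).idx ⟶ A.cat.obj i := fun i => H.trans.app ⟨i⟩
  let F : CofunctorBase A.cat B.cat := ⟨fun i => (T.obj ⟨i⟩).idx, α, fun i => H.trans_total ⟨i⟩⟩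
  have hT : PreservesRest T := H.functor_rest
  have hidem : ∀ (i : Ext A.cat) (e : A.cat.obj i.idx ⟶ A.cat.obj i.idx) (he : rest e = e),
      T.map (X := i) (Y := i) (idemSection e he) = idemSection (rest (α i.idx ≫ e)) (rest_rest _) :=
    fun i e he => Ext.eq_idemSection
      ((hT _).symm.trans (congrArg T.map (Ext.rest_idemSection e he))) _ _
      ((H.proj_map_idem (x := i) (Ext.rest_idemSection e he)).trans
        (congrArg (fun d => rest (α i.idx ≫ d)) (Ext.proj_idemSection e he)))
  let R : SectionRep F :=
    { K := fun i j => A.cat.PartialSection i j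
      sec := fun s => s
      img := fun {i j} s => T.map (X := ⟨i⟩) (Y := ⟨j⟩) s
      cover := hA.exists_atlas
      img_eq := fun _ _ h => congrArg _ h
      img_tgt := fun {i j} s => (Category.assoc _ _ _).symm.trans
        (H.trans.naturality (X := ⟨i⟩) (Y := ⟨j⟩) s)
      unit := fun i => ⟨𝟙 (⟨i⟩ : Ext A.cat), rfl, congrArg PartialSection.val (T.map_id ⟨i⟩)⟩
      star := fun {i j l} t s => ⟨_, rfl, congrArg PartialSection.val
        (T.map_comp (X := ⟨i⟩) (Y := ⟨j⟩) (Z := ⟨l⟩) s t)⟩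
      restr := fun {i j} s e he => ⟨_, star_idem e he s, by
        have h₁ := T.map_comp (X := ⟨i⟩) (Y := ⟨i⟩) (Z := ⟨j⟩) (idemSection e he) s
        rw [hidem] at h₁
        exact (congrArg PartialSection.val h₁).trans (star_idem _ _ _)⟩ }
  exact ⟨R.cofunctor, RCatOver.Hom.ext' (CategoryTheory.Functor.hext (fun _ => rfl)
    fun _ _ s => heq_of_eq (PartialSection.ext' (R.push_sec s))) fun _ => (Category.id_comp _).symm⟩

/-- Only the action on partial bisections is given. It suffices, since these cover the arrows and
are closed under composition and restriction. -/
theorem externalisationG_surjective {A B : (IsPGpd.{w} C).FullSubcategory}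
    (hA : A.obj.cat.SourceEtale)
    (H : (externalisationG C).obj A ⟶ (externalisationG C).obj B) :
    ∃ F : A ⟶ B, (externalisationG C).map F = H := by
  let T : Bis ((externalisation C).obj A.obj) ⥤ Bis ((externalisation C).obj B.obj) := H.functor
  let α : ∀ i : A.obj.comps, B.obj.cat.obj (T.obj ⟨⟨i⟩⟩).of.idx ⟶ A.obj.cat.obj i :=
    fun i => H.trans.app ⟨⟨i⟩⟩
  let F : CofunctorBase A.obj.cat B.obj.cat :=
    ⟨fun i => (T.obj ⟨⟨i⟩⟩).of.idx, α, fun i => H.trans_total ⟨⟨i⟩⟩⟩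
  have hT : PreservesRest T := H.functor_rest
  let idem : ∀ (i : A.obj.comps) (e : A.obj.cat.obj i ⟶ A.obj.cat.obj i) (_ : rest e = e),
      (⟨⟨i⟩⟩ : Bis ((externalisation C).obj A.obj)) ⟶ ⟨⟨i⟩⟩ :=
    fun i e he => ⟨idemSection e he, by
      have h : ((externalisation C).obj A.obj).proj.map (X := ⟨i⟩) (Y := ⟨i⟩)
        (idemSection e he) = e := Ext.proj_idemSection (i := ⟨i⟩) e he
      rw [h, ← he]; exact PartialIso.rest e⟩
  have hrest : ∀ i e he, rest (idem i e he) = idem i e he := fun i e he =>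
    Subtype.ext (Ext.rest_idemSection (i := ⟨i⟩) e he)
  have hidem : ∀ i e he, (T.map (idem i e he)).1 =
      idemSection (rest (α i ≫ e)) (rest_rest _) := fun i e he =>
    Ext.eq_idemSection (congrArg Subtype.val ((hT _).symm.trans (congrArg T.map (hrest i e he)))) _ _
      ((H.proj_map_idem (x := ⟨⟨i⟩⟩) (hrest i e he)).trans
        (congrArg (fun d => rest (α i ≫ d)) (Ext.proj_idemSection (i := ⟨i⟩) e he)))
  let R : SectionRep F :=
    { K := fun i j => A.obj.cat.PartialBisection i j
      sec := fun s => s.1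
      img := fun {i j} s => (T.map (X := ⟨⟨i⟩⟩) (Y := ⟨⟨j⟩⟩) s).1
      cover := hA.exists_atlas_bisections A.property
      img_eq := fun {i j} _ _ h => congrArg (fun s => (T.map (X := ⟨⟨i⟩⟩) (Y := ⟨⟨j⟩⟩) s).1)
        (Subtype.ext h)
      img_tgt := fun {i j} s => (Category.assoc _ _ _).symm.trans
        (H.trans.naturality (X := ⟨⟨i⟩⟩) (Y := ⟨⟨j⟩⟩) s)
      unit := fun i => ⟨𝟙 (⟨⟨i⟩⟩ : Bis ((externalisation C).obj A.obj)), rfl,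
        congrArg (fun s => s.1.val) (T.map_id ⟨⟨i⟩⟩)⟩
      star := fun {i j l} t s =>
        ⟨(show (⟨⟨i⟩⟩ : Bis ((externalisation C).obj A.obj)) ⟶ ⟨⟨j⟩⟩ from s) ≫
          (show (⟨⟨j⟩⟩ : Bis ((externalisation C).obj A.obj)) ⟶ ⟨⟨l⟩⟩ from t), rfl,
          congrArg (fun s => s.1.val)
            (T.map_comp (X := ⟨⟨i⟩⟩) (Y := ⟨⟨j⟩⟩) (Z := ⟨⟨l⟩⟩) s t)⟩
      restr := fun {i j} s e he =>
        ⟨idem i e he ≫ (show (⟨⟨i⟩⟩ : Bis ((externalisation C).obj A.obj)) ⟶ ⟨⟨j⟩⟩ from s),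
          star_idem e he s.1, by
        have h₁ := congrArg Subtype.val (T.map_comp (X := ⟨⟨i⟩⟩) (Y := ⟨⟨i⟩⟩) (Z := ⟨⟨j⟩⟩)
          (idem i e he) s)
        refine (congrArg PartialSection.val h₁).trans ?_
        refine (congrArg (fun d => star (T.map (X := ⟨⟨i⟩⟩) (Y := ⟨⟨j⟩⟩) s).1 d)
          (hidem i e he)).trans ?_
        exact star_idem _ _ _⟩ }
  exact ⟨ObjectProperty.homMk R.cofunctor, RCatOver.Hom.ext' (CategoryTheory.Functor.hext
    (fun _ => rfl) fun _ _ s => heq_of_eq (Subtype.ext (PartialSection.ext' (R.push_sec s))))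
      fun _ => (Category.id_comp _).symm⟩

end

end

end EtaleCat

/-! ### Restriction categories over `C` as externalisations. -/

namespace EtaleCat

open RestrictionCategory PartiteCat

section

variable {C : Type u} [Category.{v} C] [RestrictionCategory C] [JoinRestriction C]

namespace Glueing

variable [HasLocalGlueings C]

section

variable {Y : RCatOver.{w} C} [BoundedJoins Y.carrier] (D : Glueing Y.proj)

/-- The internal category of a restriction category over `C`. -/
noncomputable def pCat : PCat.{w} C := ⟨Y.carrier, D.cat Y.proj_rest⟩

/-- A restriction category over `C`, as the externalisation of its internal category. -/
noncomputable def isoExt (hc : Hyperconnected Y.proj)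
    (hs : ∀ {x y : Y.carrier} (t : (D.cat Y.proj_rest).PartialSection x y),
      ∃ f : x ⟶ y, D.partialSection Y.proj_rest f = t) :
    Y ≅ (externalisation C).obj D.pCat :=
  have hinj : ∀ {x y : Y.carrier} {f g : x ⟶ y},
      D.partialSection Y.proj_rest f = D.partialSection Y.proj_rest g → f = g :=
    fun h => D.sec_injective hc (congrArg PartialSection.val h)
  have hid : ∀ x : Y.carrier, D.partialSection Y.proj_rest (𝟙 x) = 𝟙 (⟨x⟩ : Ext D.pCat.cat) :=
    fun x => PartialSection.ext' (D.partialSection_id Y.proj_rest x)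
  have hcomp : ∀ {x y z : Y.carrier} (f : x ⟶ y) (g : y ⟶ z),
      D.partialSection Y.proj_rest (f ≫ g) =
        CategoryStruct.comp (obj := Ext D.pCat.cat) (X := ⟨x⟩) (Y := ⟨y⟩) (Z := ⟨z⟩)
          (D.partialSection Y.proj_rest f) (D.partialSection Y.proj_rest g) :=
    fun f g => PartialSection.ext' (D.star_partialSection Y.proj_rest g f).symm
  have hrest : ∀ {x y : Y.carrier} (f : x ⟶ y), D.partialSection Y.proj_rest (rest f) =
      rest (C := Ext D.pCat.cat) (A := ⟨x⟩) (B := ⟨y⟩) (D.partialSection Y.proj_rest f) :=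
    fun f => PartialSection.ext' (D.rest_partialSection Y.proj_rest f).symm
  { hom :=
      { functor :=
          { obj := fun x => ⟨x⟩
            map := fun f => D.partialSection Y.proj_rest f
            map_id := hid
            map_comp := hcomp }
        functor_rest := hrest
        trans :=
          { app := fun x => 𝟙 (Y.proj.obj x)
            naturality := fun _ _ f => (Category.comp_id _).trans
              ((D.partialSection_tgt Y.proj_rest f).trans (Category.id_comp _).symm) }
        trans_total := fun _ => Total.id _ }
    inv :=
      { functor :=
          { obj := fun i => i.idx
            map := fun t => (hs t).choose
            map_id := fun i => hinj ((hs _).choose_spec.trans (hid i.idx).symm)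
            map_comp := fun s t => hinj ((hs _).choose_spec.trans ((hcomp _ _).trans
              (congrArg₂ _ (hs s).choose_spec (hs t).choose_spec)).symm) }
        functor_rest := fun s => hinj ((hs _).choose_spec.trans ((hrest _).trans
          (congrArg _ (hs s).choose_spec)).symm)
        trans :=
          { app := fun i => 𝟙 (Y.proj.obj i.idx)
            naturality := fun _ _ s => by
              have h := (D.partialSection_tgt Y.proj_rest (hs s).choose).symm
              rw [(hs s).choose_spec] at h
              exact (Category.comp_id _).trans (h.trans (Category.id_comp _).symm) }
        trans_total := fun _ => Total.id _ }
    hom_inv_id := RCatOver.Hom.ext'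
      (CategoryTheory.Functor.hext (fun _ => rfl) fun _ _ _ => heq_of_eq (hinj (hs _).choose_spec))
      fun _ => Category.id_comp _
    inv_hom_id := RCatOver.Hom.ext'
      (CategoryTheory.Functor.hext (fun _ => rfl) fun _ _ t => heq_of_eq (hs t).choose_spec)
      fun _ => Category.id_comp _ }

/-- The internal groupoid of an inverse category over `C`. -/
noncomputable def pGpd (hi : ∀ {x y : Y.carrier} (f : x ⟶ y), PartialIso f) :
    (IsPGpd.{w} C).FullSubcategory := ⟨D.pCat, D.cat_isGroupoid Y.proj_rest hi⟩

/-- The partial bisection induced by a map. -/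
noncomputable def bisection (hi : ∀ {x y : Y.carrier} (f : x ⟶ y), PartialIso f) {x y : Y.carrier}
    (f : x ⟶ y) : (⟨⟨x⟩⟩ : Bis ((externalisation C).obj D.pCat)) ⟶ ⟨⟨y⟩⟩ :=
  ⟨D.partialSection Y.proj_rest f, by
    have h : PartialIso (Y.proj.map f) := (hi f).map Y.proj_rest
    rw [← D.partialSection_tgt Y.proj_rest f] at h
    exact h⟩

/-- An inverse category over `C`, as the category of partial bisections of its internal
groupoid. -/
noncomputable def isoExtG (hc : Hyperconnected Y.proj)
    (hi : ∀ {x y : Y.carrier} (f : x ⟶ y), PartialIso f)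
    (hs : ∀ {x y : Y.carrier} (t : (D.cat Y.proj_rest).PartialSection x y),
      PartialIso (t.val ≫ (D.cat Y.proj_rest).tgt x y) →
        ∃ f : x ⟶ y, D.partialSection Y.proj_rest f = t) :
    Y ≅ (externalisationG C).obj (D.pGpd hi) :=
  have hinj : ∀ {x y : Y.carrier} {f g : x ⟶ y}, D.bisection hi f = D.bisection hi g → f = g :=
    fun h => D.sec_injective hc (congrArg (fun s => s.1.val) h)
  have hs' : ∀ {X Z : Bis ((externalisation C).obj D.pCat)} (t : X ⟶ Z),
      ∃ f, D.bisection hi f = t := fun t =>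
    let ⟨f, hf⟩ := hs t.1 t.2
    ⟨f, Subtype.ext hf⟩
  have hid : ∀ x : Y.carrier, D.bisection hi (𝟙 x) =
      𝟙 (⟨⟨x⟩⟩ : Bis ((externalisation C).obj D.pCat)) :=
    fun x => Subtype.ext (PartialSection.ext' (D.partialSection_id Y.proj_rest x))
  have hcomp : ∀ {x y z : Y.carrier} (f : x ⟶ y) (g : y ⟶ z),
      D.bisection hi (f ≫ g) = D.bisection hi f ≫ D.bisection hi g :=
    fun f g => Subtype.ext (PartialSection.ext' (D.star_partialSection Y.proj_rest g f).symm)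
  have hrest : ∀ {x y : Y.carrier} (f : x ⟶ y),
      D.bisection hi (rest f) = rest (D.bisection hi f) :=
    fun f => Subtype.ext (PartialSection.ext' (D.rest_partialSection Y.proj_rest f).symm)
  { hom :=
      { functor :=
          { obj := fun x => ⟨⟨x⟩⟩
            map := fun f => D.bisection hi f
            map_id := hid
            map_comp := hcomp }
        functor_rest := hrest
        trans :=
          { app := fun x => 𝟙 (Y.proj.obj x)
            naturality := fun _ _ f => (Category.comp_id _).trans
              ((D.partialSection_tgt Y.proj_rest f).trans (Category.id_comp _).symm) }
        trans_total := fun _ => Total.id _ }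
    inv :=
      { functor :=
          { obj := fun i => i.of.idx
            map := fun t => (hs' t).choose
            map_id := fun i => hinj ((hs' _).choose_spec.trans (hid i.of.idx).symm)
            map_comp := fun s t => hinj ((hs' _).choose_spec.trans ((hcomp _ _).trans
              (congrArg₂ _ (hs' s).choose_spec (hs' t).choose_spec)).symm) }
        functor_rest := fun s => hinj ((hs' _).choose_spec.trans ((hrest _).trans
          (congrArg _ (hs' s).choose_spec)).symm)
        trans :=
          { app := fun i => 𝟙 (Y.proj.obj i.of.idx)
            naturality := fun _ _ s => (Category.comp_id _).trans
              ((D.partialSection_tgt Y.proj_rest (hs' s).choose).symm.trans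
                ((congrArg (fun s => ((externalisationG C).obj (D.pGpd hi)).proj.map s)
                  (hs' s).choose_spec).trans (Category.id_comp _).symm)) }
        trans_total := fun _ => Total.id _ }
    hom_inv_id := RCatOver.Hom.ext'
      (CategoryTheory.Functor.hext (fun _ => rfl) fun _ _ _ => heq_of_eq (hinj (hs' _).choose_spec))
      fun _ => Category.id_comp _
    inv_hom_id := RCatOver.Hom.ext'
      (CategoryTheory.Functor.hext (fun _ => rfl) fun _ _ t => heq_of_eq (hs' t).choose_spec)
      fun _ => Category.id_comp _ }

end

end Glueing

end

/-! ### Properties of cofunctors read off from the externalisation. -/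

section

variable {C : Type u} [Category.{v} C] [RestrictionCategory C] [JoinRestriction C]

/-- Meets and joins of partial sections are computed in `C`, so both directions are statements about
the covering family of all partial sections. -/
theorem bijArr_iff_overMeet {A B : PCat.{w} C} (hA : A.cat.SourceEtale) (hB : B.cat.SourceEtale)
    (F : A ⟶ B) : bijArr C F ↔ overMeet C ((externalisation C).map F) := by
  let F' : Cofunctor A.cat B.cat := F
  constructor
  · intro h
    refine ⟨fun {i j} f g m hm => ?_, fun {i j} g => ?_⟩
    · have : IsIso (F'.onArr i.idx j.idx) := h i.idx j.idx
      exact Ext.isMeet_iff.2 (F'.isMeet_push (hA _ _) (Ext.isMeet_iff.1 hm))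
    · have : IsIso (F'.onArr i.idx j.idx) := h i.idx j.idx
      obtain ⟨q, a⟩ := hA.exists_atlas i.idx j.idx
      exact ⟨fun _ ⟨_, h⟩ => h.1, fun k hk => Ext.rle_iff.2 ((F'.isJoin_push a g).2 _ (by
        rintro m ⟨f, hm⟩
        exact Ext.rle_iff.1 (hk ⟨m, section_of_rle hm.1⟩ ⟨f, Ext.isMeet_iff.2 hm⟩)))⟩
  · rintro ⟨hm, hj⟩ i j
    obtain ⟨q, a⟩ := hA.exists_atlas i j
    obtain ⟨q', b⟩ := hB.exists_atlas (F'.comp i) (F'.comp j)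
    refine F'.isIso_onArr a b (fun s t => ?_) fun g => ?_
    · obtain ⟨m, h⟩ := exists_isMeet (D := Ext A.cat) (A := ⟨i⟩) (B := ⟨j⟩) s t
      exact ⟨m, Ext.isMeet_iff.1 h, Ext.isMeet_iff.1 (hm _ _ _ h)⟩
    · have h := Ext.isJoin_val (hj (X := ⟨i⟩) (Y := ⟨j⟩) g)
      refine ⟨fun _ ⟨_, h⟩ => h.1, fun k hk => h.2 k ?_⟩
      rintro _ ⟨m, ⟨f, hm⟩, rfl⟩
      exact hk _ ⟨f, Ext.isMeet_iff.1 hm⟩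

theorem bijArr_iff_overMeetG {A B : (IsPGpd.{w} C).FullSubcategory}
    (hA : A.obj.cat.SourceEtale) (hB : B.obj.cat.SourceEtale) (F : A ⟶ B) :
    bijArr C F.hom ↔ overMeet C ((externalisationG C).map F) := by
  let F' : Cofunctor A.obj.cat B.obj.cat := F.hom
  have hJ := (hcon_externalisation B.obj).1
  constructor
  · intro h
    refine ⟨fun {i j} f g m hm => ?_, fun {i j} g => ?_⟩
    · have : IsIso (F'.onArr i.of.idx j.of.idx) := h _ _
      exact Bis.isMeet_iff.2 (Ext.isMeet_iff.2 (F'.isMeet_push (hA _ _)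
        (Ext.isMeet_iff.1 (Bis.isMeet_iff.1 hm))))
    · have : IsIso (F'.onArr i.of.idx j.of.idx) := h _ _
      obtain ⟨q, a⟩ := hA.exists_atlas_bisections A.property i.of.idx j.of.idx
      exact ⟨fun _ ⟨_, h⟩ => h.1, fun k hk => Bis.rle_iff.2 (Ext.rle_iff.2
        ((F'.isJoin_push a g.1).2 _ (by
          rintro m ⟨f, hm⟩
          have hle : RLe (C := Ext B.obj.cat) (A := ⟨F'.comp i.of.idx⟩) (B := ⟨F'.comp j.of.idx⟩)
            (PartialSection.mk m (section_of_rle hm.1)) g.1 := Ext.rle_iff.2 hm.1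
          exact Ext.rle_iff.1 (Bis.rle_iff.1 (hk ⟨_, RCatOver.partialIso_of_rle hle g.2⟩
            ⟨f, Bis.isMeet_iff.2 (Ext.isMeet_iff.2 hm)⟩)))))⟩
  · rintro ⟨hm, hj⟩ i j
    obtain ⟨q, a⟩ := hA.exists_atlas_bisections A.property i j
    obtain ⟨q', b⟩ := hB.exists_atlas_bisections B.property (F'.comp i) (F'.comp j)
    refine F'.isIso_onArr a b (fun s t => ?_) fun g => ?_
    · have : JoinInverse (Bis ((externalisation C).obj A.obj)) := (jihcon_externalisationG A).1
      have := BoundedJoins.of_joinInverse (Bis ((externalisation C).obj A.obj))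
      obtain ⟨m, h⟩ := exists_isMeet (D := Bis ((externalisation C).obj A.obj)) (A := ⟨⟨i⟩⟩)
        (B := ⟨⟨j⟩⟩) s t
      exact ⟨m.1, Ext.isMeet_iff.1 (Bis.isMeet_iff.1 h),
        Ext.isMeet_iff.1 (Bis.isMeet_iff.1 (hm _ _ _ h))⟩
    · have h := Ext.isJoin_val (Bis.isJoin_val (hj (X := ⟨⟨i⟩⟩) (Y := ⟨⟨j⟩⟩) g))
      refine ⟨fun _ ⟨_, h⟩ => h.1, fun k hk => h.2 k ?_⟩
      rintro _ ⟨_, ⟨m, ⟨f, hm⟩, rfl⟩, rfl⟩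
      exact hk _ ⟨f, Ext.isMeet_iff.1 (Bis.isMeet_iff.1 hm)⟩

omit [JoinRestriction C] in
theorem bijComp_iff_overBijObj {A B : PCat.{w} C} (F : A ⟶ B) :
    bijComp C F ↔ overBijObj C ((externalisation C).map F) :=
  ⟨fun h => ⟨fun _ _ e => congrArg Ext.mk (h.1 (congrArg Ext.idx e)), fun Y =>
      let ⟨i, hi⟩ := h.2 Y.idx
      ⟨⟨i⟩, congrArg Ext.mk hi⟩⟩,
    fun h => ⟨fun _ _ e => congrArg Ext.idx (h.1 (a₁ := ⟨_⟩) (a₂ := ⟨_⟩) (congrArg Ext.mk e)),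
      fun j =>
        let ⟨i, hi⟩ := h.2 ⟨j⟩
        ⟨i.idx, congrArg Ext.idx hi⟩⟩⟩

omit [JoinRestriction C] in
theorem bijComp_iff_overBijObjG {A B : (IsPGpd.{w} C).FullSubcategory} (F : A ⟶ B) :
    bijComp C F.hom ↔ overBijObj C ((externalisationG C).map F) :=
  (bijComp_iff_overBijObj F.hom).trans
    ⟨fun h => ⟨fun _ _ e => congrArg Bis.mk (h.1 (congrArg Bis.of e)), fun Y =>
      let ⟨i, hi⟩ := h.2 Y.of
      ⟨⟨i⟩, congrArg Bis.mk hi⟩⟩,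
    fun h => ⟨fun _ _ e => congrArg Bis.of (h.1 (a₁ := ⟨_⟩) (a₂ := ⟨_⟩) (congrArg Bis.mk e)),
      fun j =>
        let ⟨i, hi⟩ := h.2 ⟨j⟩
        ⟨i.of, congrArg Bis.of hi⟩⟩⟩

omit [JoinRestriction C] in
theorem bijObj_iff_overIso {A B : PCat.{w} C} (F : A ⟶ B) :
    bijObj C F ↔ overIso C ((externalisation C).map F) :=
  ⟨fun h X => h X.idx, fun h i => h ⟨i⟩⟩

theorem bijCA_iff_localic {A B : PCat.{w} C} (hA : A.cat.SourceEtale) (hB : B.cat.SourceEtale)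
    (F : A ⟶ B) : bijCA C F ↔ localic C ((externalisation C).map F) :=
  (and_congr (bijComp_iff_overBijObj F) (bijArr_iff_overMeet hA hB F)).trans
    (localic_iff hcon_le (hcon_externalisation A) (hcon_externalisation B) _).symm

/-- Preservation of joins is automatic over `C`, so only bijectivity on objects and the meet
condition have to be matched. -/
theorem bijCA_iff_localicG {A B : (IsPGpd.{w} C).FullSubcategory}
    (hA : A.obj.cat.SourceEtale) (hB : B.obj.cat.SourceEtale) (F : A ⟶ B) :
    bijCA C F.hom ↔ localic C ((externalisationG C).map F) :=
  (and_congr (bijComp_iff_overBijObjG F) (bijArr_iff_overMeetG hA hB F)).trans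
    (localic_iff jihcon_le (jihcon_externalisationG A) (jihcon_externalisationG B) _).symm

end

/-! ### General criteria for equivalences. -/

section

variable {D : Type w₁} [Category.{w₂} D] {E : Type w₃} [Category.{w'} E]

theorem isEquivalence_lift {T : D ⥤ E} {P : ObjectProperty E} (hP : ∀ X, P (T.obj X))
    (hf : ∀ {X Y : D} {f g : X ⟶ Y}, T.map f = T.map g → f = g)
    (hs : ∀ {X Y : D} (g : T.obj X ⟶ T.obj Y), ∃ f, T.map f = g)
    (he : ∀ Y, P Y → ∃ X, Nonempty (T.obj X ≅ Y)) : (P.lift T hP).IsEquivalence where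
  faithful := ⟨fun h => hf (congrArg (fun k => k.hom) h)⟩
  full := ⟨fun g =>
    let ⟨f, hf⟩ := hs g.hom
    ⟨f, ObjectProperty.hom_ext _ hf⟩⟩
  essSurj := ⟨fun Y =>
    let ⟨X, ⟨e⟩⟩ := he Y.obj Y.property
    ⟨X, ⟨P.isoMk e⟩⟩⟩

/-- The unit of any left adjoint of an equivalence is invertible, so `g` is isomorphic as an arrow
to the image of `Ψ.map g`. -/
theorem matches_of_isEquivalence {T : D ⥤ E} {P : ObjectProperty E} {W : MorphismProperty D}
    {V : MorphismProperty E} {hP : ∀ X, P (T.obj X)} (h : (P.lift T hP).IsEquivalence)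
    (hW : ∀ {X Y : D} (f : X ⟶ Y), W f ↔ V (T.map f)) (hV : (V.inverseImage P.ι).RespectsIso) :
    Matches T P W V := by
  refine ⟨hP, hW, ?_⟩
  rintro Ψ ⟨adj⟩ X Y g
  rw [hW]
  have hn := adj.unit.naturality g
  exact (MorphismProperty.arrow_mk_iso_iff (V.inverseImage P.ι)
    (Arrow.isoMk (asIso (adj.unit.app X)) (asIso (adj.unit.app Y)) hn.symm)).symm

/-- The composite of a faithful functor `K`, surjective on objects and full onto the maps sent to
`V` by an equivalence `T` onto `P`, with `T`. -/
theorem isEquivOntoWide_comp {D' : Type w} [Category.{v} D'] {K : D' ⥤ D} {T : D ⥤ E}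
    {P : ObjectProperty E} {V : MorphismProperty E} {hP : ∀ X, P (T.obj X)}
    (h : (P.lift T hP).IsEquivalence) (hm : (V.inverseImage P.ι).IsMultiplicative)
    (hi : ∀ {A B : E} (_ : P A) (_ : P B) (e : A ≅ B), V e.hom)
    (hK : ∀ {X Y : D'} {f g : X ⟶ Y}, K.map f = K.map g → f = g)
    (hV : ∀ {X Y : D'} (f : X ⟶ Y), V (T.map (K.map f)))
    (hs : ∀ {X Y : D'} (g : K.obj X ⟶ K.obj Y), V (T.map g) → ∃ f, K.map f = g)
    (ho : ∀ Y, ∃ X, K.obj X = Y) : IsEquivOntoWide (K ⋙ T) P V := by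
  refine ⟨fun X => hP _, hm, hV, ?_⟩
  refine @Functor.IsEquivalence.mk _ _ _ _ _ ⟨fun {X Y f g} e => hK ?_⟩ ⟨fun {X Y} g => ?_⟩
    ⟨fun Y => ?_⟩
  · exact (P.lift T hP).map_injective (congrArg (fun k => k.1) e)
  · obtain ⟨k, hk⟩ := (P.lift T hP).map_surjective g.1
    obtain ⟨f, rfl⟩ := hs k (by
      have : V g.1.hom := g.2
      rw [← hk] at this
      exact this)
    exact ⟨f, by ext; exact congrArg (fun k => k.hom) hk⟩
  · obtain ⟨X, hX⟩ := ho ((P.lift T hP).objPreimage Y.obj)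
    -- An isomorphism of the wide subcategory needs both directions in `V`; `hi` provides this.
    let e := eqToIso (congrArg (P.lift T hP).obj hX) ≪≫ (P.lift T hP).objObjPreimageIso Y.obj
    exact ⟨X, ⟨WideSubcategory.isoMk e
      (hi (hP _) Y.obj.property (P.ι.mapIso e)) (hi Y.obj.property (hP _) (P.ι.mapIso e.symm))⟩⟩

end

end EtaleCat

/-! ### Covering functors and cofunctors bijective on components and arrows. -/

namespace EtaleCat

open RestrictionCategory PartiteCat

section

variable {C : Type u} [Category.{v} C] [RestrictionCategory C]
variable {I : Type w₁} {J : Type w₂} {A : PartiteCat I C} {B : PartiteCat J C}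

namespace Corresponds

variable {G : PartiteFunctor B A} {F : Cofunctor A B}

theorem onArr_arr' (h : Corresponds G F) (i j : I) :
    F.onArr i j ≫ G.arr' (h.choose i) (h.choose j) = F.fibFst i j :=
  (congrArg (· ≫ _) (F.act_self (F.fib_condition i j)).symm).trans
    (h.choose_spec.2 i j _ _ (F.fib_condition i j))

/-- The inverse of `F_ij` is the comparison map from `B_ij` to the fibre product, given by `G` and
the source map. -/
theorem isIso_onArr (h : Corresponds G F) (hG : G.IsCovering) (i j : I) :
    IsIso (F.onArr i j) := by
  refine ⟨F.fibLift (G.arr' (h.choose i) (h.choose j)) (B.src _ _) ?_, ?_, ?_⟩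
  · rw [G.arr'_src, h.choose_spec.1]
  · apply F.fib_hom_ext
    · rw [Category.assoc, F.fibLift_fst, h.onArr_arr', Category.id_comp]
    · rw [Category.assoc, F.fibLift_snd, F.onArr_src, Category.id_comp]
  · refine (hG.arr' (h.choose i) (h.choose j)).hom_ext ?_ ?_
    · rw [Category.assoc, h.onArr_arr', F.fibLift_fst, Category.id_comp]
    · rw [Category.assoc, F.onArr_src, F.fibLift_snd, Category.id_comp]

theorem bijective_comp (h : Corresponds G F) (hG : G.IsCovering) : Function.Bijective F.comp :=
  Function.bijective_iff_has_inverse.2 ⟨G.comp, h.choose, fun j =>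
    hG.bijective.1 (h.choose (G.comp j))⟩

/-- Every component of `B` is of the form `F.comp i`, and there `F` fixes the object map. The arrow
map is fixed because `F_ij` is invertible and its composite with the arrow map is the projection. -/
theorem functor_unique {G' : PartiteFunctor B A} (h : Corresponds G F) (h' : Corresponds G' F)
    (hF : Function.Surjective F.comp) (hi : ∀ i j, IsIso (F.onArr i j)) : G = G' := by
  have hc : G.comp = G'.comp := funext fun j => by
    obtain ⟨i, rfl⟩ := hF j
    exact (h.choose i).trans (h'.choose i).symm
  refine PartiteFunctor.ext' hc (fun j => ?_) fun j k => ?_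
  · obtain ⟨i, rfl⟩ := hF j
    have e := (h.choose_spec.1 i).symm.trans (h'.choose_spec.1 i)
    rw [← cancel_mono (eqToHom (congrArg A.obj (h'.choose i))), Category.assoc, eqToHom_trans]
    exact e
  · obtain ⟨i, rfl⟩ := hF j
    obtain ⟨l, rfl⟩ := hF k
    have e := (h.onArr_arr' i l).trans (h'.onArr_arr' i l).symm
    rw [cancel_epi] at e
    rw [← cancel_mono (eqToHom (congrArg₂ A.arr (h'.choose i) (h'.choose l))), Category.assoc,
      eqToHom_trans]
    exact e

end Corresponds

namespace Cofunctor

variable (F : Cofunctor A B)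

/-- The component of `F` on objects, at `i ↦ j`. -/
def obj' {i : I} {j : J} (h : F.comp i = j) : B.obj j ⟶ A.obj i :=
  eqToHom (congrArg B.obj h).symm ≫ F.onObj i

theorem obj'_rfl (i : I) : F.obj' (rfl : F.comp i = F.comp i) = F.onObj i := Category.id_comp _

theorem obj'_total {i : I} {j : J} (h : F.comp i = j) : Total (F.obj' h) := by
  subst h; rw [obj'_rfl]; exact F.onObj_total i

theorem obj'_eqToHom {i i' : I} {j : J} (h : F.comp i = j) (h' : F.comp i' = j) (e : i = i') :
    F.obj' h ≫ eqToHom (congrArg A.obj e) = F.obj' h' := by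
  subst e; exact Category.comp_id _

variable [hF : ∀ i j, IsIso (F.onArr i j)]

/-- The inverse of the action of `F` on arrows, at `i ↦ j` and `i' ↦ j'`. -/
noncomputable def arr' {i i' : I} {j j' : J} (h : F.comp i = j) (h' : F.comp i' = j') :
    B.arr j j' ⟶ A.arr i i' :=
  eqToHom (congrArg₂ B.arr h h').symm ≫ inv (F.onArr i i') ≫ F.fibFst i i'

theorem arr'_rfl (i i' : I) : F.arr' (rfl : F.comp i = F.comp i) (rfl : F.comp i' = F.comp i') =
    inv (F.onArr i i') ≫ F.fibFst i i' := Category.id_comp _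

theorem arr'_eqToHom {i i' k k' : I} {j j' : J} (h : F.comp i = j) (h' : F.comp i' = j')
    (l : F.comp k = j) (l' : F.comp k' = j') (e : i = k) (e' : i' = k') :
    F.arr' h h' ≫ eqToHom (congrArg₂ A.arr e e') = F.arr' l l' := by
  subst e e'; exact Category.comp_id _

theorem act_arr' {T : C} {i j : I} (a : T ⟶ A.arr i j) (b : T ⟶ B.obj (F.comp i))
    (h : a ≫ A.src i j = b ≫ F.onObj i) : F.act a b h ≫ F.arr' rfl rfl = a := by
  rw [arr'_rfl, PreCofunctor.act, Category.assoc, IsIso.hom_inv_id_assoc, F.fibLift_fst]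

theorem arr'_src {i i' : I} {j j' : J} (h : F.comp i = j) (h' : F.comp i' = j') :
    F.arr' h h' ≫ A.src i i' = B.src j j' ≫ F.obj' h := by
  subst h h'
  rw [arr'_rfl, obj'_rfl, Category.assoc, F.fib_condition, IsIso.inv_comp_eq, ← Category.assoc,
    F.onArr_src]

theorem arr'_tgt {i i' : I} {j j' : J} (h : F.comp i = j) (h' : F.comp i' = j') :
    F.arr' h h' ≫ A.tgt i i' = B.tgt j j' ≫ F.obj' h' := by
  subst h h'
  rw [arr'_rfl, obj'_rfl, Category.assoc, IsIso.inv_comp_eq, F.onArr_tgt]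

/-- An arrow of `B` is recovered from its image in `A` together with its source, because the
comparison map is the inverse of `F_ij`. -/
theorem act_arr'_src {T : C} {i i' : I} (x : T ⟶ B.arr (F.comp i) (F.comp i')) (h) :
    F.act (x ≫ F.arr' rfl rfl) (x ≫ B.src _ _) h = x := by
  have : F.fibLift (x ≫ F.arr' rfl rfl) (x ≫ B.src _ _) h = x ≫ inv (F.onArr i i') := by
    apply F.fib_hom_ext
    · rw [F.fibLift_fst, arr'_rfl, Category.assoc]
    · rw [F.fibLift_snd, Category.assoc, ← F.onArr_src, IsIso.inv_hom_id_assoc]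
  rw [PreCofunctor.act, this, Category.assoc, IsIso.inv_hom_id, Category.comp_id]

theorem arr'_ident {i : I} {j : J} (h : F.comp i = j) :
    B.ident j ≫ F.arr' h h = F.obj' h ≫ A.ident i := by
  subst h
  rw [← F.act_ident, act_arr', obj'_rfl]

/-- The composition law of the cofunctor is applied to the images of `c` and `a` in `A`. Acting with
these images returns `c` and `a`, so the law becomes preservation of composition by the inverse. -/
theorem arr'_mu {T : C} {i i' i'' : I} {j j' j'' : J} (hi : F.comp i = j) (hi' : F.comp i' = j')
    (hi'' : F.comp i'' = j'') (c : T ⟶ B.arr j' j'') (a : T ⟶ B.arr j j')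
    (h : c ≫ B.src j' j'' = a ≫ B.tgt j j') (h') :
    B.mu c a h ≫ F.arr' hi hi'' = A.mu (c ≫ F.arr' hi' hi'') (a ≫ F.arr' hi hi') h' := by
  subst hi hi' hi''
  have ha : (a ≫ F.arr' rfl rfl) ≫ A.src i i' = (a ≫ B.src _ _) ≫ F.onObj i := by
    rw [Category.assoc, arr'_src, obj'_rfl, Category.assoc]
  have e₁ := F.act_arr'_src a ha
  have hc : (c ≫ F.arr' rfl rfl) ≫ A.src i' i'' = (c ≫ B.src _ _) ≫ F.onObj i' := by
    rw [Category.assoc, arr'_src, obj'_rfl, Category.assoc]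
  have e₂ := F.act_mu _ _ _ h' ha
  rw [← F.act_arr' _ _ ((A.mu_src _ _ h').trans ha)]
  refine congrArg (· ≫ F.arr' rfl rfl) (Eq.symm (e₂.trans (B.mu_congr _ ?_ e₁)))
  exact (F.act_congr _ rfl ((congrArg (· ≫ B.tgt _ _) e₁).trans h.symm)).trans
    (F.act_arr'_src c hc)

/-- Up to the isomorphism `F_ij` the square is the one defining the fibre product. -/
theorem arr'_isPullback {i i' : I} {j j' : J} (h : F.comp i = j) (h' : F.comp i' = j') :
    IsPullback (F.arr' h h') (B.src j j') (A.src i i') (F.obj' h) := by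
  subst h h'
  rw [arr'_rfl, obj'_rfl]
  refine (F.isPullback i i').of_iso (asIso (F.onArr i i')) (Iso.refl _) (Iso.refl _) (Iso.refl _)
    ?_ ?_ ?_ ?_
  · rw [asIso_hom, IsIso.hom_inv_id_assoc, Iso.refl_hom, Category.comp_id]
  · rw [asIso_hom, F.onArr_src, Iso.refl_hom, Category.comp_id]
  · simp
  · simp

variable {k : J → I} (hk : ∀ j, F.comp (k j) = j)

/-- The functor corresponding to a cofunctor bijective on arrows. -/
noncomputable def partiteFunctor : PartiteFunctor B A where
  comp := k
  onObj j := F.obj' (hk j)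
  onObj_total j := F.obj'_total (hk j)
  onArr j j' := F.arr' (hk j) (hk j')
  onArr_src j j' := F.arr'_src (hk j) (hk j')
  onArr_tgt j j' := F.arr'_tgt (hk j) (hk j')
  ident j := F.arr'_ident (hk j)
  mul i j l := (congrArg (· ≫ F.arr' (hk i) (hk l)) (by
    rw [PrePartiteCat.mu]
    refine (Category.id_comp _).symm.trans (congrArg (· ≫ B.mul i j l) ?_)
    apply B.fib_hom_ext <;> simp)).trans
      (F.arr'_mu (hk i) (hk j) (hk l) _ _ (B.fib_condition i j l) _)

theorem partiteFunctor_isCovering (hb : Function.Bijective k) :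
    (F.partiteFunctor hk).IsCovering :=
  ⟨hb, fun j j' => F.arr'_isPullback (hk j) (hk j')⟩

theorem corresponds_partiteFunctor (hk' : ∀ i, k (F.comp i) = i) :
    Corresponds (F.partiteFunctor hk) F := by
  refine ⟨hk', fun i => ?_, fun i j a b h => ?_⟩
  · exact (F.obj'_rfl i).symm.trans (F.obj'_eqToHom (hk (F.comp i)) rfl (hk' i)).symm
  · exact (congrArg (F.act a b h ≫ ·) (F.arr'_eqToHom (hk (F.comp i)) (hk (F.comp j)) rfl rfl
      (hk' i) (hk' j))).trans (F.act_arr' a b h)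

end Cofunctor

theorem exists_corresponds {F : Cofunctor A B} (hc : Function.Bijective F.comp)
    (ha : ∀ i j, IsIso (F.onArr i j)) : ∃ G : PartiteFunctor B A, G.IsCovering ∧ Corresponds G F := by
  obtain ⟨k, hk, hk'⟩ := Function.bijective_iff_has_inverse.1 hc
  exact ⟨F.partiteFunctor hk', F.partiteFunctor_isCovering hk'
    (Function.bijective_iff_has_inverse.2 ⟨F.comp, hk', hk⟩), F.corresponds_partiteFunctor hk' hk⟩

theorem bijCA_of_corresponds {A B : PCat.{w} C} {G : PartiteFunctor B.cat A.cat}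
    (hG : G.IsCovering) {F : A ⟶ B} (h : Corresponds G F) : bijCA C F :=
  ⟨h.bijective_comp hG, h.isIso_onArr hG⟩

/-- Closure under composition is transferred from covering functors, where it is the pasting of
pullback squares. -/
instance : (bijCA.{w} C).IsMultiplicative where
  id_mem A := bijCA_of_corresponds (PartiteFunctor.IsCovering.id A.cat) (Corresponds.id A.cat)
  comp_mem f g hf hg := by
    obtain ⟨G, hG, h⟩ := exists_corresponds hf.1 hf.2
    obtain ⟨G', hG', h'⟩ := exists_corresponds hg.1 hg.2
    exact bijCA_of_corresponds (hG'.comp hG) (h'.comp h)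

theorem bijCA_coveringToCofunctor {A B : (PCov.{w} C)ᵒᵖ} (G : A ⟶ B) :
    bijCA C ((coveringToCofunctor C).map G) :=
  bijCA_of_corresponds G.unop.2 G.unop.2.corresponds

theorem coveringToCofunctor_injective {A B : (PCov.{w} C)ᵒᵖ} {G G' : A ⟶ B}
    (h : (coveringToCofunctor C).map G = (coveringToCofunctor C).map G') : G = G' := by
  have h₁ : Corresponds G.unop.1 ((coveringToCofunctor C).map G) := G.unop.2.corresponds
  have h₂ : Corresponds G'.unop.1 ((coveringToCofunctor C).map G) := by
    rw [h]; exact G'.unop.2.corresponds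
  have hF := bijCA_coveringToCofunctor G
  exact Quiver.Hom.unop_inj (Subtype.ext (h₁.functor_unique h₂ hF.1.2 hF.2))

theorem coveringToCofunctor_surjective {A B : (PCov.{w} C)ᵒᵖ}
    (F : (coveringToCofunctor C).obj A ⟶ (coveringToCofunctor C).obj B) (h : bijCA C F) :
    ∃ G : A ⟶ B, (coveringToCofunctor C).map G = F := by
  obtain ⟨G, hG, hGF⟩ := exists_corresponds h.1 h.2
  exact ⟨Quiver.Hom.op ⟨G, hG⟩, Corresponds.unique hG hG.corresponds hGF⟩

theorem isIsoOntoWide_coveringToCofunctor : IsIsoOntoWide (coveringToCofunctor.{w} C) (bijCA C) :=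
  ⟨inferInstance, bijCA_coveringToCofunctor,
    { faithful := ⟨fun h => coveringToCofunctor_injective (congrArg (fun k => k.1) h)⟩
      full := ⟨fun g =>
        let ⟨f, hf⟩ := coveringToCofunctor_surjective g.1 g.2
        ⟨f, by ext; exact hf⟩⟩
      bijective_obj := Function.bijective_iff_has_inverse.2
        ⟨fun X => op ⟨X.obj⟩, fun _ => rfl, fun _ => rfl⟩ }⟩

end

end EtaleCat

/-! ### The equivalences for étale partite categories and groupoids. -/

namespace EtaleCat

open RestrictionCategory PartiteCat

section

variable {C : Type u} [Category.{v} C] [RestrictionCategory C]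

section

variable {P : ObjectProperty (PCat.{w} C)}

theorem coveringToCofunctorOf_injective {X Y : (covOf P).FullSubcategoryᵒᵖ} {f g : X ⟶ Y}
    (h : (coveringToCofunctorOf P).map f = (coveringToCofunctorOf P).map g) : f = g :=
  Quiver.Hom.unop_inj (ObjectProperty.hom_ext _ (Quiver.Hom.op_inj
    (coveringToCofunctor_injective (congrArg (fun k => k.hom) h))))

theorem coveringToCofunctorOf_surjective {X Y : (covOf P).FullSubcategoryᵒᵖ}
    (g : (coveringToCofunctorOf P).obj X ⟶ (coveringToCofunctorOf P).obj Y) (h : bijCA C g.hom) :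
    ∃ f, (coveringToCofunctorOf P).map f = g := by
  obtain ⟨f, hf⟩ := coveringToCofunctor_surjective (A := op X.unop.obj) (B := op Y.unop.obj) g.hom h
  exact ⟨(ObjectProperty.homMk f.unop).op, ObjectProperty.hom_ext _ hf⟩

end

variable [JoinRestriction C]

theorem hcon_etaleExt (X : (IsEtale.{w} C).FullSubcategory) : hcon C ((etaleExt C).obj X) :=
  hcon_externalisation X.obj

theorem jihcon_etaleExtG (X : (IsEtaleGpd.{w} C).FullSubcategory) :
    jihcon C ((etaleExtG C).obj X) :=
  jihcon_externalisationG _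

omit [JoinRestriction C] in
theorem overBijObj_respectsIso (P : ObjectProperty (RCatOver.{w} C)) :
    ((overBijObj C).inverseImage P.ι).RespectsIso :=
  respectsIso_inverseImage inferInstance fun _ _ e => overBijObj_iso e

omit [JoinRestriction C] in
theorem overIso_respectsIso (P : ObjectProperty (RCatOver.{w} C)) :
    ((overIso C).inverseImage P.ι).RespectsIso :=
  respectsIso_inverseImage inferInstance fun _ _ e => overIso_iso e

theorem overMeet_respectsIso {P : ObjectProperty (RCatOver.{w} C)} (hP : P ≤ bhcon C) :
    ((overMeet C).inverseImage P.ι).RespectsIso :=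
  respectsIso_inverseImage (isMultiplicative_overMeet hP) fun _ _ e => overMeet_iso e

theorem localic_respectsIso {P : ObjectProperty (RCatOver.{w} C)} (hP : P ≤ bhcon C) :
    ((localic C).inverseImage P.ι).RespectsIso :=
  respectsIso_inverseImage (isMultiplicative_localic hP) fun hA hB e => localic_iso hP hA hB e

variable [HasLocalGlueings C]

theorem isEquivalence_etaleExt : ((hcon.{w} C).lift (etaleExt C) hcon_etaleExt).IsEquivalence := by
  refine isEquivalence_lift _ (fun {X Y f g} h => ?_) (fun {X Y} H => ?_) fun Y hY => ?_
  · exact ObjectProperty.hom_ext _ (externalisation_injective X.property h)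
  · obtain ⟨F, hF⟩ := externalisation_surjective X.property H
    exact ⟨ObjectProperty.homMk F, hF⟩
  · have := hY.1
    obtain ⟨D⟩ := exists_glueing Y.proj_rest
    exact ⟨⟨D.pCat, D.cat_sourceEtale Y.proj_rest⟩,
      ⟨(D.isoExt hY.2 (D.exists_eq Y.proj_rest hY.2)).symm⟩⟩

theorem isEquivalence_etaleExtG :
    ((jihcon.{w} C).lift (etaleExtG C) jihcon_etaleExtG).IsEquivalence := by
  refine isEquivalence_lift _ (fun {X Y f g} h => ?_) (fun {X Y} H => ?_) fun Y hY => ?_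
  · have := externalisationG_injective (A := ⟨X.obj, X.property.2⟩) (B := ⟨Y.obj, Y.property.2⟩)
      X.property.1 (F := ObjectProperty.homMk f.hom) (G := ObjectProperty.homMk g.hom) h
    exact ObjectProperty.hom_ext _ (congrArg (fun k => k.hom) this)
  · obtain ⟨F, hF⟩ := externalisationG_surjective (A := ⟨X.obj, X.property.2⟩)
      (B := ⟨Y.obj, Y.property.2⟩) X.property.1 H
    exact ⟨ObjectProperty.homMk F.hom, hF⟩
  · have := hY.1
    have := BoundedJoins.of_joinInverse Y.carrier
    obtain ⟨D⟩ := exists_glueing Y.proj_rest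
    exact ⟨⟨D.pCat, D.cat_sourceEtale Y.proj_rest,
      (D.pGpd fun f => JoinInverse.partialIso f).property⟩,
      ⟨(D.isoExtG hY.2 (fun f => JoinInverse.partialIso f)
        (D.exists_eq_of_partialIso Y.proj_rest hY.2)).symm⟩⟩

theorem isEquivOntoWide_etaleExt :
    IsEquivOntoWide (coveringToCofunctorOf (IsEtale.{w} C) ⋙ etaleExt C) (hcon C) (localic C) :=
  isEquivOntoWide_comp isEquivalence_etaleExt (isMultiplicative_localic hcon_le)
    (fun hA hB e => localic_iso hcon_le hA hB e) coveringToCofunctorOf_injective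
    (fun {X Y} _ => (bijCA_iff_localic X.unop.property Y.unop.property _).1
      (bijCA_coveringToCofunctor _))
    (fun {X Y} g h => coveringToCofunctorOf_surjective g
      ((bijCA_iff_localic X.unop.property Y.unop.property _).2 h))
    fun Y => ⟨op ⟨⟨Y.obj⟩, Y.property⟩, rfl⟩

omit [HasLocalGlueings C] in
theorem bijCA_iff_localic_etaleExtG {X Y : (IsEtaleGpd.{w} C).FullSubcategory} (F : X ⟶ Y) :
    bijCA C F.hom ↔ localic C ((etaleExtG C).map F) :=
  bijCA_iff_localicG (A := ⟨X.obj, X.property.2⟩) (B := ⟨Y.obj, Y.property.2⟩)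
    X.property.1 Y.property.1 (ObjectProperty.homMk F.hom)

theorem isEquivOntoWide_etaleExtG :
    IsEquivOntoWide (coveringToCofunctorOf (IsEtaleGpd.{w} C) ⋙ etaleExtG C) (jihcon C)
      (localic C) :=
  isEquivOntoWide_comp isEquivalence_etaleExtG (isMultiplicative_localic jihcon_le)
    (fun hA hB e => localic_iso jihcon_le hA hB e) coveringToCofunctorOf_injective
    (fun f => (bijCA_iff_localic_etaleExtG _).1 (bijCA_coveringToCofunctor f.unop.hom.op))
    (fun g h => coveringToCofunctorOf_surjective g ((bijCA_iff_localic_etaleExtG g).2 h))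
    fun Y => ⟨op ⟨⟨Y.obj⟩, Y.property⟩, rfl⟩

theorem isEquivOnto_etaleExt :
    IsEquivOnto (etaleExt.{w} C) (hcon C) ∧
      Matches (etaleExt.{w} C) (hcon C) ((bijComp C).inverseImage (IsEtale C).ι) (overBijObj C) ∧
      Matches (etaleExt.{w} C) (hcon C) ((bijObj C).inverseImage (IsEtale C).ι) (overIso C) ∧
      Matches (etaleExt.{w} C) (hcon C) ((bijArr C).inverseImage (IsEtale C).ι) (overMeet C) ∧
      Matches (etaleExt.{w} C) (hcon C) ((bijCA C).inverseImage (IsEtale C).ι) (localic C) :=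
  ⟨⟨_, isEquivalence_etaleExt⟩,
    matches_of_isEquivalence isEquivalence_etaleExt (fun f => bijComp_iff_overBijObj f.hom)
      (overBijObj_respectsIso _),
    matches_of_isEquivalence isEquivalence_etaleExt (fun f => bijObj_iff_overIso f.hom)
      (overIso_respectsIso _),
    matches_of_isEquivalence isEquivalence_etaleExt
      (fun {X Y} f => bijArr_iff_overMeet X.property Y.property f.hom)
      (overMeet_respectsIso hcon_le),
    matches_of_isEquivalence isEquivalence_etaleExt
      (fun {X Y} f => bijCA_iff_localic X.property Y.property f.hom)
      (localic_respectsIso hcon_le)⟩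

theorem isEquivOnto_etaleExtG :
    IsEquivOnto (etaleExtG.{w} C) (jihcon C) ∧
      Matches (etaleExtG.{w} C) (jihcon C) ((bijCA C).inverseImage (IsEtaleGpd C).ι) (localic C) :=
  ⟨⟨_, isEquivalence_etaleExtG⟩,
    matches_of_isEquivalence isEquivalence_etaleExtG (fun f => bijCA_iff_localic_etaleExtG f)
      (localic_respectsIso jihcon_le)⟩

end

end EtaleCat

/-! ### Inverse monoids as one-object inverse categories. -/

namespace EtaleCat

open RestrictionCategory PartiteCat

section

variable {D : Type w₁} [Category.{v} D] [RestrictionCategory D]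
variable {E : Type w₂} [Category.{v} E] [RestrictionCategory E]

/-- In an inverse monoid, and likewise among partial automorphisms, the restriction idempotents are
therefore all the idempotents. This makes the condition on `θ` the same as hyperconnectedness. -/
theorem PartialIso.rest_eq_self {x : D} {e : x ⟶ x} (he : e ≫ e = e) (h : PartialIso e) :
    RestrictionCategory.rest e = e := by
  obtain ⟨f, hf⟩ := h
  calc RestrictionCategory.rest e = (e ≫ e) ≫ f := by rw [he, hf.1]
    _ = RestrictionCategory.rest (e ≫ e) ≫ e := by rw [Category.assoc, hf.1, comp_rest]
    _ = e := by rw [he, rest_comp]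

/-- Among partial isomorphisms the generalised inverses of semigroup theory are partial inverses: `s
≫ t` is an idempotent partial isomorphism, hence a restriction, and its domain is that of `s`. -/
theorem PartialInverse.of_weak {x y : D} {s : x ⟶ y} {t : y ⟶ x} (hs : PartialIso s)
    (ht : PartialIso t) (h : s ≫ t ≫ s = s) (h' : t ≫ s ≫ t = t) : PartialInverse s t := by
  have key : ∀ {x y : D} {s : x ⟶ y} {t : y ⟶ x}, PartialIso s → PartialIso t →
      s ≫ t ≫ s = s → s ≫ t = rest s := by
    intro x y s t hs ht h
    have h₁ : rest (s ≫ t) = s ≫ t := (hs.comp ht).rest_eq_self (by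
      rw [Category.assoc, ← Category.assoc t, ← Category.assoc, h])
    have h₂ : rest s = (s ≫ t) ≫ rest s := by
      rw [← rest_eq_comp h₁, Category.assoc, h]
    rw [h₂, ← h₁, rest_le]
  exact ⟨key hs ht h, key ht hs h'⟩

/-- The restriction of `f` is `f ≫ g` for a partial inverse `g`, and partial inverses are
characterised by equations in composition alone, which any functor preserves. -/
theorem preservesRest_of_partialIso (hi : ∀ {x y : D} (f : x ⟶ y), PartialIso f) (F : D ⥤ E)
    (hF : ∀ {x y : D} (f : x ⟶ y), PartialIso (F.map f)) : PreservesRest F := fun f => by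
  obtain ⟨g, hg⟩ := hi f
  have h : PartialInverse (F.map f) (F.map g) := PartialInverse.of_weak (hF f) (hF g)
    (by rw [← F.map_comp, ← F.map_comp, ← Category.assoc, hg.1, rest_comp])
    (by rw [← F.map_comp, ← F.map_comp, ← Category.assoc, hg.2, rest_comp])
  rw [← h.1, ← F.map_comp, hg.1]

section

variable (hi : ∀ {x y : D} (f : x ⟶ y), PartialIso f) {x : D}

include hi

theorem mInverse_iff {s t : End x} :
    MInverse s t ↔ PartialInverse (show x ⟶ x from s) (show x ⟶ x from t) :=
  ⟨fun h => PartialInverse.of_weak (hi _) (hi _)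
      ((Category.assoc _ _ _).symm.trans ((Category.assoc _ _ _).trans h.1)) h.2,
    fun h => ⟨(Category.assoc _ _ _).symm.trans ((congrArg (· ≫ s) h.1).trans (rest_comp _)),
      (Category.assoc _ _ _).symm.trans ((congrArg (· ≫ t) h.2).trans (rest_comp _))⟩⟩

theorem mLe_iff {s t : End x} : MLe s t ↔ RLe (show x ⟶ x from s) (show x ⟶ x from t) := by
  constructor
  · rintro ⟨s', h, h'⟩
    exact (congrArg (· ≫ t) ((mInverse_iff hi).1 h).1).symm.trans h'
  · intro h
    obtain ⟨s', hs⟩ := hi s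
    exact ⟨s', (mInverse_iff hi).2 hs, (congrArg (· ≫ t) hs.1).trans h⟩

theorem mIsJoin_iff {S : Set (End x)} {j : End x} :
    MIsJoin S j ↔ IsJoin (A := x) (B := x) S j := by
  simp only [MIsJoin, mLe_iff hi]; rfl

theorem mIsMeet_iff {s t m : End x} :
    MIsMeet s t m ↔ IsMeet (A := x) (B := x) s t m := by
  simp only [MIsMeet, mLe_iff hi]; rfl

theorem mBicompatible_iff {s t : End x} :
    MBicompatible s t ↔ Bicompatible (A := x) (B := x) s t := by
  constructor
  · intro h
    obtain ⟨s', hs⟩ := hi s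
    obtain ⟨t', ht⟩ := hi t
    have key : ∀ s' t', PartialInverse (A := x) (B := x) s s' →
        PartialInverse (A := x) (B := x) t t' →
        Compatible (A := x) (B := x) s t ∧ Compatible (A := x) (B := x) s' t' := by
      intro s' t' hs ht
      obtain ⟨h₁, h₂⟩ := h s' t' ((mInverse_iff hi).2 hs) ((mInverse_iff hi).2 ht)
      refine ⟨Eq.symm ?_, Eq.symm ?_⟩
      · rw [← hs.1, ← ht.1]; exact h₁
      · rw [← hs.2, ← ht.2]; exact h₂
    exact ⟨(key s' t' hs ht).1, fun s' t' hs ht => (key s' t' hs ht).2⟩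
  · rintro ⟨h, h'⟩ s' t' hs ht
    have hs := (mInverse_iff hi).1 hs
    have ht := (mInverse_iff hi).1 ht
    have h₁ : rest (A := x) (B := x) t ≫ s = rest (A := x) (B := x) s ≫ t := h
    have h₂ : rest (A := x) (B := x) t' ≫ s' = rest (A := x) (B := x) s' ≫ t' := h' s' t' hs ht
    rw [← hs.1, ← ht.1] at h₁
    rw [← hs.2, ← ht.2] at h₂
    exact ⟨h₁.symm, h₂.symm⟩

end

theorem joinInverseMonoid_end [JoinInverse D] (x : D) : JoinInverseMonoid (End x) :=
  have hi : ∀ {x y : D} (f : x ⟶ y), PartialIso f := fun f => JoinInverse.partialIso f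
  { inverse := fun s =>
      let ⟨t, ht⟩ := hi s
      ⟨t, (mInverse_iff hi).2 ht, fun _ ht' => ((mInverse_iff hi).1 ht').unique ht⟩
    exists_join := fun F h =>
      let ⟨j, hj⟩ := JoinInverse.exists_join (A := x) (B := x) F fun f hf g hg =>
        (mBicompatible_iff hi).1 (h f hf g hg)
      ⟨j, (mIsJoin_iff hi).2 hj⟩
    join_mul := fun g F j h =>
      (mIsJoin_iff hi).2 (JoinInverse.comp_join (A' := x) (A := x) (B := x) g F j
        ((mIsJoin_iff hi).1 h)) }

theorem localic_iff_mLocalic [Subsingleton D] [Subsingleton E]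
    (hD : ∀ {x y : D} (f : x ⟶ y), PartialIso f) (hE : ∀ {x y : E} (f : x ⟶ y), PartialIso f)
    (F : D ⥤ E) (x : D) : Localic F ↔ MLocalic (F.mapEnd x) := by
  constructor
  · rintro ⟨h, -, h'⟩
    refine ⟨fun S j hj => (mIsJoin_iff hE).2 (h _ _ ((mIsJoin_iff hD).1 hj)),
      fun f g m hm => (mIsMeet_iff hE).2 (h'.1 _ _ _ ((mIsMeet_iff hD).1 hm)),
      fun g => (mIsJoin_iff hE).2 ?_⟩
    simp only [mIsMeet_iff hE]
    exact h'.2 (X := x) (Y := x) g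
  · rintro ⟨h, hm, h'⟩
    have hx : ∀ y, y = x := fun y => Subsingleton.elim _ _
    refine ⟨fun {y z} S j hj => ?_, ⟨fun _ _ _ => Subsingleton.elim _ _,
      fun _ => ⟨x, Subsingleton.elim _ _⟩⟩, fun {y z} f g m hfg => ?_, fun {y z} g => ?_⟩
    · obtain rfl := hx y
      obtain rfl := hx z
      exact (mIsJoin_iff hE).1 (h S j ((mIsJoin_iff hD).2 hj))
    · obtain rfl := hx y
      obtain rfl := hx z
      exact (mIsMeet_iff hE).1 (hm f g m ((mIsMeet_iff hD).2 hfg))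
    · obtain rfl := hx y
      obtain rfl := hx z
      have := (mIsJoin_iff hE).1 (h' g)
      simp only [mIsMeet_iff hE] at this
      exact this

end

section InverseMonoid

variable {S : Type w} [Monoid S]

theorem MInverse.symm {s t : S} (h : MInverse s t) : MInverse t s := ⟨h.2, h.1⟩

theorem MInverse.of_idem {e : S} (he : e * e = e) : MInverse e e := by
  simp only [MInverse, he, and_self]

variable [JoinInverseMonoid S]

theorem MInverse.unique {s t t' : S} (h : MInverse s t) (h' : MInverse s t') : t = t' :=
  (JoinInverseMonoid.inverse s).unique h h'

/-- If `x` is the inverse of `e * f`, then so is `f * x * e`, and uniqueness makes them equal. It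
follows that `x` is idempotent, hence its own inverse, and so `e * f = x`. -/
theorem idem_mul_idem {e f : S} (he : e * e = e) (hf : f * f = f) : e * f * (e * f) = e * f := by
  obtain ⟨x, ⟨h₁, h₂⟩, -⟩ := JoinInverseMonoid.inverse (e * f)
  have he' : ∀ z, e * (e * z) = e * z := fun z => by rw [← mul_assoc, he]
  have hf' : ∀ z, f * (f * z) = f * z := fun z => by rw [← mul_assoc, hf]
  have h₂' : ∀ z, x * (e * (f * (x * z))) = x * z := fun z => by
    conv_rhs => rw [← h₂]
    simp only [mul_assoc]
  have hx : x = f * x * e := MInverse.unique (s := e * f) ⟨h₁, h₂⟩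
    ⟨by simpa only [mul_assoc, he', hf'] using h₁, by simp only [mul_assoc, he', hf', h₂']⟩
  have hxx : x * x = x := by
    conv_lhs => rw [hx]
    simp only [mul_assoc, h₂']
    rw [← mul_assoc, ← hx]
  have := (MInverse.of_idem hxx).unique ⟨h₂, h₁⟩
  rw [← this, hxx]

/-- Both `e * f`, being idempotent, and `f * e` are inverses of `e * f`. -/
theorem idem_mul_comm {e f : S} (he : e * e = e) (hf : f * f = f) : e * f = f * e := by
  have h₁ := idem_mul_idem he hf
  have h₂ := idem_mul_idem hf he
  have he' : ∀ z, e * (e * z) = e * z := fun z => by rw [← mul_assoc, he]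
  have hf' : ∀ z, f * (f * z) = f * z := fun z => by rw [← mul_assoc, hf]
  refine (MInverse.of_idem h₁).unique ⟨?_, ?_⟩
  · simpa only [mul_assoc, he', hf'] using h₁
  · simpa only [mul_assoc, he', hf'] using h₂

/-- The inverse of an element of an inverse monoid. -/
noncomputable def minv (s : S) : S := (JoinInverseMonoid.inverse s).choose

theorem mInverse_minv (s : S) : MInverse s (minv s) := (JoinInverseMonoid.inverse s).choose_spec.1

theorem minv_eq {s t : S} (h : MInverse s t) : minv s = t := (mInverse_minv s).unique h

theorem mul_minv_idem (s : S) : s * minv s * (s * minv s) = s * minv s := by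
  rw [← mul_assoc, (mInverse_minv s).1]

theorem minv_mul_idem (s : S) : minv s * s * (minv s * s) = minv s * s := by
  rw [← mul_assoc, (mInverse_minv s).2]

theorem mInverse_mul {f f' g g' : S} (hf : MInverse f f') (hg : MInverse g g') :
    MInverse (g * f) (f' * g') := by
  -- The idempotents `g' * g` and `f * f'` commute, which brings each element next to its own
  -- inverse.
  have e : ∀ z, g' * (g * (f * (f' * z))) = f * (f' * (g' * (g * z))) := fun z => by
    have h₁ : g' * g * (g' * g) = g' * g := by rw [← mul_assoc, hg.2]
    have h₂ : f * f' * (f * f') = f * f' := by rw [← mul_assoc, hf.1]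
    simpa only [mul_assoc] using congrArg (· * z) (idem_mul_comm h₁ h₂)
  have e' : ∀ z, f * (f' * (f * z)) = f * z := fun z => by
    simpa only [mul_assoc] using congrArg (· * z) hf.1
  have e'' : ∀ z, g' * (g * (g' * z)) = g' * z := fun z => by
    simpa only [mul_assoc] using congrArg (· * z) hg.2
  have k₁ : f * (f' * f) = f := by rw [← mul_assoc, hf.1]
  have k₂ : g' * (g * g') = g' := by rw [← mul_assoc, hg.2]
  have k₃ : f' * (f * f') = f' := by rw [← mul_assoc, hf.2]
  have k₄ : ∀ z, g * (g' * (g * z)) = g * z := fun z => by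
    simpa only [mul_assoc] using congrArg (· * z) hg.1
  have k₅ : ∀ z, f' * (f * (f' * z)) = f' * z := fun z => by
    simpa only [mul_assoc] using congrArg (· * z) hf.2
  constructor
  · simp only [mul_assoc]
    rw [← e f, k₄, k₁]
  · simp only [mul_assoc]
    rw [e, k₅, k₂]

/-- An inverse monoid, as a restriction category. -/
noncomputable instance : RestrictionCategory (SingleObj S) where
  rest {_ _} f := (minv (S := S) f * f : S)
  rest_comp {_ _} f := (mul_assoc (G := S) _ _ _).symm.trans (mInverse_minv (S := S) f).1
  rest_comm f g := idem_mul_comm (S := S) (minv_mul_idem (S := S) g) (minv_mul_idem (S := S) f)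
  rest_rest_comp {_ _ _} f g := by
    let e : S := minv (S := S) f * f
    have he : e * e = e := minv_mul_idem (S := S) f
    have h := minv_eq (mInverse_mul (MInverse.of_idem he) (mInverse_minv (S := S) g))
    change minv (S := S) ((g : S) * e) * ((g : S) * e) = (minv (S := S) g * (g : S)) * e
    rw [h, mul_assoc, ← mul_assoc (minv (S := S) g), idem_mul_comm (minv_mul_idem (S := S) g) he,
      ← mul_assoc, he]
  comp_rest {_ _ _} f g := by
    have h := minv_eq (mInverse_mul (mInverse_minv (S := S) f) (mInverse_minv (S := S) g))
    change (minv (S := S) g * (g : S)) * (f : S) =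
      (f : S) * (minv (S := S) ((g : S) * (f : S)) * ((g : S) * (f : S)))
    rw [h]
    have e := idem_mul_comm (minv_mul_idem (S := S) g) (mul_minv_idem (S := S) f)
    calc (minv (S := S) g * (g : S)) * (f : S)
        = (minv (S := S) g * (g : S)) * ((f : S) * minv (S := S) f * (f : S)) := by
          rw [(mInverse_minv (S := S) f).1]
      _ = ((minv (S := S) g * (g : S)) * ((f : S) * minv (S := S) f)) * (f : S) := by
          simp only [mul_assoc]
      _ = _ := by rw [e]; simp only [mul_assoc]

theorem singleObj_partialIso {x y : SingleObj S} (f : x ⟶ y) : PartialIso f :=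
  ⟨minv (S := S) f, rfl, (congrArg (fun z : S => z * minv (S := S) f)
    (minv_eq (mInverse_minv (S := S) f).symm)).symm⟩

instance : JoinInverse (SingleObj S) where
  partialIso f := singleObj_partialIso f
  exists_join {x _} F h :=
    have H : ∀ F : Set S, (∀ f ∈ F, ∀ g ∈ F, MBicompatible f g) → ∃ j, MIsJoin F j :=
      JoinInverseMonoid.exists_join
    let ⟨j, hj⟩ := H F fun f hf g hg =>
      (mBicompatible_iff singleObj_partialIso (x := x)).2 (h f hf g hg)
    ⟨j, (mIsJoin_iff singleObj_partialIso (x := x)).1 hj⟩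
  comp_join {_ x _} g F j h := (mIsJoin_iff singleObj_partialIso (x := x)).1
    (JoinInverseMonoid.join_mul (S := S) g F j
      ((mIsJoin_iff singleObj_partialIso (x := x)).2 h))

end InverseMonoid

end EtaleCat

/-! ### Complete pseudogroups. -/

namespace EtaleCat

open RestrictionCategory PartiteCat

section

variable {C : Type u} [Category.{v} C] [RestrictionCategory C]

theorem partialAut_idem_iff {X : C} (s : partialAut X) :
    s * s = s ↔ rest (A := X) (B := X) s.1 = s.1 := by
  rw [← Subtype.coe_inj]
  exact ⟨fun h => PartialIso.rest_eq_self h s.2, fun h => idem_idem (A := X) h⟩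

namespace MonOver

/-- A monoid over `C`, as a functor. -/
def proj (M : MonOver C) : SingleObj M.carrier ⥤ C where
  obj _ := M.X
  map s := (M.θ s).1
  map_id _ := congrArg Subtype.val (map_one M.θ)
  map_comp s t := congrArg Subtype.val (M.θ.map_mul' t s)

section

variable (M : MonOver C) [JoinInverseMonoid M.carrier]

/-- An inverse monoid over `C`, as a restriction category over `C`. -/
noncomputable def toOver : RCatOver.{0} C where
  carrier := SingleObj M.carrier
  proj := M.proj
  proj_rest := preservesRest_of_partialIso (D := SingleObj M.carrier) singleObj_partialIso M.proj
    fun s => (M.θ s).2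

theorem singleObj_rest_iff {x : SingleObj M.carrier} {e : M.carrier} :
    rest (A := x) (B := x) e = e ↔ e * e = e :=
  ⟨fun h => idem_idem (A := x) h, fun h =>
    PartialIso.rest_eq_self (x := x) h (singleObj_partialIso _)⟩

theorem jihcon_toOver (hM : Set.BijOn M.θ {e | e * e = e} {e | e * e = e}) :
    jihcon C M.toOver :=
  ⟨inferInstanceAs (JoinInverse (SingleObj M.carrier)), Hyperconnected.of_exists M.toOver.proj_rest
    (fun hd he h => hM.injOn ((M.singleObj_rest_iff).1 hd) ((M.singleObj_rest_iff).1 he)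
      (Subtype.ext h))
    fun e he => by
      have he' : rest (A := M.X) (B := M.X) e = e := he
      obtain ⟨d, hd, h⟩ := hM.surjOn (a := ⟨e, he' ▸ PartialIso.rest (A := M.X) (B := M.X) e⟩)
        ((partialAut_idem_iff _).2 he)
      exact ⟨d, (M.singleObj_rest_iff).2 hd, congrArg Subtype.val h⟩⟩

variable {M} {N : MonOver C} [JoinInverseMonoid N.carrier]

/-- A map of inverse monoids over `C`, as a map of restriction categories over `C`. -/
noncomputable def Hom.toOver (f : M ⟶ N) : M.toOver ⟶ N.toOver where
  functor :=
    { obj := fun _ => SingleObj.star N.carrier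
      map := fun s => f.hom s
      map_id := fun _ => map_one f.hom
      map_comp := fun s t => f.hom.map_mul' t s }
  functor_rest := preservesRest_of_partialIso (D := SingleObj M.carrier)
    (E := SingleObj N.carrier) singleObj_partialIso
    { obj := fun _ => SingleObj.star N.carrier
      map := fun s => f.hom s
      map_id := fun _ => map_one f.hom
      map_comp := fun s t => f.hom.map_mul' t s } fun _ => singleObj_partialIso _
  trans :=
    { app := fun _ => f.map
      naturality := fun _ _ s => (f.comm s).symm }
  trans_total := fun _ => f.map_total

theorem localic_toOver (f : M ⟶ N) : localic C (Hom.toOver f) ↔ mLocalic C f :=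
  have : Subsingleton (SingleObj M.carrier) := inferInstanceAs (Subsingleton PUnit)
  have : Subsingleton (SingleObj N.carrier) := inferInstanceAs (Subsingleton PUnit)
  localic_iff_mLocalic (D := SingleObj M.carrier) (E := SingleObj N.carrier)
    singleObj_partialIso singleObj_partialIso (Hom.toOver f).functor (SingleObj.star _)

end

/-- Monoids over `C` are isomorphic if there are maps inverse to each other in both components. -/
def isoMk {M N : MonOver C} (f : M ⟶ N) (g : N.carrier → M.carrier)
    (h : ∀ s, g (f.hom s) = s) (h' : ∀ t, f.hom (g t) = t) (k : M.X ⟶ N.X) (hk : f.map ≫ k = 𝟙 _)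
    (hk' : k ≫ f.map = 𝟙 _) : M ≅ N where
  hom := f
  inv :=
    { hom := (MulEquiv.symm ⟨⟨f.hom, g, h, h'⟩, map_mul f.hom⟩).toMonoidHom
      map := k
      map_total := Total.of_comp (g := f.map) (by rw [hk']; exact Total.id _)
      comm := fun t => by
        have e := f.comm (g t)
        rw [h'] at e
        have : IsIso f.map := ⟨k, hk, hk'⟩
        rw [← cancel_mono f.map, ← cancel_epi f.map]
        simp only [Category.assoc, hk', Category.comp_id]
        rw [← Category.assoc, hk, Category.id_comp]
        exact e.symm }
  hom_inv_id := MonOver.Hom.ext' h hk'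
  inv_hom_id := MonOver.Hom.ext' h' hk

end MonOver

/-- Complete pseudogroups, as join inverse categories over `C`. -/
noncomputable def psGrpOver (C : Type u) [Category.{v} C] [RestrictionCategory C] :
    (psGrp C).FullSubcategory ⥤ (jihcon.{0} C).FullSubcategory where
  obj M :=
    have := M.property.1
    ⟨M.obj.toOver, M.obj.jihcon_toOver M.property.2⟩
  map {M N} f :=
    have := M.property.1
    have := N.property.1
    ObjectProperty.homMk (MonOver.Hom.toOver f.hom)
  map_id _ := ObjectProperty.hom_ext _ (RCatOver.Hom.ext'
    (CategoryTheory.Functor.hext (fun _ => rfl) fun _ _ _ => HEq.rfl) fun _ => (Category.id_comp _).symm)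
  map_comp _ _ := ObjectProperty.hom_ext _ (RCatOver.Hom.ext'
    (CategoryTheory.Functor.hext (fun _ => rfl) fun _ _ _ => HEq.rfl)
    fun _ => ((Category.id_comp _).trans (Category.id_comp _)).symm)

/-- Through the passage to one-object categories, closure of localic maps under composition is
inherited from restriction categories over `C`. -/
theorem mLocalic_inverseImage : (mLocalic C).inverseImage (psGrp C).ι =
    ((localic C).inverseImage (jihcon C).ι).inverseImage (psGrpOver C) := by
  ext M N f
  have := M.property.1
  have := N.property.1
  exact (MonOver.localic_toOver f.hom).symm

variable [JoinRestriction C]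

theorem isMultiplicative_mLocalic : ((mLocalic C).inverseImage (psGrp C).ι).IsMultiplicative := by
  have := isMultiplicative_localic (C := C) jihcon_le.{0}
  rw [mLocalic_inverseImage]
  infer_instance

theorem mLocalic_iso {M N : MonOver C} (hM : psGrp C M) (hN : psGrp C N) (e : M ≅ N) :
    mLocalic C e.hom := by
  have := hM.1
  have := hN.1
  let e' : (⟨M, hM⟩ : (psGrp C).FullSubcategory) ≅ ⟨N, hN⟩ := (psGrp C).isoMk e
  exact (MonOver.localic_toOver e.hom).1 (localic_iso jihcon_le ((psGrpOver C).obj ⟨M, hM⟩).property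
    ((psGrpOver C).obj ⟨N, hN⟩).property ((jihcon C).ι.mapIso ((psGrpOver C).mapIso e')))

theorem mLocalic_respectsIso : ((mLocalic C).inverseImage (psGrp C).ι).RespectsIso :=
  respectsIso_inverseImage isMultiplicative_mLocalic fun hA hB e => mLocalic_iso hA hB e

instance (A : EtaleGpd C) : Subsingleton ((externalisationG C).obj A.toPGpd).carrier :=
  have : Subsingleton (Ext A.cat) := ⟨fun ⟨_⟩ ⟨_⟩ => rfl⟩
  have : Subsingleton (Bis ((externalisation C).obj A.toPGpd.obj)) :=
    ⟨fun ⟨x⟩ ⟨y⟩ => congrArg Bis.mk (Subsingleton.elim (α := Ext A.cat) x y)⟩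
  this

theorem partialIso_externalisationG (A : (IsPGpd.{w} C).FullSubcategory)
    {x y : ((externalisationG C).obj A).carrier} (f : x ⟶ y) : PartialIso f :=
  have := (jihcon_externalisationG A).1
  JoinInverse.partialIso f

theorem psGrp_bisections (A : EtaleGpdCof C) : psGrp C ((bisections C).obj A) := by
  have hA := jihcon_externalisationG (EtaleGpd.toPGpd A)
  have := hA.1
  have hr : ∀ e : End (EtaleGpd.pt A), e * e = e ↔
      rest (A := EtaleGpd.pt A) (B := EtaleGpd.pt A) e = e := fun e =>
    ⟨fun h => PartialIso.rest_eq_self h (partialIso_externalisationG _ _),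
      fun h => idem_idem (A := EtaleGpd.pt A) h⟩
  have hc := hA.2 (EtaleGpd.pt A)
  refine ⟨joinInverseMonoid_end _, fun e he => ?_, fun d hd e he h => ?_, fun e he => ?_⟩
  · exact (partialAut_idem_iff _).2 (hc.mapsTo ((hr e).1 he))
  · exact hc.injOn ((hr d).1 hd) ((hr e).1 he) (congrArg Subtype.val h)
  · obtain ⟨d, hd, h⟩ := hc.surjOn ((partialAut_idem_iff e).1 he)
    exact ⟨d, (hr d).2 hd, Subtype.ext h⟩

theorem bijCA_iff_mLocalic {A B : EtaleGpdCof C} (F : A ⟶ B) :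
    bijCA C F.hom.hom ↔ mLocalic C ((bisections C).map F) :=
  (bijCA_iff_localicG (A := EtaleGpd.toPGpd A) (B := EtaleGpd.toPGpd B) (EtaleGpd.etale A)
    (EtaleGpd.etale B) F.hom).trans
    (localic_iff_mLocalic (partialIso_externalisationG _) (partialIso_externalisationG _)
      ((externalisationG C).map F.hom).functor (EtaleGpd.pt A))

theorem bisections_injective {A B : EtaleGpdCof C} {F G : A ⟶ B}
    (h : (bisections C).map F = (bisections C).map G) : F = G := by
  apply InducedCategory.hom_ext
  refine externalisationG_injective (EtaleGpd.etale A) (RCatOver.Hom.ext'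
    (CategoryTheory.Functor.hext (fun _ => rfl) fun _ _ s => heq_of_eq ?_) fun _ => ?_)
  · exact DFunLike.congr_fun (congrArg (fun k : MonOver.Hom _ _ => k.hom) h) s
  · exact (congrArg (fun k : MonOver.Hom _ _ => k.map) h).trans (Category.id_comp _).symm

theorem bisections_surjective {A B : EtaleGpdCof C}
    (f : (bisections C).obj A ⟶ (bisections C).obj B) : ∃ F, (bisections C).map F = f := by
  let T : ((externalisationG C).obj (EtaleGpd.toPGpd A)).carrier ⥤
      ((externalisationG C).obj (EtaleGpd.toPGpd B)).carrier :=
    { obj := fun _ => EtaleGpd.pt B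
      map := fun s => f.hom s
      map_id := fun _ => map_one f.hom
      map_comp := fun s t => f.hom.map_mul' t s }
  let H : RCatOver.Hom ((externalisationG C).obj (EtaleGpd.toPGpd A))
      ((externalisationG C).obj (EtaleGpd.toPGpd B)) :=
    { functor := T
      -- A homomorphism is not assumed to preserve restrictions; for inverse categories this is
      -- automatic.
      functor_rest := preservesRest_of_partialIso (partialIso_externalisationG _) T
        fun _ => partialIso_externalisationG _ _
      trans :=
        { app := fun _ => f.map
          naturality := fun _ _ s => (f.comm s).symm }
      trans_total := fun _ => f.map_total }
  obtain ⟨F, hF⟩ := externalisationG_surjective (EtaleGpd.etale A) H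
  refine ⟨InducedCategory.homMk F, MonOver.Hom.ext' (fun s => ?_) ?_⟩
  · exact eq_of_heq (congr_arg_heq (fun x : RCatOver.Hom _ _ =>
      x.functor.map (X := EtaleGpd.pt A) (Y := EtaleGpd.pt A) s) hF)
  · exact eq_of_heq (congr_arg_heq (fun x : RCatOver.Hom _ _ => x.trans.app (EtaleGpd.pt A)) hF)

variable [HasLocalGlueings C]

/-- The internal groupoid glued from the one-object category of `M` has `M` as its monoid of partial
bisections, acting on the same object of `C`. -/
theorem exists_iso_bisections (M : MonOver C) (hM : psGrp C M) :
    ∃ A : EtaleGpdCof C, Nonempty ((bisections C).obj A ≅ M) := by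
  have := hM.1
  have hj := M.jihcon_toOver hM.2
  have := hj.1
  have := BoundedJoins.of_joinInverse M.toOver.carrier
  have hi : ∀ {x y : M.toOver.carrier} (f : x ⟶ y), PartialIso f := fun f => JoinInverse.partialIso f
  obtain ⟨D⟩ := exists_glueing M.toOver.proj_rest
  let e := D.isoExtG hj.2 hi (D.exists_eq_of_partialIso M.toOver.proj_rest hj.2)
  -- The components of this groupoid are the objects of `SingleObj M.carrier`, a type that unfolds
  -- to the one-point type.
  let A : EtaleGpd C := ⟨D.cat M.toOver.proj_rest, D.cat_sourceEtale _, D.cat_isGroupoid _ hi⟩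
  let x : M.toOver.carrier := SingleObj.star M.carrier
  let N : M ⟶ (bisections C).obj A :=
    { hom :=
        { toFun := fun s => e.hom.functor.map (X := x) (Y := x) s
          map_one' := e.hom.functor.map_id x
          map_mul' := fun s t => e.hom.functor.map_comp (X := x) (Y := x) (Z := x) t s }
      map := 𝟙 M.X
      map_total := Total.id _
      comm := fun s => (e.hom.trans.naturality (X := x) (Y := x) s).symm }
  have h : Function.Bijective N.hom :=
    ⟨fun s t h => e.hom.functor.map_injective (X := x) (Y := x) h,
      fun t => e.hom.functor.map_surjective (X := x) (Y := x) t⟩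
  obtain ⟨g, hg, hg'⟩ := Function.bijective_iff_has_inverse.1 h
  exact ⟨A, ⟨(MonOver.isoMk N g hg hg' (𝟙 M.X) (Category.id_comp _) (Category.id_comp _)).symm⟩⟩

theorem isEquivalence_bisections :
    ((psGrp C).lift (bisections C) psGrp_bisections).IsEquivalence :=
  isEquivalence_lift _ bisections_injective bisections_surjective exists_iso_bisections

theorem isEquivOnto_bisections :
    IsEquivOnto (bisections C) (psGrp C) ∧
      Matches (bisections C) (psGrp C)
        ((bijCA C).inverseImage (inducedFunctor EtaleGpd.toPGpd ⋙ (IsPGpd C).ι)) (mLocalic C) :=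
  ⟨⟨_, isEquivalence_bisections⟩,
    matches_of_isEquivalence isEquivalence_bisections bijCA_iff_mLocalic mLocalic_respectsIso⟩

theorem isEquivOntoWide_bisections :
    IsEquivOntoWide (gpdCoveringToCofunctor C ⋙ bisections C) (psGrp C) (mLocalic C) :=
  isEquivOntoWide_comp isEquivalence_bisections isMultiplicative_mLocalic
    (fun hA hB e => mLocalic_iso hA hB e)
    (fun {X Y f g} h => Quiver.Hom.unop_inj (InducedCategory.hom_ext (Quiver.Hom.op_inj
      (coveringToCofunctor_injective (congrArg (fun k => k.hom.hom) h)))))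
    (fun f => (bijCA_iff_mLocalic _).1 (bijCA_coveringToCofunctor f.unop.hom.op))
    (fun {X Y} g h => by
      obtain ⟨f, hf⟩ := coveringToCofunctor_surjective (A := op (EtaleGpd.toPCov X.unop))
        (B := op (EtaleGpd.toPCov Y.unop)) g.hom.hom ((bijCA_iff_mLocalic g).2 h)
      exact ⟨(show Y.unop ⟶ X.unop from InducedCategory.homMk f.unop).op,
        InducedCategory.hom_ext (ObjectProperty.hom_ext _ hf)⟩)
    fun Y => ⟨op Y, rfl⟩

end

end EtaleCat

theorem mainTheorem7 {C : Type u} [Category.{v} C] [RestrictionCategory C] [JoinRestriction C]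
    [HasLocalGlueings C] :
    -- covering functors are, contravariantly, the cofunctors bijective on components and arrows
    IsIsoOntoWide (coveringToCofunctor.{w} C) (bijCA C) ∧
    -- source-étale partite internal categories
    (IsEquivOnto (etaleExt.{w} C) (hcon C) ∧
      Matches (etaleExt.{w} C) (hcon C) ((bijComp C).inverseImage (IsEtale C).ι) (overBijObj C) ∧
      Matches (etaleExt.{w} C) (hcon C) ((bijObj C).inverseImage (IsEtale C).ι) (overIso C) ∧
      Matches (etaleExt.{w} C) (hcon C) ((bijArr C).inverseImage (IsEtale C).ι) (overMeet C) ∧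
      Matches (etaleExt.{w} C) (hcon C) ((bijCA C).inverseImage (IsEtale C).ι) (localic C) ∧
      IsEquivOntoWide (coveringToCofunctorOf (IsEtale.{w} C) ⋙ etaleExt C)
        (hcon C) (localic C)) ∧
    -- étale partite internal groupoids
    (IsEquivOnto (etaleExtG.{w} C) (jihcon C) ∧
      Matches (etaleExtG.{w} C) (jihcon C) ((bijCA C).inverseImage (IsEtaleGpd C).ι) (localic C) ∧
      IsEquivOntoWide (coveringToCofunctorOf (IsEtaleGpd.{w} C) ⋙ etaleExtG C)
        (jihcon C) (localic C)) ∧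
    -- étale internal groupoids and pseudogroups
    (IsEquivOnto (bisections C) (psGrp C) ∧
      Matches (bisections C) (psGrp C)
        ((bijCA C).inverseImage (inducedFunctor EtaleGpd.toPGpd ⋙ (IsPGpd C).ι)) (mLocalic C) ∧
      IsEquivOntoWide (gpdCoveringToCofunctor C ⋙ bisections C) (psGrp C) (mLocalic C)) :=
  ⟨isIsoOntoWide_coveringToCofunctor,
    ⟨isEquivOnto_etaleExt.1, isEquivOnto_etaleExt.2.1, isEquivOnto_etaleExt.2.2.1,
      isEquivOnto_etaleExt.2.2.2.1, isEquivOnto_etaleExt.2.2.2.2, isEquivOntoWide_etaleExt⟩,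
    ⟨isEquivOnto_etaleExtG.1, isEquivOnto_etaleExtG.2, isEquivOntoWide_etaleExtG⟩,
    isEquivOnto_bisections.1, isEquivOnto_bisections.2, isEquivOntoWide_bisections⟩
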